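/- **Setting.** Let $\mathcal L$ be a connected oriented link diagram on the sphere with $n_+$ positive and $n_-$ negative crossings, with a checkerboard colouring, a fixed dotted arc, and a linear ordering of its crossings. The Tait graph $G=G_{\mathcal L}$ has the black regions as vertices and the crossings as edges; an edge is positive if the $A$-smoothing of its crossing joins the two black corners there, and negative otherwise. A spanning subgraph $H$ of $G$ corresponds to the resolved state in which a positive edge is $A$-smoothed iff it lies in $H$, and a negative edge is $A$-smoothed iff it does not lie in $H$. The faces $F(H)$ of the components of $H$ correspond to the circles of this state. *Reduced Khovanov complex.* An enhanced spanning subgraph is a pair $(H,\epsilon)$ with $\epsilon\colon F(H)\to\{1,x\}$; its bidegree is $$i=\#\{\text{positive edges}\notin H\}+\#\{\text{negative edges}\in H\}-n_-,\qquad j=i+|\epsilon^{-1}(1)|-|\epsilon^{-1}(x)|+n_+-n_-.$$ $\mathrm{CKh}^+(\mathcal L)$ is the bigraded free abelian group on those $(H,\epsilon)$ for which the face containing the dotted arc has label $1$. Its differential $\partial^+_{\mathrm{Kh}}$ changes an $A$-smoothed crossing $e$ into a $B$-smoothed one in all possible ways, with sign $(-1)^{\#\{f<e\,:\,f\ B\text{-smoothed}\}}$,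 by the maps $m(1,1)=1$, $m(1,x)=m(x,1)=x$, $m(x,x)=0$ if two faces merge, and $\Delta(1)=1\otimes x+x\otimes 1$, $\Delta(x)=x\otimes x$ if a face splits; terms in which the dotted face has label $x$ are dropped. $\mathrm{Kh}^+(\mathcal L)$ is its cohomology. *Matching.* Let $T$ be a spanning tree of $G$. An edge $e\in T$ is internally active ($L$) if it is the smallest edge that connects the two components of $T\setminus e$, and otherwise internally inactive ($D$); an edge $e\notin T$ is externally active ($l$) if it is the smallest edge of the cycle in $T\cup e$, and otherwise externally inactive ($d$). Edges of type $L,l$ are live, those of type $D,d$ are dead. To positive edges of type $L,D,l,d$ one assigns the smoothings $B,A,A,B$, to negative ones $A,B,B,A$. Smoothing the dead edges in this way gives the twisted unknot $U(T)$; $\mathrm{CKh}^+(U(T))\subset\mathrm{CKh}^+(\mathcal L)$ denotes the span of the $(H,\epsilon)$ with these smoothings at all dead edges. Smoothing the live edges too yields a set of circles, which are the vertices of a tree $G(T)$; its edges are the live edges, each joining the two circles that meet at its crossing; its root $v_d$ is the circle with the dotted arc. The states of $U(T)$ correspond to the spanning subgraphs of $G(T)$: a live edge belongs to the subgraph iff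 its smoothing is opposite to the assigned one. A live edge is a negative twist if its assigned smoothing is $B$, and a positive twist if it is $A$. The elements of $\mathrm{CKh}^+(U(T))$ are matched recursively. Let $e$ be the least leaf edge of $G(T)$ whose degree-one vertex $v$ is not $v_d$. Each $(H,\epsilon)$ containing $e$ is matched with the one obtained by removing $e$, where $v$ gets the label $x$ if $e$ is a negative twist and $1$ if it is a positive twist, and all other labels stay the same. The remaining ones, in which $v$ is isolated with label $1$ (negative twist) or $x$ (positive twist), are matched by the matching for the tree $G(T)\setminus v$. Let $\mathcal M$ be the union of these matchings over all spanning trees $T$. *Reduced spanning tree complex.* In the Hasse diagram of $(\mathrm{CKh}^+(\mathcal L),\partial^+_{\mathrm{Kh}})$ (edges $c\to c'$ with weight the incidence number $[c:c']\ne0$) reverse the edges of $\mathcal M$ and give a reversed edge $c'\to c$ the weight $-1/[c:c']$. For $c,c'$ let $\Gamma(c,c')$ be the sum, over all directed paths from $c$ to $c'$ in the resulting graph, of the products of the edge weights. For a spanning tree $T$ let $S_c^{T^+}$ be the element of $\mathrm{CKh}^+(U(T))$ that $\mathcal M$ leaves unmatched. $\mathrm{CST}^+(G)$ is the free abelian group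 on the spanning trees $T$ of $G$, where $T$ has the bidegree of $S_c^{T^+}$, with $$\partial^+_{ST}(T)=\sum_{T'\,:\,i(T')=i(T)+1}\Gamma\bigl(S_c^{T^+},S_c^{T'^+}\bigr)\,T'.$$ **Theorem.** $\mathcal M$ is an acyclic matching on the Hasse diagram of $(\mathrm{CKh}^+(\mathcal L),\partial^+_{\mathrm{Kh}})$, and for each spanning tree $T$ exactly one basis element of $\mathrm{CKh}^+(U(T))$ is unmatched, so that $\mathrm{CST}^+(G)$ and $\partial^+_{ST}$ are well defined. Moreover $(\mathrm{CKh}^+(\mathcal L),\partial^+_{\mathrm{Kh}})$ and $(\mathrm{CST}^+(G),\partial^+_{ST})$ are complexes, and for all $i,j$ $$H^{i,j}\bigl(\mathrm{CST}^+(G_{\mathcal L}),\partial^+_{ST}\bigr)\;\cong\;\mathrm{Kh}^{+\,i,j}(\mathcal L).$$ -/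

import Mathlib

/-! ## Based bigraded complexes, Hasse diagrams and Morse complexes -/

/-- Combinatorial data of a bigraded complex of free abelian groups with a chosen finite basis `V`:
a homological degree `deg`, a quantum degree `qdeg` and the incidence numbers `inc v w = [v : w]`,
i.e. `∂ v = ∑ w, [v : w] w`. -/
structure BasedComplex (V : Type*) where
  deg : V → ℤ
  qdeg : V → ℤ
  inc : V → V → ℤ

namespace BasedComplex

variable {V : Type*} (K : BasedComplex V)

/-- The basis of the part of bidegree `(i, j)`. -/
abbrev Basis (i j : ℤ) : Type _ := {v : V // K.deg v = i ∧ K.qdeg v = j}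

/-- The chain group `C^{i,j}`, free abelian on the basis elements of bidegree `(i, j)`. -/
abbrev Chain (i j : ℤ) : Type _ := K.Basis i j →₀ ℤ

variable [Finite V]

/-- The linear map `C^{i,j} → C^{i',j}` with matrix the incidence numbers; for `i' = i + 1` it is
the differential `∂^{i,j}`. -/
noncomputable def d (i i' j : ℤ) : K.Chain i j →ₗ[ℤ] K.Chain i' j :=
  Finsupp.linearCombination ℤ fun v : K.Basis i j =>
    Finsupp.equivFunOnFinite.symm fun w : K.Basis i' j => K.inc v.1 w.1

/-- `∂ ∘ ∂ = 0`. -/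
def IsComplex : Prop :=
  ∀ i j : ℤ, K.d i (i + 1) j ∘ₗ K.d (i - 1) i j = 0

/-- The cohomology group `H^{i,j} = ker ∂^{i,j} / im ∂^{i-1,j}`. -/
abbrev Cohomology (i j : ℤ) : Type _ :=
  LinearMap.ker (K.d i (i + 1) j) ⧸
    (LinearMap.range (K.d (i - 1) i j)).comap (LinearMap.ker (K.d i (i + 1) j)).subtype

end BasedComplex

namespace BasedComplex

variable {V : Type*} (K : BasedComplex V)

/-- The edges `v → w` of the Hasse diagram. -/
def HasseEdge (v w : V) : Prop := K.deg w = K.deg v + 1 ∧ K.inc v w ≠ 0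

/-- The edges of the Hasse diagram in which the edges of `M` have been reversed. -/
def MorseEdge (M : V → V → Prop) (v w : V) : Prop :=
  (K.HasseEdge v w ∧ ¬ M v w) ∨ M w v

/-- `M` is an acyclic matching on the Hasse diagram of `K`. -/
structure IsAcyclicMatching (M : V → V → Prop) : Prop where
  hasseEdge : ∀ v w, M v w → K.HasseEdge v w
  /-- every vertex lies in at most one edge of `M` -/
  matching : ∀ v w v' w', M v w → M v' w' → (v = v' ∨ v = w' ∨ w = v' ∨ w = w') → v = v' ∧ w = w'
  isUnit : ∀ v w, M v w → IsUnit (K.inc v w)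
  /-- there is no directed cycle after reversing the edges of `M` -/
  acyclic : ∀ v, ¬ Relation.TransGen (K.MorseEdge M) v v

/-- A vertex that lies in no edge of `M`. -/
def IsCritical (M : V → V → Prop) (v : V) : Prop := ∀ w, ¬ M v w ∧ ¬ M w v

open Classical in
/-- The weight of the edge `v → w`: it is `-[w : v]⁻¹` on a reversed edge, and `[v : w]` on
any other one. -/
noncomputable def weight (M : V → V → Prop) (v w : V) : ℤ :=
  if M w v then - Ring.inverse (K.inc w v) else K.inc v w

/-- The weight of a path is the product of the weights of its edges. -/
noncomputable def pathWeight (M : V → V → Prop) : List V → ℤ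
  | [] => 1
  | [_] => 1
  | v :: w :: p => K.weight M v w * pathWeight M (w :: p)

/-- The directed paths from `v` to `w` after reversing the edges of `M`, as lists of vertices. -/
def paths (M : V → V → Prop) (v w : V) : Set (List V) :=
  {p | p.IsChain (K.MorseEdge M) ∧ p.head? = some v ∧ p.getLast? = some w}

/-- `Γ(v, w)`, the sum of the weights of all directed paths from `v` to `w`. (If `V` is finite and
`M` is an acyclic matching, there are finitely many such paths.) -/
noncomputable def Gamma (M : V → V → Prop) (v w : V) : ℤ :=
  ∑ᶠ p ∈ K.paths M v w, K.pathWeight M p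

end BasedComplex

/-! ## Connected link diagrams and checkerboard colourings -/

/-- A connected oriented link diagram on the sphere, given by its oriented planar diagram code:
a set `Arc` of arcs (running from crossing to crossing), a set `C` of crossings, and for every
crossing the four arc ends around it, in counterclockwise order. The ends `0, 2` form the
under-strand, the ends `1, 3` the over-strand. A diagram without crossings is a single
circle, which is then its only arc. -/
structure ConnectedLinkDiagram (Arc C : Type*) where
  /-- the arc at the `k`-th end of the crossing `c` -/
  arc : C → Fin 4 → Arc
  /-- whether the orientation of the link leaves the crossing `c` at its `k`-th end -/
  out : C → Fin 4 → Bool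
  /-- the orientation runs straight through each crossing -/
  out_opposite : ∀ c k, out c (k + 2) = !out c k
  /-- an arc either is a closed circle without crossings or begins at exactly one crossing end and
  terminates at exactly one crossing end -/
  arc_ends : ∀ a, (∀ c k, arc c k ≠ a) ∨
    ((∃! p : C × Fin 4, arc p.1 p.2 = a ∧ out p.1 p.2 = true) ∧
      (∃! p : C × Fin 4, arc p.1 p.2 = a ∧ out p.1 p.2 = false))
  /-- the diagram is connected -/
  connected : ∀ a b, Relation.EqvGen (fun a b => ∃ c k l, arc c k = a ∧ arc c l = b) a b
  /-- The diagram lies on a sphere: with `n` crossings it has `n + 2` regions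
  (Euler's formula, a connected 4-valent graph with `n ≥ 1` vertices having `2 n` edges). A region is
  a class of sides of arcs, `(a, true)` being the left side of the oriented arc `a` and
  `(a, false)` its right side; the sides that face each other in the corner between the ends
  `k` and `k + 1` of a crossing bound the same region. -/
  planar : Nat.card (Quot fun s t : Arc × Bool =>
    ∃ c k, s = (arc c k, out c k) ∧ t = (arc c (k + 1), !out c (k + 1))) = Nat.card C + 2

/-- The two smoothings of a crossing. -/
inductive Smoothing
  | A
  | B
  deriving DecidableEq

/-- The two labels of a face. -/
inductive Label
  | one
  | x
  deriving DecidableEq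

/-- `m(1,1) = 1`, `m(1,x) = m(x,1) = x` and `m(x,x) = 0`. -/
def Label.merge : Label → Label → Option Label
  | .one, l => some l
  | .x, .one => some .x
  | .x, .x => none

/-- The terms of `Δ(1) = 1 ⊗ x + x ⊗ 1` and of `Δ(x) = x ⊗ x`. -/
def Label.split : Label → Set (Label × Label)
  | .one => {(.one, .x), (.x, .one)}
  | .x => {(.x, .x)}

/-- The activities: internally active (`L`) or inactive (`D`), externally active (`l`)
or inactive (`d`). -/
inductive Activity
  | L
  | D
  | l
  | d

/-- The smoothing assigned to an edge from its sign and its activity. -/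
def Activity.smoothing (positive : Bool) : Activity → Smoothing
  | .L => if positive then .B else .A
  | .D => if positive then .A else .B
  | .l => if positive then .A else .B
  | .d => if positive then .B else .A

namespace ConnectedLinkDiagram

variable {Arc C : Type*} (D : ConnectedLinkDiagram Arc C)

/-- The regions of the diagram. -/
def Region : Type _ := Quot fun s t : Arc × Bool =>
  ∃ c k, s = (D.arc c k, D.out c k) ∧ t = (D.arc c (k + 1), !D.out c (k + 1))

/-- The region on the left side (`true`) or on the right side (`false`) of an arc. -/
def region (a : Arc) (side : Bool) : D.Region := Quot.mk _ (a, side)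

/-- The region in the corner of the crossing `c` between its ends `k` and `k + 1`. -/
def corner (c : C) (k : Fin 4) : D.Region := D.region (D.arc c k) (D.out c k)

theorem corner_eq (c : C) (k : Fin 4) :
    D.corner c k = D.region (D.arc c (k + 1)) (!D.out c (k + 1)) :=
  Quot.sound ⟨c, k, rfl, rfl⟩

/-- A checkerboard colouring: any two regions that share an arc have different colours. -/
structure Checkerboard where
  black : D.Region → Bool
  black_ne : ∀ a, black (D.region a true) ≠ black (D.region a false)

/-- A crossing is positive if the smoothing that is compatible with the orientation
joins the ends `0, 1` and the ends `2, 3`. -/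
def IsPositiveCrossing (c : C) : Prop := D.out c 0 ≠ D.out c 1

/-- `n₊` -/
noncomputable def nPlus : ℕ := Nat.card {c // D.IsPositiveCrossing c}

/-- `n₋` -/
noncomputable def nMinus : ℕ := Nat.card {c // ¬ D.IsPositiveCrossing c}

end ConnectedLinkDiagram

namespace ConnectedLinkDiagram.Checkerboard

variable {Arc C : Type*} {D : ConnectedLinkDiagram Arc C} (χ : D.Checkerboard)

/-! ## The Tait graph, its spanning trees and their activities -/

/-- The sign of the edge `c` of the Tait graph: `true` (positive) if the `A`-smoothing of the
crossing `c` connects the two black corners. The `A`-smoothing connects the two corners that the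
over-strand sweeps when it is rotated counterclockwise, i.e. the corners `1` and `3`. -/
def positive (c : C) : Bool := χ.black (D.corner c 1)

/-- The first black corner at a crossing; the other one is opposite to it. -/
def blackCorner (c : C) : Fin 4 := if χ.positive c then 1 else 0

theorem black_succ (c : C) (k : Fin 4) :
    χ.black (D.corner c (k + 1)) = !χ.black (D.corner c k) := by
  rw [D.corner_eq c k, ConnectedLinkDiagram.corner]
  have h := χ.black_ne (D.arc c (k + 1))
  cases D.out c (k + 1)
  · exact Bool.eq_not.mpr fun h' => h h'.symm
  · exact Bool.eq_not.mpr h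

theorem black_blackCorner (c : C) :
    χ.black (D.corner c (χ.blackCorner c)) = true ∧
      χ.black (D.corner c (χ.blackCorner c + 2)) = true := by
  have h0 := χ.black_succ c 0
  have h1 := χ.black_succ c 1
  have h2 := χ.black_succ c 2
  simp only [Fin.isValue, zero_add] at h0
  rw [show (1 : Fin 4) + 1 = 2 from rfl] at h1
  rw [show (2 : Fin 4) + 1 = 3 from rfl] at h2
  unfold blackCorner positive
  cases h : χ.black (D.corner c 1) <;> simp_all

/-- The Tait graph: its vertices are the black regions, its edges the crossings, and the edge `c`
links the two black corners at the crossing `c`. -/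
def taitGraph : Graph D.Region C where
  vertexSet := {r | χ.black r = true}
  IsLink c r s :=
    (r = D.corner c (χ.blackCorner c) ∧ s = D.corner c (χ.blackCorner c + 2)) ∨
      (s = D.corner c (χ.blackCorner c) ∧ r = D.corner c (χ.blackCorner c + 2))
  isLink_symm _ _ := ⟨fun _ _ h => h.symm⟩
  eq_or_eq_of_isLink_of_isLink := by
    rintro e x y v w (⟨rfl, rfl⟩ | ⟨rfl, rfl⟩) (⟨rfl, rfl⟩ | ⟨rfl, rfl⟩) <;> simp
  left_mem_of_isLink := by
    rintro e x y (⟨rfl, rfl⟩ | ⟨rfl, rfl⟩)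
    · exact (χ.black_blackCorner e).1
    · exact (χ.black_blackCorner e).2

/-- `r` and `s` are connected by edges in `H`. A spanning subgraph of the Tait graph
is given by its set `H` of edges. -/
def Reachable (H : Set C) (r s : D.Region) : Prop :=
  Relation.EqvGen (fun r s => ∃ e ∈ H, χ.taitGraph.IsLink e r s) r s

/-- The end points of the edge `e` are connected by edges in `H`. -/
def EndsReachable (H : Set C) (e : C) : Prop :=
  ∀ r s, χ.taitGraph.IsLink e r s → χ.Reachable H r s

/-- `T` is the edge set of a spanning tree: it connects all vertices, and none of
its edges lies on a cycle. -/
def IsSpanningTree (T : Finset C) : Prop :=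
  (∀ r ∈ χ.taitGraph.vertexSet, ∀ s ∈ χ.taitGraph.vertexSet, χ.Reachable (T : Set C) r s) ∧
    ∀ e ∈ T, ¬ χ.EndsReachable ((T : Set C) \ {e}) e

/-- The spanning trees of the Tait graph. -/
abbrev SpanningTree : Type _ := {T : Finset C // χ.IsSpanningTree T}

/-- `cut(T, e)` for `e ∈ T`: the edges that connect the two components of `T \ e`. -/
def cut (T : Finset C) (e : C) : Set C :=
  {e' | ¬ χ.EndsReachable ((T : Set C) \ {e}) e'}

/-- `cyc(T, f)` for `f ∉ T`: the edges of the unique cycle in `T ∪ f`, i.e. the edges of `T ∪ f`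
whose end points stay connected in `T ∪ f` after their removal. -/
def cyc (T : Finset C) (f : C) : Set C :=
  {f' | (f' ∈ T ∨ f' = f) ∧ χ.EndsReachable (((T : Set C) ∪ {f}) \ {f'}) f'}

section Ordered

variable [LinearOrder C]

/-- An edge is live (active) if it is the smallest one in its cut or cycle; otherwise it is dead. -/
def IsLive (T : Finset C) (e : C) : Prop :=
  (e ∈ T ∧ ∀ e' ∈ χ.cut T e, e ≤ e') ∨ (e ∉ T ∧ ∀ e' ∈ χ.cyc T e, e ≤ e')

open Classical in
/-- The activity of an edge with respect to `T`. -/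
noncomputable def activity (T : Finset C) (e : C) : Activity :=
  if e ∈ T then (if χ.IsLive T e then .L else .D) else (if χ.IsLive T e then .l else .d)

/-- The smoothing that the activity word of `T` assigns to the crossing `e`. Applied to the dead
edges only, these smoothings give the twisted unknot `U(T)`. -/
noncomputable def treeSmoothing (T : Finset C) (e : C) : Smoothing :=
  (χ.activity T e).smoothing (χ.positive e)

end Ordered

/-! ## Enhanced spanning subgraphs and the reduced Khovanov complex -/

section Khovanov

open Classical in
/-- The smoothing of the crossing `c` that corresponds to the spanning subgraph `H`: for a
positive edge it is `A` iff `c ∈ H`, for a negative edge it is `A` iff `c ∉ H`. -/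
noncomputable def res (H : Finset C) (c : C) : Smoothing :=
  if (χ.positive c = true ↔ c ∈ H) then .A else .B

/-- Two arcs that the smoothings of `H` connect at some crossing: the `A`-smoothing connects
the ends `0, 1` and the ends `2, 3`, the `B`-smoothing the ends `1, 2` and the ends `3, 0`. -/
def Joined (H : Finset C) (a b : Arc) : Prop :=
  ∃ c, match χ.res H c with
    | .A => (a = D.arc c 0 ∧ b = D.arc c 1) ∨ (a = D.arc c 2 ∧ b = D.arc c 3)
    | .B => (a = D.arc c 1 ∧ b = D.arc c 2) ∨ (a = D.arc c 3 ∧ b = D.arc c 0)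

/-- `F(H)`, the faces of the connected components of the spanning subgraph `H`. The arcs of the
diagram are the corners of the Tait graph (every arc runs along one black region, from one edge of
the Tait graph to the next one around the corresponding vertex). Going around a face
of a component of `H` means to pass at each edge `e` from one corner to the next: across `e`,
at the same vertex, if `e ∉ H`, and along `e` to its other end point if `e ∈ H`. So a face is a class
of corners, and the faces are exactly the circles of the resolved state, i.e. the boundary circles
of a regular neighbourhood of `H`. -/
def Face (H : Finset C) : Type _ := Quot (χ.Joined H)

/-- The face with the corner `a`, i.e. the circle of the resolved state containing the arc `a`. -/
def face (H : Finset C) (a : Arc) : χ.Face H := Quot.mk _ a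

/-- The face at the end `0` of the crossing `c`. With either smoothing the ends `0` and `2` lie on
different ones of the two strands at `c`, so `face₁ H c` and `face₂ H c` are the two (possibly equal)
faces that meet at `c`. -/
def face₁ (H : Finset C) (c : C) : χ.Face H := χ.face H (D.arc c 0)

/-- The face at the end `2` of the crossing `c`. -/
def face₂ (H : Finset C) (c : C) : χ.Face H := χ.face H (D.arc c 2)

/-- An enhanced spanning subgraph `(H, ε)`. -/
structure EnhancedSubgraph where
  H : Finset C
  ε : χ.Face H → Label

/-- The enhanced spanning subgraphs in which the face that contains the dotted arc
has the label `1`. -/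
abbrev ReducedSubgraph (dot : Arc) : Type _ :=
  {S : χ.EnhancedSubgraph // S.ε (χ.face S.H dot) = .one}

instance (dot : Arc) : Nonempty (χ.ReducedSubgraph dot) := ⟨⟨⟨∅, fun _ => .one⟩, rfl⟩⟩

namespace EnhancedSubgraph

variable {χ}

/-- The homological degree `i(H, ε)`. -/
noncomputable def iDeg (S : χ.EnhancedSubgraph) : ℤ :=
  (Nat.card {c // χ.positive c = true ∧ c ∉ S.H} : ℤ) +
    (Nat.card {c // χ.positive c = false ∧ c ∈ S.H} : ℤ) - (D.nMinus : ℤ)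

/-- The quantum degree `j(H, ε)`. -/
noncomputable def jDeg (S : χ.EnhancedSubgraph) : ℤ :=
  S.iDeg + ((Nat.card {F // S.ε F = .one} : ℤ) - (Nat.card {F // S.ε F = .x} : ℤ)) +
    (D.nPlus : ℤ) - (D.nMinus : ℤ)

/-- `A(H, ε)`, the set of the positive edges in `H` and the negative edges not in `H`. -/
def aEdges (S : χ.EnhancedSubgraph) : Set C :=
  {e | (χ.positive e = true ∧ e ∈ S.H) ∨ (χ.positive e = false ∧ e ∉ S.H)}

/-- `S'` is one of the enhanced spanning subgraphs that arise from `S` by changing the edge `e` of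
`A(S)`: `e` is removed if it is positive, inserted if it is negative; the labels of the
faces not touched by this are kept; if two faces merge their labels are merged, and if a face
splits its label is split. -/
def IsTerm (S S' : χ.EnhancedSubgraph) (e : C) : Prop :=
  e ∈ S.aEdges ∧
  (e ∈ S'.H ↔ χ.positive e = false) ∧ (∀ c, c ≠ e → (c ∈ S'.H ↔ c ∈ S.H)) ∧
  (∀ a, χ.face S.H a ≠ χ.face₁ S.H e → χ.face S.H a ≠ χ.face₂ S.H e →
    S'.ε (χ.face S'.H a) = S.ε (χ.face S.H a)) ∧
  (χ.face₁ S.H e ≠ χ.face₂ S.H e →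
    Label.merge (S.ε (χ.face₁ S.H e)) (S.ε (χ.face₂ S.H e)) = some (S'.ε (χ.face₁ S'.H e))) ∧
  (χ.face₁ S.H e = χ.face₂ S.H e →
    (S'.ε (χ.face₁ S'.H e), S'.ε (χ.face₂ S'.H e)) ∈ Label.split (S.ε (χ.face₁ S.H e)))

variable [LinearOrder C]

/-- `w(e)`, the number of edges `f < e` outside of `A(H, ε)`. -/
noncomputable def signExponent (S : χ.EnhancedSubgraph) (e : C) : ℕ :=
  Nat.card {f // f < e ∧ f ∉ S.aEdges}

open Classical in
/-- The incidence numbers of the Khovanov complex. -/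
noncomputable def inc [Fintype C] (S S' : χ.EnhancedSubgraph) : ℤ :=
  ∑ e : C, if S.IsTerm S' e then (-1) ^ S.signExponent e else 0

end EnhancedSubgraph

instance [Finite Arc] (H : Finset C) : Finite (χ.Face H) :=
  inferInstanceAs (Finite (Quot (χ.Joined H)))

instance : Finite Label :=
  Finite.of_injective (fun l : Label => decide (l = .one)) (by
    intro a b h; cases a <;> cases b <;> simp_all)

instance [Finite Arc] [Finite C] : Finite χ.EnhancedSubgraph :=
  Finite.of_injective (β := Σ H : Finset C, χ.Face H → Label) (fun S => ⟨S.H, S.ε⟩) (by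
    rintro ⟨H, ε⟩ ⟨H', ε'⟩ h; cases h; rfl)

/-- The reduced Khovanov complex `CKh⁺`, with basis the enhanced spanning subgraphs in which the
dotted face has the label `1`. The remaining terms of the Khovanov differential are dropped, i.e.
`CKh⁺` is the quotient of `CKh` by the subcomplex where the dotted face has the label `x`. -/
noncomputable def reducedKhovanov [Fintype C] [LinearOrder C] (dot : Arc) :
    BasedComplex (χ.ReducedSubgraph dot) where
  deg S := S.1.iDeg
  qdeg S := S.1.jDeg
  inc S S' := S.1.inc S'.1

end Khovanov

/-! ## The matching and the reduced spanning tree complex -/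

section Matching

variable [Fintype C] [LinearOrder C]

open Classical in
/-- The live edges of `T`; they are the edges of the tree `G(T)`, and the crossings of `U(T)`. -/
noncomputable def liveEdges (T : Finset C) : Finset C := Finset.univ.filter (χ.IsLive T)

open Classical in
/-- The spanning subgraph of the Tait graph in which each crossing, dead or live, is smoothed
according to the activity word of `T`. -/
noncomputable def treeState (T : Finset C) : Finset C :=
  Finset.univ.filter fun c => (χ.positive c = true ↔ χ.treeSmoothing T c = .A)

/-- The vertices of the tree `G(T)` that represents `U(T)`: the circles left when the
crossings of `U(T)` are smoothed, too. The spanning subgraphs of `G(T)` correspond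
to the resolved states of `U(T)`. -/
abbrev TreeVertex (T : Finset C) : Type _ := χ.Face (χ.treeState T)

/-- The live edge `e` joins in `G(T)` the two circles that meet at the crossing `e`. -/
def TreeIncident (T : Finset C) (e : C) (v : χ.TreeVertex T) : Prop :=
  v = χ.face₁ (χ.treeState T) e ∨ v = χ.face₂ (χ.treeState T) e

/-- `e` is a leaf of the subtree of `G(T)` with edge set `R`, and `v`, different from the root
(the circle with the dotted arc), is its vertex of degree one. -/
def IsLeaf (dot : Arc) (T R : Finset C) (e : C) (v : χ.TreeVertex T) : Prop :=
  e ∈ R ∧ v ≠ χ.face (χ.treeState T) dot ∧ χ.TreeIncident T e v ∧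
    ∀ e' ∈ R, χ.TreeIncident T e' v → e' = e

/-- `e` is the least such leaf. -/
def IsLeastLeaf (dot : Arc) (T R : Finset C) (e : C) (v : χ.TreeVertex T) : Prop :=
  χ.IsLeaf dot T R e v ∧ ∀ e' v', χ.IsLeaf dot T R e' v' → e ≤ e'

/-- `S ∈ CKh(U(T))`, i.e. `S` has the prescribed smoothings at all the dead edges of `T`. -/
def InTwistedUnknot (T : Finset C) (S : χ.EnhancedSubgraph) : Prop :=
  ∀ c, ¬ χ.IsLive T c → χ.res S.H c = χ.treeSmoothing T c

/-- For `S ∈ CKh(U(T))`: the live edge `e` belongs to the spanning subgraph of `G(T)` that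
corresponds to `S`. -/
def InTreeSubgraph (T : Finset C) (S : χ.EnhancedSubgraph) (e : C) : Prop :=
  χ.res S.H e ≠ χ.treeSmoothing T e

/-- The vertex `v` of `G(T)` (a set of arcs) has the label `l` in `S`. -/
def HasLabel (T : Finset C) (S : χ.EnhancedSubgraph) (v : χ.TreeVertex T) (l : Label) : Prop :=
  ∀ a, χ.face (χ.treeState T) a = v → S.ε (χ.face S.H a) = l

/-- `S` contains the leaf `e` with end vertex `v`, and `S'` arises from `S` by removing `e`, where the
new isolated vertex `v` gets the label `l`, the rest of the component of `v` keeps the label of the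
component, and all other labels are unchanged. -/
def IsLeafRemoval (T : Finset C) (e : C) (v : χ.TreeVertex T) (l : Label)
    (S S' : χ.EnhancedSubgraph) : Prop :=
  χ.InTreeSubgraph T S e ∧ ¬ χ.InTreeSubgraph T S' e ∧ (∀ c, c ≠ e → (c ∈ S'.H ↔ c ∈ S.H)) ∧
    χ.HasLabel T S' v l ∧
    ∀ a, χ.face (χ.treeState T) a ≠ v → S'.ε (χ.face S'.H a) = S.ε (χ.face S.H a)

/-- The matching on the enhanced spanning subgraphs in `CKh⁺(U(T))`, by recursion on the subtree of
`G(T)` with edge set `R`. Let `e` be its least leaf, with end vertex `v`. A live edge is a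
negative twist if its smoothing in the activity word is `B` (i.e. its activity is `L` or `l̄`),
and a positive twist if it is `A`.

* Each `S` that contains `e` is matched with its leaf removal `S'`, where `v` has the label `x` for
  a negative twist (the Hasse edge then is `S → S'`, a split) and the label `1` for a positive twist
  (the Hasse edge then is `S' → S`, a merge).
* The remaining ones, in which `v` is isolated with the label `1` for a negative
  and `x` for a positive twist, are matched by the matching of the tree without `v`. -/
inductive TreeMatching (dot : Arc) (T : Finset C) :
    Finset C → χ.EnhancedSubgraph → χ.EnhancedSubgraph → Prop
  | negative (R : Finset C) (e : C) (v : χ.TreeVertex T) (S S' : χ.EnhancedSubgraph) :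
      χ.IsLeastLeaf dot T R e v → χ.treeSmoothing T e = .B →
      χ.IsLeafRemoval T e v .x S S' → TreeMatching dot T R S S'
  | positive (R : Finset C) (e : C) (v : χ.TreeVertex T) (S S' : χ.EnhancedSubgraph) :
      χ.IsLeastLeaf dot T R e v → χ.treeSmoothing T e = .A →
      χ.IsLeafRemoval T e v .one S S' → TreeMatching dot T R S' S
  | step (R : Finset C) (e : C) (v : χ.TreeVertex T) (l : Label) (S S' : χ.EnhancedSubgraph) :
      χ.IsLeastLeaf dot T R e v →
      (χ.treeSmoothing T e = .B ∧ l = .one ∨ χ.treeSmoothing T e = .A ∧ l = .x) →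
      ¬ χ.InTreeSubgraph T S e → ¬ χ.InTreeSubgraph T S' e →
      χ.HasLabel T S v l → χ.HasLabel T S' v l →
      TreeMatching dot T (R.erase e) S S' → TreeMatching dot T R S S'

/-- The matching on the Hasse diagram of `CKh⁺`: the union over all spanning trees `T`
of the matchings on `CKh⁺(U(T))`. -/
def khovanovMatching (dot : Arc) (S S' : χ.ReducedSubgraph dot) : Prop :=
  ∃ T : χ.SpanningTree, χ.InTwistedUnknot T.1 S.1 ∧ χ.InTwistedUnknot T.1 S'.1 ∧
    χ.TreeMatching dot T.1 (χ.liveEdges T.1) S.1 S'.1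

/-- `S` is a critical enhanced spanning subgraph in `CKh⁺(U(T))`. -/
def IsCriticalFor (dot : Arc) (T : χ.SpanningTree) (S : χ.ReducedSubgraph dot) : Prop :=
  χ.InTwistedUnknot T.1 S.1 ∧ BasedComplex.IsCritical (χ.khovanovMatching dot) S

/-- `S_c^{T⁺}`, the (unique) critical enhanced spanning subgraph in `CKh⁺(U(T))`. -/
noncomputable def criticalSubgraph (dot : Arc) (T : χ.SpanningTree) : χ.ReducedSubgraph dot :=
  Classical.epsilon (χ.IsCriticalFor dot T)

/-- The reduced spanning tree complex `CST⁺`: its basis are the spanning trees `T`, with the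
bidegree of `S_c^{T⁺}`, and its incidence numbers are the sums `Γ(S_c^{T⁺}, S_c^{T'⁺})` of the weights
of the alternating paths. -/
noncomputable def reducedSpanningTreeComplex (dot : Arc) : BasedComplex χ.SpanningTree where
  deg T := (χ.criticalSubgraph dot T).1.iDeg
  qdeg T := (χ.criticalSubgraph dot T).1.jDeg
  inc T T' := (χ.reducedKhovanov dot).Gamma (χ.khovanovMatching dot)
    (χ.criticalSubgraph dot T) (χ.criticalSubgraph dot T')

end Matching

end ConnectedLinkDiagram.Checkerboard

/-!
The proof combines algebraic discrete Morse theory with matroid activities, Euler's formula, and an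
induction on the leaves of the trees `G(T)`.

*Algebra.* Let `D` be the differential, `d` its part along the matched pairs, `U = D - d`, and `Φ`
the inverse of `d` on the matched pairs. As `d Φ + Φ d` is the identity minus the projection `π` to
the critical elements, and `U Φ` is nilpotent because the matching is acyclic, the homological
perturbation lemma makes `π A π`, with `A = U - U Φ U + ⋯`, a differential on the critical elements
whose complex is homotopy equivalent to `D`. The path sums `Γ` form the inverse of `1 - W`, where
`W = U - Φ` is the matrix of weights; comparing degrees shows that its part of degree one between
critical elements is `π A π`. This is `BasedComplex.morse_complex`. It needs the Khovanov
differential to square to zero (`isComplex_reducedKhovanov`). For that, the map of a single crossing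
commutes with the multiplication by the variable of any circle, so that the commutation of two such
maps has to be checked on the states with all labels `1` only, where each map is a factor `1`
(merge) or `x₁ + x₂` (split).

*Partition into twisted unknots.* For the closure operator of the cycle matroid of the Tait graph,
let an edge be active for a set `H` of edges if it is a loop or a coloop after contracting the
larger edges in `H` and deleting the larger edges outside of `H`. Inserting or removing an active
edge does not change any activity (`active_insert`), and so every `H` lies in `U(T)` for exactly one
spanning tree `T` (Crapo's intervals, `isMatroidBase_baseOf` and `baseOf_eq_of_agree`), whose live
edges are the active edges of `H`.

*Planarity.* By Euler's formula, an edge that is added to `H` splits a circle if its ends are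
connected by `H`, and merges two circles otherwise (`face₁_eq_face₂_iff`). Hence for a state of
`U(T)` a live edge belongs to the subgraph of `G(T)` iff one circle meets itself at its crossing,
and the circles are the components of this subgraph (`face_eq_iff_edgeConn`). In particular `G(T)`
is a tree, and has a leaf other than the root as long as it has an edge.

*The matching.* All statements about one twisted unknot follow by induction on the rooted subtree,
removing the least leaf `v` with edge `e`: the state either is one side of a matched pair at `e`, or
it is deferred to the smaller tree, with `v` isolated and carrying the other label. This yields
uniqueness of the partner and of the unmatched state. Number the states by `0`, `1`, `2` if `v` is
isolated with label `x`, joined to the rest by `e`, or isolated with label `1`. This level weakly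
increases along the differential and the reversed matching edges, for either sign of the twist
(`leafLevel_mono`); where it is constant, either the homological degree increases, or all states are
deferred, so there is no cycle within `U(T)`. An edge of the Hasse diagram that leads to another
twisted unknot changes an inactive crossing `c` from `A` to `B`; activities of crossings `≥ c` do
not change, so that the set of the inactive `B`-smoothed crossings increases in the colexicographic
order (`deadB_lt`). Together, the matching is acyclic.
-/

/-! ### Homological perturbation in a ring -/

section Perturbation

variable {R : Type*} [Ring R] {d U Φ π A : R}

/-- The transferred perturbation `A = U - U Φ U + U Φ U Φ U - ⋯` satisfies the Maurer-Cartan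
equation of the homological perturbation lemma. -/
theorem perturbation_maurerCartan (hD : (d + U) * (d + U) = 0) (hdd : d * d = 0)
    (h1 : d * Φ + Φ * d = 1 - π) (hl : A = U - U * Φ * A) (hr : A = U - A * Φ * U) :
    A * d + d * A + A * π * A = 0 := by
  have hU : U * d + d * U + U * U = 0 := by
    have : (d + U) * (d + U) = d * d + (U * d + d * U + U * U) := by noncomm_ring
    rw [hD, hdd, zero_add] at this
    exact this.symm
  have hYr : (1 - A * Φ) * (1 + U * Φ) = 1 := by
    have : (1 - A * Φ) * (1 + U * Φ) = 1 + (U - A * Φ * U - A) * Φ := by noncomm_ring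
    rw [this, ← hr, sub_self, zero_mul, add_zero]
  have hYl : (1 + Φ * U) * (1 - Φ * A) = 1 := by
    have : (1 + Φ * U) * (1 - Φ * A) = 1 + Φ * (U - U * Φ * A - A) := by noncomm_ring
    rw [this, ← hl, sub_self, mul_zero, add_zero]
  have hA1 : (1 + U * Φ) * A = U := by
    rw [add_mul, one_mul]
    nth_rewrite 1 [hl]
    abel
  have hA2 : A * (1 + Φ * U) = U := by
    rw [mul_add, mul_one, ← mul_assoc]
    nth_rewrite 1 [hr]
    abel
  have hZ : (1 + U * Φ) * (A * d + d * A + A * π * A) * (1 + Φ * U) = 0 := by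
    have e1 : (1 + U * Φ) * (A * d + d * A + A * π * A) * (1 + Φ * U) =
        ((1 + U * Φ) * A) * d * (1 + Φ * U) + (1 + U * Φ) * d * (A * (1 + Φ * U)) +
          ((1 + U * Φ) * A) * π * (A * (1 + Φ * U)) := by noncomm_ring
    rw [e1, hA1, hA2]
    have e2 : U * d * (1 + Φ * U) + (1 + U * Φ) * d * U + U * π * U =
        U * d + d * U + U * (d * Φ + Φ * d + π) * U := by noncomm_ring
    rw [e2, h1, sub_add_cancel, mul_one, hU]
  calc A * d + d * A + A * π * A
      = ((1 - A * Φ) * (1 + U * Φ)) * (A * d + d * A + A * π * A) *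
          ((1 + Φ * U) * (1 - Φ * A)) := by rw [hYr, hYl, one_mul, mul_one]
    _ = (1 - A * Φ) * ((1 + U * Φ) * (A * d + d * A + A * π * A) * (1 + Φ * U)) *
          (1 - Φ * A) := by noncomm_ring
    _ = 0 := by rw [hZ, mul_zero, zero_mul]

/-- The transferred differential `π A π` squares to zero. -/
theorem perturbation_sq (hmc : A * d + d * A + A * π * A = 0) (hππ : π * π = π)
    (hπd : π * d = 0) (hdπ : d * π = 0) : (π * A * π) * (π * A * π) = 0 := by
  have h : A * π * A = -(A * d + d * A) := by
    rw [eq_neg_iff_add_eq_zero, add_comm]; exact hmc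
  calc (π * A * π) * (π * A * π) = π * A * (π * π) * A * π := by noncomm_ring
    _ = π * (A * π * A) * π := by rw [hππ]; noncomm_ring
    _ = -(π * A * (d * π)) - (π * d) * A * π := by rw [h]; noncomm_ring
    _ = 0 := by rw [hdπ, hπd]; simp

/-- The projection `(1 - Φ A) π` is a chain map. -/
theorem perturbation_projection (h1 : d * Φ + Φ * d = 1 - π) (hl : A = U - U * Φ * A)
    (hmc : A * d + d * A + A * π * A = 0) (hππ : π * π = π) (hdπ : d * π = 0) :
    (d + U) * ((1 - Φ * A) * π) = (1 - Φ * A) * π * (π * A * π) := by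
  have h : d * A = -(A * d + A * π * A) := by
    rw [eq_neg_iff_add_eq_zero, ← hmc]; abel
  have hdΦ : d * Φ = 1 - π - Φ * d := by rw [← h1]; abel
  calc (d + U) * ((1 - Φ * A) * π) = d * π + (U - U * Φ * A) * π - (d * Φ) * A * π := by
        noncomm_ring
    _ = π * A * π + Φ * (d * A) * π := by rw [← hl, hdΦ, hdπ]; noncomm_ring
    _ = π * A * π - Φ * A * (d * π) - Φ * A * π * A * π := by rw [h]; noncomm_ring
    _ = (1 - Φ * A) * (π * π) * A * π := by rw [hdπ, hππ]; noncomm_ring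
    _ = _ := by noncomm_ring

/-- The inclusion `π (1 - A Φ)` is a chain map. -/
theorem perturbation_inclusion (h1 : d * Φ + Φ * d = 1 - π) (hr : A = U - A * Φ * U)
    (hmc : A * d + d * A + A * π * A = 0) (hππ : π * π = π) (hπd : π * d = 0) :
    π * (1 - A * Φ) * (d + U) = (π * A * π) * (π * (1 - A * Φ)) := by
  have h : A * d = -(d * A + A * π * A) := by
    rw [eq_neg_iff_add_eq_zero, ← hmc]; abel
  have hΦd : Φ * d = 1 - π - d * Φ := by rw [← h1]; abel
  calc π * (1 - A * Φ) * (d + U) = π * d + π * (U - A * Φ * U) - π * A * (Φ * d) := by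
        noncomm_ring
    _ = π * A * π + π * (A * d) * Φ := by rw [← hr, hΦd, hπd]; noncomm_ring
    _ = π * A * π - (π * d) * A * Φ - π * A * π * A * Φ := by rw [h]; noncomm_ring
    _ = π * A * (π * π) * (1 - A * Φ) := by rw [hπd, hππ]; noncomm_ring
    _ = _ := by noncomm_ring

theorem perturbation_retract (hΦΦ : Φ * Φ = 0) (hππ : π * π = π) (hπΦ : π * Φ = 0)
    (hΦπ : Φ * π = 0) : π * (1 - A * Φ) * ((1 - Φ * A) * π) = π := by
  calc π * (1 - A * Φ) * ((1 - Φ * A) * π) = π * π - (π * Φ) * A * π - π * A * (Φ * π)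
        + π * A * (Φ * Φ) * A * π := by noncomm_ring
    _ = π := by rw [hΦΦ, hππ, hπΦ, hΦπ]; simp

/-- `Φ - Φ A Φ` is a chain homotopy from the identity to the projection followed by the
inclusion. -/
theorem perturbation_homotopy (h1 : d * Φ + Φ * d = 1 - π) (hl : A = U - U * Φ * A)
    (hr : A = U - A * Φ * U) (hmc : A * d + d * A + A * π * A = 0) (hππ : π * π = π) :
    (1 - Φ * A) * π * (π * (1 - A * Φ)) =
      1 - ((d + U) * (Φ - Φ * A * Φ) + (Φ - Φ * A * Φ) * (d + U)) := by
  have h : A * π * A = -(A * d + d * A) := by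
    rw [eq_neg_iff_add_eq_zero, add_comm]; exact hmc
  have hdΦ : d * Φ = 1 - π - Φ * d := by rw [← h1]; abel
  have e1 : (d + U) * (Φ - Φ * A * Φ) = d * Φ + (π + Φ * d) * A * Φ := by
    calc (d + U) * (Φ - Φ * A * Φ) = d * Φ + (U - U * Φ * A) * Φ - (d * Φ) * A * Φ := by
          noncomm_ring
      _ = d * Φ + A * Φ - (1 - π - Φ * d) * A * Φ := by rw [← hl, ← hdΦ]
      _ = _ := by noncomm_ring
  have e2 : (Φ - Φ * A * Φ) * (d + U) = Φ * d + Φ * A * (π + d * Φ) := by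
    calc (Φ - Φ * A * Φ) * (d + U) = Φ * d + Φ * (U - A * Φ * U) - Φ * A * (Φ * d) := by
          noncomm_ring
      _ = Φ * d + Φ * A - Φ * A * (1 - π - d * Φ) := by
          rw [← hr]; congr 2; rw [hdΦ]; abel
      _ = _ := by noncomm_ring
  calc (1 - Φ * A) * π * (π * (1 - A * Φ)) = (1 - Φ * A) * (π * π) * (1 - A * Φ) := by
        noncomm_ring
    _ = π - Φ * A * π - π * A * Φ + Φ * (A * π * A) * Φ := by rw [hππ]; noncomm_ring
    _ = 1 - (1 - π) - Φ * A * π - π * A * Φ - Φ * A * d * Φ - Φ * d * A * Φ := by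
        rw [h]; noncomm_ring
    _ = _ := by rw [e1, e2, ← h1]; noncomm_ring

end Perturbation

/-! ### Acyclic relations and nilpotent matrices -/

/-- The number of elements that can be reached from `v` along `r`. For an acyclic relation on a
finite type it drops along every step. -/
noncomputable def reachRank {V : Type*} (r : V → V → Prop) (v : V) : ℕ :=
  {u | Relation.TransGen r v u}.ncard

theorem reachRank_lt {V : Type*} [Finite V] {r : V → V → Prop}
    (hr : ∀ v, ¬ Relation.TransGen r v v) {v w : V} (h : Relation.TransGen r v w) :
    reachRank r w < reachRank r v := by
  refine Set.ncard_lt_ncard ⟨fun u hu => h.trans hu, fun hsub => ?_⟩ (Set.toFinite _)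
  exact hr w (hsub h)

theorem isNilpotent_of_acyclic {V : Type*} [Fintype V] [DecidableEq V] {r : V → V → Prop}
    (hr : ∀ v, ¬ Relation.TransGen r v v) (B : Matrix V V ℤ)
    (hB : ∀ v w, B v w ≠ 0 → Relation.TransGen r v w) : IsNilpotent B := by
  have key : ∀ n v w, (B ^ n) v w ≠ 0 → reachRank r w + n ≤ reachRank r v := by
    intro n
    induction n with
    | zero =>
      intro v w h
      rw [pow_zero, Matrix.one_apply] at h
      have : v = w := by by_contra h'; simp [h'] at h
      simp [this]
    | succ n ih =>
      intro v w h
      rw [pow_succ, Matrix.mul_apply] at h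
      obtain ⟨u, -, hu⟩ := Finset.exists_ne_zero_of_sum_ne_zero h
      have h1 := ih v u (left_ne_zero_of_mul hu)
      have h2 := reachRank_lt hr (hB u w (right_ne_zero_of_mul hu))
      omega
  refine ⟨Finset.univ.sup (reachRank r) + 1, ?_⟩
  ext v w
  by_contra h
  have h1 := key _ v w h
  have h2 : reachRank r v ≤ Finset.univ.sup (reachRank r) := Finset.le_sup (Finset.mem_univ v)
  omega

/-! ### Path sums -/

namespace BasedComplex

variable {V : Type*} (K : BasedComplex V) (M : V → V → Prop)

open Classical in
/-- The matrix of the weights of the graph in which the edges of `M` have been reversed. -/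
noncomputable def weightMatrix : Matrix V V ℤ :=
  fun v w => if K.MorseEdge M v w then K.weight M v w else 0

theorem finite_paths [Finite V] (hac : ∀ v, ¬ Relation.TransGen (K.MorseEdge M) v v) (v w : V) :
    (K.paths M v w).Finite := by
  have key : ∀ (p : List V) (v : V), p.IsChain (K.MorseEdge M) → p.head? = some v →
      p.length ≤ reachRank (K.MorseEdge M) v + 1 := by
    intro p
    induction p with
    | nil => simp
    | cons a p ih =>
      rintro v hc hh
      obtain rfl : a = v := by simpa using hh
      cases p with
      | nil => simp
      | cons b p =>
        rw [List.isChain_cons_cons] at hc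
        have h1 := ih b hc.2 rfl
        have h2 := reachRank_lt hac (Relation.TransGen.single hc.1)
        simp only [List.length_cons] at h1 ⊢
        omega
  exact (List.finite_length_le V (reachRank (K.MorseEdge M) v + 1)).subset
    fun p hp => key p v hp.1 hp.2.1

theorem paths_eq [DecidableEq V] (v w : V) :
    K.paths M v w = (if v = w then {[v]} else ∅) ∪
      ⋃ u ∈ {u | K.MorseEdge M v u}, List.cons v '' K.paths M u w := by
  ext p
  simp only [paths, Set.mem_union, Set.mem_iUnion, Set.mem_image, Set.mem_ofPred_eq]
  constructor
  · rintro ⟨hc, hh, hl⟩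
    cases p with
    | nil => simp at hh
    | cons a p =>
      obtain rfl : a = v := by simpa using hh
      cases p with
      | nil =>
        obtain rfl : a = w := by simpa using hl
        simp
      | cons b p =>
        rw [List.isChain_cons_cons] at hc
        exact Or.inr ⟨b, hc.1, b :: p, ⟨hc.2, rfl, by simpa using hl⟩, rfl⟩
  · rintro (h | ⟨u, hu, q, ⟨hc, hh, hl⟩, rfl⟩)
    · split_ifs at h with hvw
      · subst hvw
        simp only [Set.mem_singleton_iff] at h
        subst h
        simp
      · exact h.elim
    · cases q with
      | nil => simp at hh
      | cons b q =>
        obtain rfl : b = u := by simpa using hh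
        exact ⟨List.isChain_cons_cons.2 ⟨hu, hc⟩, rfl, by simpa using hl⟩

theorem gamma_eq [Fintype V] [DecidableEq V]
    (hac : ∀ v, ¬ Relation.TransGen (K.MorseEdge M) v v) (v w : V) :
    K.Gamma M v w = (1 : Matrix V V ℤ) v w + ∑ u, K.weightMatrix M v u * K.Gamma M u w := by
  classical
  have hfin : ∀ u, (List.cons v '' K.paths M u w).Finite :=
    fun u => (K.finite_paths M hac u w).image _
  unfold Gamma
  rw [K.paths_eq M v w, finsum_mem_union]
  · congr 1
    · rw [Matrix.one_apply]
      split_ifs with h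
      · rw [finsum_mem_singleton, pathWeight]
      · rw [finsum_mem_empty]
    · rw [finsum_mem_biUnion]
      · rw [finsum_mem_eq_finite_toFinset_sum _ (Set.toFinite _)]
        have : (Set.toFinite {u | K.MorseEdge M v u}).toFinset =
            Finset.univ.filter (K.MorseEdge M v) := by ext; simp
        rw [this, Finset.sum_filter]
        refine Finset.sum_congr rfl fun u _ => ?_
        unfold weightMatrix
        split_ifs with h
        · rw [finsum_mem_image (fun _ _ _ _ h => (List.cons.inj h).2),
            mul_finsum_mem' _ _ (K.finite_paths M hac u w)]
          refine finsum_mem_congr rfl fun q hq => ?_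
          cases q with
          | nil => simp [paths] at hq
          | cons b q =>
            obtain rfl : b = u := by simpa using hq.2.1
            rw [pathWeight]
        · rw [zero_mul]
      · intro u _ u' _ huu'
        refine Set.disjoint_left.2 ?_
        rintro _ ⟨q, hq, rfl⟩ ⟨q', hq', h⟩
        obtain rfl := (List.cons.inj h).2
        exact huu' (Option.some.inj (hq.2.1.symm.trans hq'.2.1))
      · exact Set.toFinite _
      · exact fun u _ => hfin u
  · refine Set.disjoint_left.2 fun p hp hp' => ?_
    split_ifs at hp with h
    · rw [Set.mem_singleton_iff] at hp
      subst hp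
      simp only [Set.mem_iUnion] at hp'
      obtain ⟨u, -, q, hq, h⟩ := hp'
      obtain rfl : q = [] := by simpa using h
      simp [paths] at hq
    · exact hp
  · split_ifs
    · exact Set.finite_singleton _
    · exact Set.finite_empty
  · exact (Set.toFinite _).biUnion fun u _ => hfin u

/-- The matrix of the path sums is the inverse of `1 - W`, with `W` the matrix of the weights. -/
theorem gamma_mul [Fintype V] [DecidableEq V]
    (hac : ∀ v, ¬ Relation.TransGen (K.MorseEdge M) v v) :
    Matrix.of (K.Gamma M) * (1 - K.weightMatrix M) = 1 := by
  rw [mul_eq_one_comm, sub_mul, one_mul, sub_eq_iff_eq_add]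
  ext v w
  exact K.gamma_eq M hac v w

end BasedComplex

/-! ### Linear maps given by blocks of a matrix -/

section Block

variable {V α β γ : Type*}

/-- The linear map between free abelian groups whose matrix is the block of `B` with rows `a` and
columns `b`. As for the differential of a `BasedComplex`, the rows are the images of the basis
elements. -/
noncomputable def blockMap [Finite β] (a : α → V) (b : β → V) (B : Matrix V V ℤ) :
    (α →₀ ℤ) →ₗ[ℤ] (β →₀ ℤ) :=
  Finsupp.linearCombination ℤ fun x => Finsupp.equivFunOnFinite.symm fun y => B (a x) (b y)

theorem blockMap_single [Finite β] (a : α → V) (b : β → V) (B : Matrix V V ℤ) (x : α) (y : β) :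
    blockMap a b B (Finsupp.single x 1) y = B (a x) (b y) := by
  simp [blockMap]

theorem blockMap_ext [Finite β] {a : α → V} {b : β → V} {f : (α →₀ ℤ) →ₗ[ℤ] (β →₀ ℤ)}
    {B : Matrix V V ℤ} (h : ∀ x y, f (Finsupp.single x 1) y = B (a x) (b y)) :
    f = blockMap a b B := by
  refine Finsupp.lhom_ext' fun x => LinearMap.ext_ring (Finsupp.ext fun y => ?_)
  simpa [blockMap] using h x y

theorem blockMap_apply [Fintype α] [Finite β] (a : α → V) (b : β → V) (B : Matrix V V ℤ)
    (z : α →₀ ℤ) (y : β) : blockMap a b B z y = ∑ x, z x * B (a x) (b y) := by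
  rw [blockMap, Finsupp.linearCombination_apply, Finsupp.sum_fintype _ _ (by simp),
    Finsupp.finsetSum_apply]
  simp

/-- Block maps compose to the block of the product if the middle block contains all
contributing indices. -/
theorem blockMap_comp [Fintype V] [Finite β] [Finite γ] {a : α → V} {b : β → V} {c : γ → V}
    (hb : Function.Injective b) {B B' : Matrix V V ℤ}
    (h : ∀ x u y, B (a x) u ≠ 0 → B' u (c y) ≠ 0 → u ∈ Set.range b) :
    blockMap b c B' ∘ₗ blockMap a b B = blockMap a c (B * B') := by
  classical
  have := Fintype.ofFinite β
  refine blockMap_ext fun x y => ?_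
  rw [LinearMap.comp_apply, blockMap_apply, Matrix.mul_apply]
  simp only [blockMap_single]
  refine Finset.sum_of_injOn b hb.injOn (by simp) (fun u _ hu => ?_) (fun _ _ => rfl)
  by_contra h0
  exact hu (by simpa using h x u y (left_ne_zero_of_mul h0) (right_ne_zero_of_mul h0))

end Block

/-! ### Cohomology of homotopy equivalent sequences -/

section Cohomology

variable {R : Type*} [CommRing R]
  {A₁ A₂ A₃ B₁ B₂ B₃ : Type*} [AddCommGroup A₁] [AddCommGroup A₂] [AddCommGroup A₃]
  [AddCommGroup B₁] [AddCommGroup B₂] [AddCommGroup B₃] [Module R A₁] [Module R A₂] [Module R A₃]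
  [Module R B₁] [Module R B₂] [Module R B₃]

/-- The cohomology of two sequences at their middle terms agrees if there are morphisms of
sequences in both directions that are inverse to each other up to homotopy. -/
theorem nonempty_cohomology_equiv (d₁ : A₁ →ₗ[R] A₂) (d₂ : A₂ →ₗ[R] A₃)
    (δ₁ : B₁ →ₗ[R] B₂) (δ₂ : B₂ →ₗ[R] B₃) (f₁ : A₁ →ₗ[R] B₁) (f₂ : A₂ →ₗ[R] B₂) (f₃ : A₃ →ₗ[R] B₃)
    (g₁ : B₁ →ₗ[R] A₁) (g₂ : B₂ →ₗ[R] A₂) (g₃ : B₃ →ₗ[R] A₃) (h₂ : A₂ →ₗ[R] A₁) (h₃ : A₃ →ₗ[R] A₂)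
    (hf₁ : f₂ ∘ₗ d₁ = δ₁ ∘ₗ f₁) (hf₂ : f₃ ∘ₗ d₂ = δ₂ ∘ₗ f₂) (hg₁ : g₂ ∘ₗ δ₁ = d₁ ∘ₗ g₁)
    (hg₂ : g₃ ∘ₗ δ₂ = d₂ ∘ₗ g₂) (hfg : f₂ ∘ₗ g₂ = LinearMap.id)
    (hgf : g₂ ∘ₗ f₂ = LinearMap.id - (h₃ ∘ₗ d₂ + d₁ ∘ₗ h₂)) :
    Nonempty ((LinearMap.ker δ₂ ⧸ (LinearMap.range δ₁).comap (LinearMap.ker δ₂).subtype) ≃ₗ[R]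
      (LinearMap.ker d₂ ⧸ (LinearMap.range d₁).comap (LinearMap.ker d₂).subtype)) := by
  have hfk : ∀ z ∈ LinearMap.ker d₂, f₂ z ∈ LinearMap.ker δ₂ := fun z hz => by
    have := LinearMap.congr_fun hf₂ z
    rw [LinearMap.mem_ker] at hz ⊢
    simpa [hz] using this.symm
  have hgk : ∀ z ∈ LinearMap.ker δ₂, g₂ z ∈ LinearMap.ker d₂ := fun z hz => by
    have := LinearMap.congr_fun hg₂ z
    rw [LinearMap.mem_ker] at hz ⊢
    simpa [hz] using this.symm
  refine ⟨LinearEquiv.ofLinearMap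
    (Submodule.mapQ _ _ (g₂.restrict hgk) ?_) (Submodule.mapQ _ _ (f₂.restrict hfk) ?_) ?_ ?_⟩
  · rintro ⟨z, hz⟩ ⟨y, hy⟩
    exact ⟨g₁ y, by rw [← LinearMap.comp_apply, ← hg₁, LinearMap.comp_apply, hy]; rfl⟩
  · rintro ⟨z, hz⟩ ⟨y, hy⟩
    exact ⟨f₁ y, by rw [← LinearMap.comp_apply, ← hf₁, LinearMap.comp_apply, hy]; rfl⟩
  · refine Submodule.linearMap_qext _ (LinearMap.ext ?_)
    rintro ⟨z, hz⟩
    simp only [LinearMap.comp_apply, Submodule.mkQ_apply, Submodule.mapQ_apply, LinearMap.id_apply]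
    refine (Submodule.Quotient.eq _).2 ⟨-h₂ z, ?_⟩
    have := LinearMap.congr_fun hgf z
    rw [LinearMap.mem_ker] at hz
    simp [hz] at this
    simp [this]
  · refine Submodule.linearMap_qext _ (LinearMap.ext ?_)
    rintro ⟨z, hz⟩
    simp only [LinearMap.comp_apply, Submodule.mkQ_apply, Submodule.mapQ_apply, LinearMap.id_apply]
    congr 1
    exact Subtype.ext (LinearMap.congr_fun hfg z)

end Cohomology

/-! ### The Morse complex of an acyclic matching -/

namespace BasedComplex

variable {V : Type*} (K : BasedComplex V) (M : V → V → Prop)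

/-- All nonzero entries of the matrix `B` raise the homological degree by `n` and preserve the
quantum degree. -/
def IsHomogeneous (n : ℤ) (B : Matrix V V ℤ) : Prop :=
  ∀ v w, B v w ≠ 0 → K.deg w = K.deg v + n ∧ K.qdeg w = K.qdeg v

variable {K} in
theorem IsHomogeneous.mul [Fintype V] {m n : ℤ} {B B' : Matrix V V ℤ} (h : K.IsHomogeneous m B)
    (h' : K.IsHomogeneous n B') : K.IsHomogeneous (m + n) (B * B') := by
  intro v w hvw
  obtain ⟨u, -, hu⟩ := Finset.exists_ne_zero_of_sum_ne_zero hvw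
  have h1 := h v u (left_ne_zero_of_mul hu)
  have h2 := h' u w (right_ne_zero_of_mul hu)
  exact ⟨by omega, by omega⟩

variable {K} in
theorem IsHomogeneous.add {n : ℤ} {B B' : Matrix V V ℤ} (h : K.IsHomogeneous n B)
    (h' : K.IsHomogeneous n B') : K.IsHomogeneous n (B + B') := by
  intro v w hvw
  by_cases h0 : B v w = 0
  · exact h' v w fun h1 => hvw (by simp [h0, h1])
  · exact h v w h0

variable {K} in
theorem IsHomogeneous.neg {n : ℤ} {B : Matrix V V ℤ} (h : K.IsHomogeneous n B) :
    K.IsHomogeneous n (-B) := fun v w hvw => h v w fun h0 => hvw (by simp [h0])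

variable {K} in
theorem IsHomogeneous.sub {n : ℤ} {B B' : Matrix V V ℤ} (h : K.IsHomogeneous n B)
    (h' : K.IsHomogeneous n B') : K.IsHomogeneous n (B - B') := sub_eq_add_neg B B' ▸ h.add h'.neg

theorem isHomogeneous_diagonal [DecidableEq V] (c : V → ℤ) :
    K.IsHomogeneous 0 (Matrix.diagonal c) := by
  intro v w hvw
  obtain rfl : v = w := by by_contra h; exact hvw (Matrix.diagonal_apply_ne _ h)
  simp

theorem isHomogeneous_one [DecidableEq V] : K.IsHomogeneous 0 1 :=
  Matrix.diagonal_one (n := V) (α := ℤ) ▸ K.isHomogeneous_diagonal _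

variable {K} in
theorem IsHomogeneous.pow [Fintype V] [DecidableEq V] {B : Matrix V V ℤ}
    (h : K.IsHomogeneous 0 B) (n : ℕ) : K.IsHomogeneous 0 (B ^ n) := by
  induction n with
  | zero => rw [pow_zero]; exact K.isHomogeneous_one
  | succ n ih => rw [pow_succ]; exact ih.mul h

theorem isHomogeneous_geom_sum [Fintype V] [DecidableEq V] {B : Matrix V V ℤ}
    (h : K.IsHomogeneous 0 B) (n : ℕ) : K.IsHomogeneous 0 (∑ i ∈ Finset.range n, B ^ i) := by
  induction n with
  | zero => intro v w hvw; simp at hvw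
  | succ n ih => rw [Finset.sum_range_succ]; exact ih.add (h.pow n)

/-- The part of the matrix `B` that raises the homological degree by `k`. -/
def degreePart (B : Matrix V V ℤ) (k : ℤ) : Matrix V V ℤ :=
  fun v w => if K.deg w = K.deg v + k then B v w else 0

theorem degreePart_mul [Fintype V] (B : Matrix V V ℤ) {B' : Matrix V V ℤ} {n : ℤ}
    (h : K.IsHomogeneous n B') (k : ℤ) :
    K.degreePart (B * B') k = K.degreePart B (k - n) * B' := by
  ext v w
  rw [degreePart, Matrix.mul_apply, Matrix.mul_apply]
  by_cases hk : K.deg w = K.deg v + k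
  · rw [if_pos hk]
    refine Finset.sum_congr rfl fun u _ => ?_
    by_cases h0 : B' u w = 0
    · simp [h0]
    · rw [degreePart, if_pos (by have := (h u w h0).1; omega)]
  · rw [if_neg hk]
    refine (Finset.sum_eq_zero fun u _ => ?_).symm
    by_cases h0 : B' u w = 0
    · simp [h0]
    · rw [degreePart, if_neg (by have := (h u w h0).1; omega), zero_mul]

open Classical in
/-- The part of the differential given by the matched pairs. -/
noncomputable def matchedPart : Matrix V V ℤ := fun v w => if M v w then K.inc v w else 0

open Classical in
/-- The inverse of the part of the differential given by the matched pairs. -/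
noncomputable def matchedInverse : Matrix V V ℤ :=
  fun v w => if M w v then Ring.inverse (K.inc w v) else 0

open Classical in
/-- The projection to the critical basis elements. -/
noncomputable def criticalProjection [DecidableEq V] (M : V → V → Prop) : Matrix V V ℤ :=
  Matrix.diagonal fun v => if IsCritical M v then 1 else 0

section Matching

variable {K M}

theorem isHomogeneous_matchedPart (hK : K.IsHomogeneous 1 (Matrix.of K.inc)) :
    K.IsHomogeneous 1 (K.matchedPart M) := by
  intro v w h
  unfold matchedPart at h
  split_ifs at h
  · exact hK v w h
  · exact (h rfl).elim

theorem isHomogeneous_matchedInverse (hK : K.IsHomogeneous 1 (Matrix.of K.inc))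
    (hM : K.IsAcyclicMatching M) : K.IsHomogeneous (-1) (K.matchedInverse M) := by
  intro v w h
  unfold matchedInverse at h
  split_ifs at h with hwv
  · have := hK w v (hM.hasseEdge w v hwv).2
    exact ⟨by omega, by omega⟩
  · exact (h rfl).elim

theorem weightMatrix_eq (hK : K.IsHomogeneous 1 (Matrix.of K.inc))
    (hM : K.IsAcyclicMatching M) :
    K.weightMatrix M = (Matrix.of K.inc - K.matchedPart M) - K.matchedInverse M := by
  ext v w
  simp only [weightMatrix, weight, matchedPart, matchedInverse, Matrix.sub_apply, Matrix.of_apply,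
    MorseEdge]
  by_cases hwv : M w v
  · have h1 := (hM.hasseEdge w v hwv).1
    have h0 : K.inc v w = 0 := by
      by_contra h
      have := (hK v w h).1
      omega
    have h2 : ¬ M v w := fun h => (hM.hasseEdge v w h).2 h0
    simp [hwv, h0, h2]
  · by_cases hvw : M v w
    · simp [hwv, hvw]
    · by_cases h0 : K.inc v w = 0
      · simp [hwv, hvw, h0, HasseEdge]
      · have h1 : K.HasseEdge v w := ⟨(hK v w h0).1, h0⟩
        simp [hwv, hvw, h1]

theorem morseEdge_of_unmatched (hK : K.IsHomogeneous 1 (Matrix.of K.inc)) {v w : V}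
    (h : (Matrix.of K.inc - K.matchedPart M) v w ≠ 0) : K.MorseEdge M v w := by
  simp only [Matrix.sub_apply, Matrix.of_apply, matchedPart] at h
  split_ifs at h with hvw
  · exact (h (sub_self _)).elim
  · rw [sub_zero] at h
    exact Or.inl ⟨⟨(hK v w h).1, h⟩, hvw⟩

theorem morseEdge_of_matchedInverse {v w : V} (h : K.matchedInverse M v w ≠ 0) :
    K.MorseEdge M v w := by
  unfold matchedInverse at h
  split_ifs at h with hwv
  · exact Or.inr hwv
  · exact (h rfl).elim

theorem matched_of_matchedPart_ne_zero {v w : V} (h : K.matchedPart M v w ≠ 0) : M v w := by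
  unfold matchedPart at h
  split_ifs at h with h'
  · exact h'
  · exact (h rfl).elim

theorem matched_of_matchedInverse_ne_zero {v w : V} (h : K.matchedInverse M v w ≠ 0) : M w v := by
  unfold matchedInverse at h
  split_ifs at h with h'
  · exact h'
  · exact (h rfl).elim

variable [Fintype V]

theorem matchedPart_sq (hM : K.IsAcyclicMatching M) : K.matchedPart M * K.matchedPart M = 0 := by
  ext v w
  refine Finset.sum_eq_zero fun u _ => ?_
  simp only [matchedPart]
  split_ifs with h1 h2
  · have h3 := hM.matching v u u w h1 h2 (by simp)
    have h4 := (hM.hasseEdge v u h1).1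
    rw [h3.1] at h4
    omega
  all_goals simp

theorem matchedInverse_sq (hM : K.IsAcyclicMatching M) :
    K.matchedInverse M * K.matchedInverse M = 0 := by
  ext v w
  refine Finset.sum_eq_zero fun u _ => ?_
  simp only [matchedInverse]
  split_ifs with h1 h2
  · have h3 := hM.matching u v w u h1 h2 (by simp)
    have h4 := (hM.hasseEdge u v h1).1
    rw [h3.2] at h4
    omega
  all_goals simp

variable [DecidableEq V]

theorem matchedPart_mul_matchedInverse (hM : K.IsAcyclicMatching M) :
    K.matchedPart M * K.matchedInverse M + K.matchedInverse M * K.matchedPart M =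
      1 - criticalProjection M := by
  classical
  have e1 : K.matchedPart M * K.matchedInverse M =
      Matrix.diagonal fun v => if ∃ u, M v u then 1 else 0 := by
    ext v w
    rw [Matrix.mul_apply, Matrix.diagonal_apply]
    by_cases hv : ∃ u, M v u
    · obtain ⟨u, hu⟩ := hv
      rw [Finset.sum_eq_single u]
      · by_cases hvw : v = w
        · subst hvw
          rw [if_pos rfl, if_pos ⟨u, hu⟩, matchedPart, matchedInverse, if_pos hu, if_pos hu,
            Ring.mul_inverse_cancel _ (hM.isUnit v u hu)]
        · rw [if_neg hvw, matchedInverse, if_neg, mul_zero]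
          exact fun h => hvw (hM.matching _ _ _ _ hu h (by simp)).1
      · intro u' _ hu'
        rw [matchedPart, if_neg, zero_mul]
        exact fun h => hu' (hM.matching _ _ _ _ h hu (by simp)).2
      · simp
    · rw [if_neg hv, ite_self]
      refine Finset.sum_eq_zero fun u _ => ?_
      rw [matchedPart, if_neg (fun h => hv ⟨u, h⟩), zero_mul]
  have e2 : K.matchedInverse M * K.matchedPart M =
      Matrix.diagonal fun v => if ∃ u, M u v then 1 else 0 := by
    ext v w
    rw [Matrix.mul_apply, Matrix.diagonal_apply]
    by_cases hv : ∃ u, M u v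
    · obtain ⟨u, hu⟩ := hv
      rw [Finset.sum_eq_single u]
      · by_cases hvw : v = w
        · subst hvw
          rw [if_pos rfl, if_pos ⟨u, hu⟩, matchedPart, matchedInverse, if_pos hu, if_pos hu,
            Ring.inverse_mul_cancel _ (hM.isUnit u v hu)]
        · rw [if_neg hvw, matchedPart, if_neg, mul_zero]
          exact fun h => hvw (hM.matching _ _ _ _ hu h (by simp)).2
      · intro u' _ hu'
        rw [matchedInverse, if_neg, zero_mul]
        exact fun h => hu' (hM.matching _ _ _ _ h hu (by simp)).1
      · simp
    · rw [if_neg hv, ite_self]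
      refine Finset.sum_eq_zero fun u _ => ?_
      rw [matchedInverse, if_neg (fun h => hv ⟨u, h⟩), zero_mul]
  rw [e1, e2, criticalProjection, Matrix.diagonal_add, ← Matrix.diagonal_one, Matrix.diagonal_sub]
  congr 1
  funext v
  by_cases h1 : ∃ u, M v u
  · obtain ⟨u, hu⟩ := h1
    have h2 : ¬ ∃ u, M u v := by
      rintro ⟨u', hu'⟩
      have h3 := hM.matching u' v v u hu' hu (by simp)
      have h4 := (hM.hasseEdge u' v hu').1
      rw [h3.1] at h4
      omega
    rw [if_pos ⟨u, hu⟩, if_neg h2, if_neg fun h => (h u).1 hu]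
    rfl
  · by_cases h2 : ∃ u, M u v
    · obtain ⟨u, hu⟩ := h2
      rw [if_neg h1, if_pos ⟨u, hu⟩, if_neg fun h => (h u).2 hu]
      rfl
    · rw [if_neg h1, if_neg h2, if_pos (show IsCritical M v from
        fun u => ⟨fun h => h1 ⟨u, h⟩, fun h => h2 ⟨u, h⟩⟩)]
      rfl

theorem criticalProjection_sq :
    criticalProjection M * criticalProjection M = criticalProjection M := by
  rw [criticalProjection, Matrix.diagonal_mul_diagonal]
  congr 1
  funext v
  split_ifs <;> rfl

theorem criticalProjection_mul_eq_zero {B : Matrix V V ℤ}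
    (h : ∀ v w, B v w ≠ 0 → ∃ u, M v u ∨ M u v) : criticalProjection M * B = 0 := by
  ext v w
  rw [criticalProjection, Matrix.diagonal_mul]
  by_cases h0 : B v w = 0
  · simp [h0]
  · obtain ⟨u, hu⟩ := h v w h0
    rw [if_neg fun hc => hu.elim (hc u).1 (hc u).2, zero_mul]
    rfl

theorem mul_criticalProjection_eq_zero {B : Matrix V V ℤ}
    (h : ∀ v w, B v w ≠ 0 → ∃ u, M w u ∨ M u w) : B * criticalProjection M = 0 := by
  ext v w
  rw [criticalProjection, Matrix.mul_diagonal]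
  by_cases h0 : B v w = 0
  · simp [h0]
  · obtain ⟨u, hu⟩ := h v w h0
    rw [if_neg fun hc => hu.elim (hc u).1 (hc u).2, mul_zero]
    rfl

/-- A path between critical elements starts and ends with edges that raise the degree and has no two
successive reversed edges, so that it raises the degree by one only if it alternates. In terms of
matrices: the degree one part of the path sums between critical elements is the transferred
perturbation of the matched part of the differential by the unmatched part. -/
theorem gamma_degreePart (hK : K.IsHomogeneous 1 (Matrix.of K.inc)) (hM : K.IsAcyclicMatching M)
    {X : Matrix V V ℤ}
    (hX : (1 + (Matrix.of K.inc - K.matchedPart M) * K.matchedInverse M) * X = 1) :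
    criticalProjection M * K.degreePart (Matrix.of (K.Gamma M)) 1 * criticalProjection M =
      criticalProjection M * (X * (Matrix.of K.inc - K.matchedPart M)) *
        criticalProjection M := by
  set U := Matrix.of K.inc - K.matchedPart M with hU
  set Φ := K.matchedInverse M with hΦ
  set π := criticalProjection M with hπ
  set N := Matrix.of (K.Gamma M) with hN
  have hUh : K.IsHomogeneous 1 U := hK.sub (isHomogeneous_matchedPart hK)
  have hΦh : K.IsHomogeneous (-1) Φ := isHomogeneous_matchedInverse hK hM
  have hΦΦ : Φ * Φ = 0 := matchedInverse_sq hM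
  have hπΦ : π * Φ = 0 := criticalProjection_mul_eq_zero fun v w h =>
    ⟨w, Or.inr (matched_of_matchedInverse_ne_zero h)⟩
  have hΦπ : Φ * π = 0 := mul_criticalProjection_eq_zero fun v w h =>
    ⟨v, Or.inl (matched_of_matchedInverse_ne_zero h)⟩
  have hrec : N = 1 + N * U - N * Φ := by
    have h := K.gamma_mul M hM.acyclic
    rw [weightMatrix_eq hK hM, mul_sub, mul_one, mul_sub] at h
    calc N = (N - (N * U - N * Φ)) + N * U - N * Φ := by abel
      _ = _ := by rw [h]
  have hrec' : ∀ k, K.degreePart N k =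
      K.degreePart 1 k + K.degreePart N (k - 1) * U - K.degreePart N (k + 1) * Φ := by
    intro k
    rw [show k + 1 = k - (-1) by ring, ← K.degreePart_mul N hUh, ← K.degreePart_mul N hΦh]
    ext v w
    conv_lhs => rw [hrec]
    simp only [degreePart, Matrix.sub_apply, Matrix.add_apply]
    split_ifs <;> simp
  have hone : ∀ k, k ≠ 0 → K.degreePart 1 k = 0 := by
    intro k hk
    ext v w
    rw [degreePart]
    split_ifs with h
    · have : v ≠ w := by rintro rfl; omega
      rw [Matrix.one_apply_ne this]; rfl
    · rfl
  have hone0 : K.degreePart 1 0 = 1 := by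
    ext v w
    rw [degreePart]
    split_ifs with h
    · rfl
    · have : v ≠ w := by rintro rfl; omega
      rw [Matrix.one_apply_ne this]
  have hstep : ∀ k, π * K.degreePart 1 (k + 1) * Φ = 0 → 
      π * K.degreePart N k * (1 + U * Φ) =
        π * K.degreePart 1 k + π * K.degreePart N (k - 1) * U := by
    intro k hk
    have h1 : π * K.degreePart N (k + 1) * Φ = π * K.degreePart N k * U * Φ := by
      rw [hrec' (k + 1), add_sub_cancel_right]
      calc π * (K.degreePart 1 (k + 1) + K.degreePart N k * U - K.degreePart N (k + 1 + 1) * Φ) * Φ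
          = π * K.degreePart 1 (k + 1) * Φ + π * K.degreePart N k * U * Φ -
            π * K.degreePart N (k + 1 + 1) * (Φ * Φ) := by noncomm_ring
        _ = _ := by rw [hk, hΦΦ]; simp
    rw [mul_add, mul_one]
    nth_rewrite 1 [hrec' k]
    rw [← mul_assoc, ← h1]
    noncomm_ring
  have hneg : ∀ n : ℕ, ∀ k : ℤ, k < 0 →
      k ≤ n - 2 * (∑ v, |K.deg v|) - 1 → π * K.degreePart N k = 0 := by
    have hb : ∀ v, |K.deg v| ≤ ∑ v, |K.deg v| :=
      fun v => Finset.single_le_sum (fun v _ => abs_nonneg (K.deg v)) (Finset.mem_univ v)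
    intro n
    induction n with
    | zero =>
      intro k _ hk
      have : K.degreePart N k = 0 := by
        ext v w
        rw [degreePart, if_neg]
        · rfl
        · intro h
          have h1 := abs_le.1 (hb v)
          have h2 := abs_le.1 (hb w)
          push_cast at hk
          omega
      rw [this, mul_zero]
    | succ n ih =>
      intro k hk0 hk
      push_cast at hk
      have h := hstep k (by
        by_cases hk1 : k + 1 = 0
        · rw [hk1, hone0, mul_one, hπΦ]
        · rw [hone _ hk1, mul_zero, zero_mul])
      rw [ih (k - 1) (by omega) (by omega), hone k (by omega), mul_zero, zero_mul, add_zero] at h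
      calc π * K.degreePart N k = π * K.degreePart N k * ((1 + U * Φ) * X) := by rw [hX, mul_one]
        _ = 0 := by rw [← mul_assoc, h, zero_mul]
  have hm1 : π * K.degreePart N (-1) = 0 := by
    refine hneg (2 * (∑ v, |K.deg v|)).toNat (-1) (by norm_num) ?_
    have : 0 ≤ ∑ v, |K.deg v| := Finset.sum_nonneg fun v _ => abs_nonneg _
    omega
  have h0 : π * K.degreePart N 0 = π * X := by
    have h := hstep 0 (by rw [hone _ (by norm_num), mul_zero, zero_mul])
    rw [zero_sub, hm1, hone0, zero_mul, add_zero, mul_one] at h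
    calc π * K.degreePart N 0 = π * K.degreePart N 0 * ((1 + U * Φ) * X) := by rw [hX, mul_one]
      _ = _ := by rw [← mul_assoc, h]
  rw [hrec' 1, hone 1 one_ne_zero]
  calc π * (0 + K.degreePart N (1 - 1) * U - K.degreePart N (1 + 1) * Φ) * π
      = (π * K.degreePart N 0) * U * π - π * K.degreePart N (1 + 1) * (Φ * π) := by
        rw [sub_self]; noncomm_ring
    _ = _ := by rw [h0, hΦπ]; noncomm_ring

end Matching

end BasedComplex

namespace BasedComplex

/-- Algebraic discrete Morse theory: the Morse complex of an acyclic matching, spanned by the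
critical basis elements, with the path sums as incidence numbers, is a complex with the same
cohomology. -/
theorem morse_complex {V V' : Type*} [Finite V] [Finite V'] {K : BasedComplex V}
    (K' : BasedComplex V') {M : V → V → Prop} (hM : K.IsAcyclicMatching M)
    (hK : K.IsHomogeneous 1 (Matrix.of K.inc)) (hKd : K.IsComplex) {c : V' → V}
    (hc : Function.Injective c) (hcr : ∀ v, IsCritical M v ↔ v ∈ Set.range c)
    (hdeg : ∀ t, K'.deg t = K.deg (c t)) (hqdeg : ∀ t, K'.qdeg t = K.qdeg (c t))
    (hinc : ∀ t t', K'.inc t t' = K.Gamma M (c t) (c t')) :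
    K'.IsComplex ∧ ∀ i j, Nonempty (K'.Cohomology i j ≃ₗ[ℤ] K.Cohomology i j) := by
  classical
  have := Fintype.ofFinite V
  set D : Matrix V V ℤ := Matrix.of K.inc with hD
  set d := K.matchedPart M with hd
  set U := D - d with hU
  set Φ := K.matchedInverse M with hΦ
  set π := criticalProjection M with hπ
  have hdh : K.IsHomogeneous 1 d := isHomogeneous_matchedPart hK
  have hUh : K.IsHomogeneous 1 U := hK.sub hdh
  have hΦh : K.IsHomogeneous (-1) Φ := isHomogeneous_matchedInverse hK hM
  have hπh : K.IsHomogeneous 0 π := K.isHomogeneous_diagonal _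
  have hUΦ : K.IsHomogeneous 0 (-(U * Φ)) := (hUh.mul hΦh).neg
  obtain ⟨n, hn⟩ : IsNilpotent (-(U * Φ)) := by
    refine (isNilpotent_of_acyclic hM.acyclic (U * Φ) fun v w h => ?_).neg
    obtain ⟨u, -, hu⟩ := Finset.exists_ne_zero_of_sum_ne_zero h
    exact .tail (.single (morseEdge_of_unmatched hK (left_ne_zero_of_mul hu)))
      (morseEdge_of_matchedInverse (right_ne_zero_of_mul hu))
  set X := ∑ i ∈ Finset.range n, (-(U * Φ)) ^ i with hX
  have hXh : K.IsHomogeneous 0 X := K.isHomogeneous_geom_sum hUΦ n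
  have hXr : (1 + U * Φ) * X = 1 := by
    rw [hX, ← sub_neg_eq_add, mul_neg_geom_sum, hn, sub_zero]
  have hXl : X * (1 + U * Φ) = 1 := by
    rw [hX, ← sub_neg_eq_add, geom_sum_mul_neg, hn, sub_zero]
  set A := X * U with hA
  have hAh : K.IsHomogeneous 1 A := by simpa using hXh.mul hUh
  have hl : A = U - U * Φ * A := by
    have h : (1 + U * Φ) * A = U := by rw [hA, ← mul_assoc, hXr, one_mul]
    rw [eq_sub_iff_add_eq]
    rw [add_mul, one_mul] at h
    exact h
  have hr : A = U - A * Φ * U := by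
    have h : A + A * Φ * U = X * (1 + U * Φ) * U := by rw [hA]; noncomm_ring
    rw [eq_sub_iff_add_eq, h, hXl, one_mul]
  have hdU : d + U = D := by rw [hU]; abel
  have h1 : d * Φ + Φ * d = 1 - π := matchedPart_mul_matchedInverse hM
  have hdd : d * d = 0 := matchedPart_sq hM
  have hΦΦ : Φ * Φ = 0 := matchedInverse_sq hM
  have hππ : π * π = π := criticalProjection_sq
  have hπΦ : π * Φ = 0 := criticalProjection_mul_eq_zero fun v w h =>
    ⟨w, Or.inr (matched_of_matchedInverse_ne_zero h)⟩
  have hΦπ : Φ * π = 0 := mul_criticalProjection_eq_zero fun v w h =>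
    ⟨v, Or.inl (matched_of_matchedInverse_ne_zero h)⟩
  have hπd : π * d = 0 := criticalProjection_mul_eq_zero fun v w h =>
    ⟨w, Or.inl (matched_of_matchedPart_ne_zero h)⟩
  have hdπ : d * π = 0 := mul_criticalProjection_eq_zero fun v w h =>
    ⟨v, Or.inr (matched_of_matchedPart_ne_zero h)⟩
  -- The differentials are blocks of `D` and of `π A π`.
  have hKblock : ∀ i i' j, K.d i i' j = blockMap (Subtype.val : K.Basis i j → V)
      (Subtype.val : K.Basis i' j → V) D := fun _ _ _ => rfl
  have hbasis : ∀ {n : ℤ} {B : Matrix V V ℤ} {i j i' j' : ℤ} {v u : V}, K.IsHomogeneous n B →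
      B v u ≠ 0 → K.deg v = i → K.qdeg v = j → i' = i + n → j' = j →
      u ∈ Set.range (Subtype.val : K.Basis i' j' → V) := by
    intro n B i j i' j' v u hB h hi hj hi' hj'
    have := hB v u h
    exact ⟨⟨u, by omega, by omega⟩, rfl⟩
  have hcrit : ∀ {n : ℤ} {B : Matrix V V ℤ} {i j i' j' : ℤ} {v u : V}, K.IsHomogeneous n B →
      (B * π) v u ≠ 0 → K.deg v = i → K.qdeg v = j → i' = i + n → j' = j →
      u ∈ Set.range fun t : K'.Basis i' j' => c t.1 := by
    intro n B i j i' j' v u hB h hi hj hi' hj'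
    rw [hπ, criticalProjection, Matrix.mul_diagonal] at h
    have h2 : IsCritical M u := by
      by_contra h2
      rw [if_neg h2, mul_zero] at h
      exact h rfl
    obtain ⟨t, rfl⟩ := (hcr u).1 h2
    have := hB v _ (left_ne_zero_of_mul h)
    exact ⟨⟨t, by rw [hdeg]; omega, by rw [hqdeg]; omega⟩, rfl⟩
  have hcv : ∀ i j, Function.Injective fun t : K'.Basis i j => c t.1 :=
    fun i j t t' h => Subtype.ext (hc h)
  have hvv : ∀ i j, Function.Injective (Subtype.val : K.Basis i j → V) :=
    fun i j => Subtype.val_injective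
  have hdeg' : ∀ {i j} (t : K'.Basis i j), K.deg (c t.1) = i ∧ K.qdeg (c t.1) = j :=
    fun t => ⟨(hdeg t.1).symm.trans t.2.1, (hqdeg t.1).symm.trans t.2.2⟩
  have hK'block : ∀ i i' j, i' = i + 1 → K'.d i i' j = blockMap (fun t : K'.Basis i j => c t.1)
      (fun t : K'.Basis i' j => c t.1) (π * A * π) := by
    rintro i _ j rfl
    refine blockMap_ext fun t t' => ?_
    have h := gamma_degreePart hK hM hXr
    have h' := congrFun (congrFun h (c t.1)) (c t'.1)
    change _ = (π * A * π) (c t.1) (c t'.1) at h'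
    have ht : IsCritical M (c t.1) := (hcr _).2 ⟨_, rfl⟩
    have ht' : IsCritical M (c t'.1) := (hcr _).2 ⟨_, rfl⟩
    rw [← h', criticalProjection, Matrix.mul_diagonal, Matrix.diagonal_mul, if_pos ht, if_pos ht',
      one_mul, mul_one, degreePart, if_pos (by rw [(hdeg' t).1, (hdeg' t').1])]
    simp [BasedComplex.d, hinc]
  have hDD : D * D = 0 := by
    ext v w
    by_contra h
    have hvw := (hK.mul hK) v w h
    have h2 := hKd (K.deg v + 1) (K.qdeg v)
    rw [hKblock, hKblock, blockMap_comp (hvv _ _)] at h2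
    · have h3 := DFunLike.congr_fun (LinearMap.congr_fun h2
        (Finsupp.single (⟨v, by ring, rfl⟩ : K.Basis (K.deg v + 1 - 1) (K.qdeg v)) 1))
        (⟨w, by have := hvw.1; omega, hvw.2⟩ : K.Basis (K.deg v + 1 + 1) (K.qdeg v))
      rw [blockMap_single] at h3
      exact h h3
    · intro x u y hx _
      exact hbasis hK hx x.2.1 x.2.2 (by ring) rfl
  have hmc : A * d + d * A + A * π * A = 0 :=
    perturbation_maurerCartan (by rw [hdU, hDD]) hdd h1 hl hr
  set F := (1 - Φ * A) * π with hF
  set G := π * (1 - A * Φ) with hG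
  set S := Φ - Φ * A * Φ with hS
  have hDF : D * F = F * (π * A * π) := hdU ▸ perturbation_projection h1 hl hmc hππ hdπ
  have hGD : G * D = (π * A * π) * G := hdU ▸ perturbation_inclusion h1 hr hmc hππ hπd
  have hGF : G * F = π := perturbation_retract hΦΦ hππ hπΦ hΦπ
  have hFG : F * G = 1 - (D * S + S * D) := hdU ▸ perturbation_homotopy h1 hl hr hmc hππ
  have hF0 : K.IsHomogeneous 0 (1 - Φ * A) := K.isHomogeneous_one.sub (by simpa using hΦh.mul hAh)
  have hG0 : K.IsHomogeneous 0 (1 - A * Φ) := K.isHomogeneous_one.sub (by simpa using hAh.mul hΦh)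
  have hGh : K.IsHomogeneous 0 G := by simpa using hπh.mul hG0
  have hSh : K.IsHomogeneous (-1) S := hΦh.sub (by simpa using (hΦh.mul hAh).mul hΦh)
  have hπA : K.IsHomogeneous 1 (π * A) := by simpa using hπh.mul hAh
  have hFπ : ∀ (i j : ℤ) (x : K.Basis i j) u, F x.1 u ≠ 0 →
      u ∈ Set.range fun t : K'.Basis i j => c t.1 :=
    fun i j x u hx => hcrit hF0 hx x.2.1 x.2.2 (by ring) rfl
  have hAπ : ∀ (i i' j : ℤ), i' = i + 1 → ∀ (t : K'.Basis i j) u, (π * A * π) (c t.1) u ≠ 0 →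
      u ∈ Set.range fun t : K'.Basis i' j => c t.1 :=
    fun i i' j hi t u hx => hcrit hπA hx (hdeg' t).1 (hdeg' t).2 hi rfl
  have hG' : ∀ (i j : ℤ) (t : K'.Basis i j) u, G (c t.1) u ≠ 0 →
      u ∈ Set.range (Subtype.val : K.Basis i j → V) :=
    fun i j t u hx => hbasis hGh hx (hdeg' t).1 (hdeg' t).2 (by ring) rfl
  have hD' : ∀ (i i' j : ℤ), i' = i + 1 → ∀ (x : K.Basis i j) u, D x.1 u ≠ 0 →
      u ∈ Set.range (Subtype.val : K.Basis i' j → V) :=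
    fun i i' j hi x u hx => hbasis hK hx x.2.1 x.2.2 hi rfl
  have hS' : ∀ (i i' j : ℤ), i = i' + 1 → ∀ (x : K.Basis i j) u, S x.1 u ≠ 0 →
      u ∈ Set.range (Subtype.val : K.Basis i' j → V) :=
    fun i i' j hi x u hx => hbasis hSh hx x.2.1 x.2.2 (by omega) rfl
  refine ⟨fun i j => ?_, fun i j => ?_⟩
  · rw [hK'block _ _ _ rfl, hK'block _ _ _ (sub_add_cancel i 1).symm, blockMap_comp (hcv _ _),
      perturbation_sq hmc hππ hπd hdπ]
    · exact (blockMap_ext fun _ _ => rfl).symm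
    · exact fun t u _ hx _ => hAπ _ _ _ (sub_add_cancel i 1).symm t u hx
  · refine nonempty_cohomology_equiv (K.d (i - 1) i j) (K.d i (i + 1) j) (K'.d (i - 1) i j)
      (K'.d i (i + 1) j)
      (blockMap Subtype.val (fun t => c t.1) F) (blockMap Subtype.val (fun t => c t.1) F)
      (blockMap Subtype.val (fun t => c t.1) F) (blockMap (fun t => c t.1) Subtype.val G)
      (blockMap (fun t => c t.1) Subtype.val G) (blockMap (fun t => c t.1) Subtype.val G)
      (blockMap Subtype.val Subtype.val S) (blockMap Subtype.val Subtype.val S) ?_ ?_ ?_ ?_ ?_ ?_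
    · rw [hKblock, hK'block _ _ _ (sub_add_cancel i 1).symm, blockMap_comp (hvv _ _),
        blockMap_comp (hcv _ _), hDF]
      · exact fun x u _ hx _ => hFπ _ _ x u hx
      · exact fun x u _ hx _ => hD' _ _ _ (sub_add_cancel i 1).symm x u hx
    · rw [hKblock, hK'block _ _ _ rfl, blockMap_comp (hvv _ _), blockMap_comp (hcv _ _), hDF]
      · exact fun x u _ hx _ => hFπ _ _ x u hx
      · exact fun x u _ hx _ => hD' _ _ _ rfl x u hx
    · rw [hKblock, hK'block _ _ _ (sub_add_cancel i 1).symm, blockMap_comp (hvv _ _),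
        blockMap_comp (hcv _ _), hGD]
      · exact fun t u _ hx _ => hAπ _ _ _ (sub_add_cancel i 1).symm t u hx
      · exact fun t u _ hx _ => hG' _ _ t u hx
    · rw [hKblock, hK'block _ _ _ rfl, blockMap_comp (hvv _ _), blockMap_comp (hcv _ _), hGD]
      · exact fun t u _ hx _ => hAπ _ _ _ rfl t u hx
      · exact fun t u _ hx _ => hG' _ _ t u hx
    · rw [blockMap_comp (hvv _ _), hGF]
      · refine (blockMap_ext fun t t' => ?_).symm
        have ht : IsCritical M (c t.1) := (hcr _).2 ⟨_, rfl⟩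
        rw [hπ, criticalProjection, Matrix.diagonal_apply, if_pos ht, LinearMap.id_apply,
          Finsupp.single_apply]
        exact if_congr ⟨fun h => h ▸ rfl, fun h => hcv _ _ h⟩ rfl rfl
      · exact fun t u _ hx _ => hG' _ _ t u hx
    · rw [hKblock, hKblock, blockMap_comp (hcv _ _), blockMap_comp (hvv _ _),
        blockMap_comp (hvv _ _), hFG]
      · refine (blockMap_ext fun x y => ?_).symm
        simp only [LinearMap.sub_apply, LinearMap.add_apply, LinearMap.id_apply,
          Finsupp.sub_apply, Finsupp.add_apply, blockMap_single, Matrix.sub_apply,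
          Matrix.add_apply, Matrix.one_apply, Finsupp.single_apply, Subtype.ext_iff]
      · exact fun x u _ hx _ => hS' _ _ _ (sub_add_cancel i 1).symm x u hx
      · exact fun x u _ hx _ => hD' _ _ _ rfl x u hx
      · exact fun x u _ hx _ => hFπ _ _ x u hx

end BasedComplex

/-! ### Joining two classes of an equivalence relation -/

/-- The relation `r'` arises from the equivalence relation `r` by joining the classes of
`u` and `v`. -/
def IsJoin {X : Type*} (r r' : X → X → Prop) (u v : X) : Prop :=
  ∀ x y, r' x y ↔ r x y ∨ (r x u ∧ r v y) ∨ (r x v ∧ r u y)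

theorem Equivalence.join {X : Type*} {r : X → X → Prop} (h : Equivalence r) (u v : X) :
    Equivalence fun x y => r x y ∨ (r x u ∧ r v y) ∨ (r x v ∧ r u y) where
  refl x := Or.inl (h.refl x)
  symm := by
    rintro x y (h1 | ⟨h1, h2⟩ | ⟨h1, h2⟩)
    · exact Or.inl (h.symm h1)
    · exact Or.inr (Or.inr ⟨h.symm h2, h.symm h1⟩)
    · exact Or.inr (Or.inl ⟨h.symm h2, h.symm h1⟩)
  trans := by
    rintro x y z (h1 | ⟨h1, h2⟩ | ⟨h1, h2⟩) (h3 | ⟨h3, h4⟩ | ⟨h3, h4⟩)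
    · exact Or.inl (h.trans h1 h3)
    · exact Or.inr (Or.inl ⟨h.trans h1 h3, h4⟩)
    · exact Or.inr (Or.inr ⟨h.trans h1 h3, h4⟩)
    · exact Or.inr (Or.inl ⟨h1, h.trans h2 h3⟩)
    · exact Or.inr (Or.inl ⟨h1, h4⟩)
    · exact Or.inl (h.trans h1 h4)
    · exact Or.inr (Or.inr ⟨h1, h.trans h2 h3⟩)
    · exact Or.inl (h.trans h1 h4)
    · exact Or.inr (Or.inr ⟨h1, h4⟩)

theorem Relation.EqvGen.le_of_equivalence {X : Type*} {r s : X → X → Prop} (hs : Equivalence s)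
    (h : ∀ x y, r x y → s x y) {x y : X} (hxy : Relation.EqvGen r x y) : s x y := by
  induction hxy with
  | rel x y hr => exact h x y hr
  | refl x => exact hs.refl x
  | symm x y _ ih => exact hs.symm ih
  | trans x y z _ _ ih1 ih2 => exact hs.trans ih1 ih2

theorem IsJoin.of_rel {X : Type*} {r r' : X → X → Prop} {u v : X} (hr : Equivalence r)
    (h : IsJoin r r' u v) (huv : r u v) (x y : X) : r' x y ↔ r x y := by
  rw [h x y]
  constructor
  · rintro (h1 | ⟨h1, h2⟩ | ⟨h1, h2⟩)
    · exact h1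
    · exact hr.trans h1 (hr.trans huv h2)
    · exact hr.trans h1 (hr.trans (hr.symm huv) h2)
  · exact Or.inl

/-- Sums over the fibers of a map that identifies exactly two elements. -/
theorem sum_add_eq_of_identifies {A B : Type*} [Fintype A] [Fintype B] {p : A → B} {u v : A}
    (huv : u ≠ v) (hp : p u = p v) (hsurj : Function.Surjective p)
    (hinj : ∀ x y, p x = p y → x = y ∨ (x = u ∧ y = v) ∨ (x = v ∧ y = u)) (g : A → ℤ) (g' : B → ℤ)
    (h : ∀ x, x ≠ u → x ≠ v → g' (p x) = g x) :
    ∑ x, g x + g' (p u) = ∑ y, g' y + (g u + g v) := by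
  classical
  have h1 : ∑ y, g' y = ∑ x ∈ Finset.univ.erase v, g' (p x) := by
    refine (Finset.sum_nbij p (by simp) ?_ ?_ (fun _ _ => rfl)).symm
    · intro x hx y hy hxy
      simp only [Finset.coe_erase, Finset.coe_univ, Set.mem_sdiff, Set.mem_univ,
        Set.mem_singleton_iff, true_and] at hx hy
      rcases hinj x y hxy with h | ⟨-, h⟩ | ⟨h, -⟩
      · exact h
      · exact (hy h).elim
      · exact (hx h).elim
    · intro y _
      obtain ⟨x, rfl⟩ := hsurj y
      by_cases hxv : x = v
      · exact ⟨u, by simp [huv], by rw [hxv, hp]⟩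
      · exact ⟨x, by simp [hxv], rfl⟩
  rw [h1, ← Finset.add_sum_erase _ g (Finset.mem_univ v)]
  have hu : u ∈ Finset.univ.erase v := by simp [huv]
  rw [← Finset.add_sum_erase _ g hu, ← Finset.add_sum_erase _ (fun x => g' (p x)) hu]
  have h2 : ∑ x ∈ (Finset.univ.erase v).erase u, g' (p x) =
      ∑ x ∈ (Finset.univ.erase v).erase u, g x := by
    refine Finset.sum_congr rfl fun x hx => ?_
    simp only [Finset.mem_erase, Finset.mem_univ, and_true] at hx
    exact h x hx.1 hx.2
  rw [h2]
  ring

section JoinQuot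

variable {X : Type*} {r r' : X → X → Prop} {u v : X}

theorem quot_mk_eq_iff {X : Type*} {r : X → X → Prop} (x y : X) :
    Quot.mk r x = Quot.mk r y ↔ Relation.EqvGen r x y :=
  Quot.eq

/-- Sums over the classes of two equivalence relations, the second of which joins two classes
of the first. -/
theorem sum_quot_of_isJoin [Fintype (Quot r)] [Fintype (Quot r')]
    (h : IsJoin (Relation.EqvGen r) (Relation.EqvGen r') u v) (huv : ¬ Relation.EqvGen r u v)
    (g : Quot r → ℤ) (g' : Quot r' → ℤ)
    (hg : ∀ x, ¬ Relation.EqvGen r x u → ¬ Relation.EqvGen r x v →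
      g' (Quot.mk _ x) = g (Quot.mk _ x)) :
    ∑ q, g q + g' (Quot.mk _ u) = ∑ q, g' q + (g (Quot.mk _ u) + g (Quot.mk _ v)) := by
  have hle : ∀ x y, r x y → Quot.mk r' x = Quot.mk r' y := fun x y hxy =>
    (quot_mk_eq_iff x y).2 ((h x y).2 (Or.inl (.rel x y hxy)))
  refine sum_add_eq_of_identifies (p := Quot.lift (Quot.mk r') hle)
    (u := Quot.mk r u) (v := Quot.mk r v) ?_ ?_ ?_ ?_ g g' ?_
  · rwa [Ne, quot_mk_eq_iff]
  · exact (quot_mk_eq_iff u v).2 ((h u v).2 (Or.inr (Or.inl ⟨.refl u, .refl v⟩)))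
  · rintro ⟨x⟩
    exact ⟨Quot.mk _ x, rfl⟩
  · rintro ⟨x⟩ ⟨y⟩ hxy
    have h1 := (h x y).1 ((quot_mk_eq_iff x y).1 hxy)
    rw [quot_mk_eq_iff, quot_mk_eq_iff, quot_mk_eq_iff, quot_mk_eq_iff, quot_mk_eq_iff]
    rcases h1 with h1 | ⟨h1, h2⟩ | ⟨h1, h2⟩
    · exact Or.inl h1
    · exact Or.inr (Or.inl ⟨h1, h2.symm⟩)
    · exact Or.inr (Or.inr ⟨h1, h2.symm⟩)
  · rintro ⟨x⟩ hxu hxv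
    exact hg x (fun h => hxu ((quot_mk_eq_iff x u).2 h)) fun h => hxv ((quot_mk_eq_iff x v).2 h)

theorem card_quot_of_isJoin [Finite X]
    (h : IsJoin (Relation.EqvGen r) (Relation.EqvGen r') u v) (huv : ¬ Relation.EqvGen r u v) :
    Nat.card (Quot r) = Nat.card (Quot r') + 1 := by
  have := Fintype.ofFinite (Quot r)
  have := Fintype.ofFinite (Quot r')
  have h1 := sum_quot_of_isJoin h huv (fun _ => 1) (fun _ => 1) fun _ _ _ => rfl
  simp only [Finset.sum_const, Finset.card_univ, nsmul_eq_mul, mul_one] at h1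
  rw [Nat.card_eq_fintype_card, Nat.card_eq_fintype_card]
  omega

theorem card_quot_congr (h : ∀ x y, Relation.EqvGen r x y ↔ Relation.EqvGen r' x y) :
    Nat.card (Quot r) = Nat.card (Quot r') := by
  refine Nat.card_eq_of_bijective (Quot.lift (Quot.mk r') fun x y hxy =>
    (quot_mk_eq_iff x y).2 ((h x y).1 (.rel x y hxy))) ⟨?_, ?_⟩
  · rintro ⟨x⟩ ⟨y⟩ hxy
    exact (quot_mk_eq_iff x y).2 ((h x y).2 ((quot_mk_eq_iff x y).1 hxy))
  · rintro ⟨x⟩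
    exact ⟨Quot.mk _ x, rfl⟩

end JoinQuot

/-! ### Connectivity by a set of edges -/

/-- `x` and `y` are connected by edges in `H`, where the edge `e` has the ends `a e` and `b e`. -/
def EdgeConn {C X : Type*} (a b : C → X) (H : Set C) : X → X → Prop :=
  Relation.EqvGen fun x y => ∃ e ∈ H, (x = a e ∧ y = b e) ∨ (y = a e ∧ x = b e)

section EdgeConn

variable {C X : Type*} {a b : C → X} {H : Set C}

theorem edgeConn_equivalence (a b : C → X) (H : Set C) : Equivalence (EdgeConn a b H) :=
  Relation.EqvGen.is_equivalence _

theorem edgeConn_ends {e : C} (he : e ∈ H) : EdgeConn a b H (a e) (b e) :=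
  .rel _ _ ⟨e, he, Or.inl ⟨rfl, rfl⟩⟩

theorem EdgeConn.of_equivalence {s : X → X → Prop} (hs : Equivalence s)
    (h : ∀ e ∈ H, s (a e) (b e)) {x y : X} (hxy : EdgeConn a b H x y) : s x y := by
  refine Relation.EqvGen.le_of_equivalence hs ?_ hxy
  rintro x y ⟨e, he, ⟨rfl, rfl⟩ | ⟨rfl, rfl⟩⟩
  · exact h e he
  · exact hs.symm (h e he)

theorem EdgeConn.mono {H' : Set C} (h : H ⊆ H') {x y : X} (hxy : EdgeConn a b H x y) :
    EdgeConn a b H' x y :=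
  hxy.of_equivalence (edgeConn_equivalence a b H') fun _ he => edgeConn_ends (h he)

/-- A new edge joins the components of its ends. -/
theorem edgeConn_insert (e : C) :
    IsJoin (EdgeConn a b H) (EdgeConn a b (insert e H)) (a e) (b e) := by
  intro x y
  constructor
  · intro h
    refine h.of_equivalence ((edgeConn_equivalence a b H).join (a e) (b e)) ?_
    intro f hf
    rcases Set.mem_insert_iff.1 hf with rfl | hf
    · exact Or.inr (Or.inl ⟨.refl _, .refl _⟩)
    · exact Or.inl (edgeConn_ends hf)
  · have hm : ∀ {x y}, EdgeConn a b H x y → EdgeConn a b (insert e H) x y :=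
      fun h => h.mono (Set.subset_insert e H)
    have he : EdgeConn a b (insert e H) (a e) (b e) := edgeConn_ends (Set.mem_insert e H)
    rintro (h | ⟨h1, h2⟩ | ⟨h1, h2⟩)
    · exact hm h
    · exact (hm h1).trans _ _ _ (he.trans _ _ _ (hm h2))
    · exact (hm h1).trans _ _ _ (he.symm.trans _ _ _ (hm h2))

end EdgeConn

/-! ### Cycles of a permutation and transpositions -/

/-- Multiplication with the transposition `(u v)` splits the cycle of `u` and `v` if they lie on the
same one, and merges their cycles otherwise. -/
theorem sameCycle_swap_mul {X : Type*} [Finite X] [DecidableEq X] (σ : Equiv.Perm X) {u v : X}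
    (huv : u ≠ v) : (Equiv.swap u v * σ).SameCycle u v ↔ ¬ σ.SameCycle u v := by
  -- `n` is the first positive time at which the cycle of `u` meets `u` or `v`.
  have hex : ∃ n : ℕ, 0 < n ∧ ((σ ^ n) u = u ∨ (σ ^ n) u = v) :=
    ⟨orderOf σ, orderOf_pos σ, Or.inl (by rw [pow_orderOf_eq_one]; rfl)⟩
  classical
  obtain ⟨hn0, hn⟩ := Nat.find_spec hex
  set n := Nat.find hex
  have hmin : ∀ i, 0 < i → i < n → (σ ^ i) u ≠ u ∧ (σ ^ i) u ≠ v := fun i hi hin => by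
    have := Nat.find_min hex hin
    exact ⟨fun h => this ⟨hi, Or.inl h⟩, fun h => this ⟨hi, Or.inr h⟩⟩
  set τ := Equiv.swap u v * σ with hτ
  have hτpow : ∀ i, i < n → (τ ^ i) u = (σ ^ i) u := by
    intro i
    induction i with
    | zero => simp
    | succ i ih =>
      intro hi
      rw [pow_succ', Equiv.Perm.mul_apply, ih (by omega), hτ, Equiv.Perm.mul_apply,
        ← Equiv.Perm.mul_apply σ, ← pow_succ']
      exact Equiv.swap_apply_of_ne_of_ne (hmin _ (by omega) hi).1 (hmin _ (by omega) hi).2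
  have hτn : (τ ^ n) u = Equiv.swap u v ((σ ^ n) u) := by
    obtain ⟨m, hm⟩ : ∃ m, n = m + 1 := ⟨n - 1, by omega⟩
    rw [hm, pow_succ', Equiv.Perm.mul_apply, hτpow m (by omega), hτ, Equiv.Perm.mul_apply,
      ← Equiv.Perm.mul_apply σ, ← pow_succ']
  -- If the `n`-th iterate of a permutation is `u`, the orbit of `u` is given by the first `n` ones.
  have horb : ∀ ρ : Equiv.Perm X, (∀ i, i < n → (ρ ^ i) u = (σ ^ i) u) → (ρ ^ n) u = u →
      ¬ ρ.SameCycle u v := by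
    intro ρ hρ hρn hs
    obtain ⟨i, hi⟩ := hs.exists_nat_pow_eq
    have hmul : ∀ k, (ρ ^ (n * k)) u = u := by
      intro k
      induction k with
      | zero => simp
      | succ k ih => rw [Nat.mul_succ, pow_add, Equiv.Perm.mul_apply, hρn, ih]
    rw [← Nat.mod_add_div i n, pow_add, Equiv.Perm.mul_apply, hmul,
      hρ _ (Nat.mod_lt _ hn0)] at hi
    rcases Nat.eq_zero_or_pos (i % n) with h0 | h0
    · rw [h0] at hi
      exact huv hi
    · exact (hmin _ h0 (Nat.mod_lt _ hn0)).2 hi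
  rcases hn with hn | hn
  · rw [hn, Equiv.swap_apply_left] at hτn
    exact iff_of_true ⟨n, by exact_mod_cast hτn⟩ (horb σ (fun _ _ => rfl) hn)
  · rw [hn, Equiv.swap_apply_right] at hτn
    exact iff_of_false (horb τ hτpow hτn) (not_not.2 ⟨n, by exact_mod_cast hn⟩)

/-! ### Activities in a matroid -/

/-- The axioms of the closure operator of a matroid on the set `C`. -/
structure IsMatroidClosure {C : Type*} (cl : Set C → Set C) : Prop where
  subset : ∀ H, H ⊆ cl H
  mono : ∀ H H', H ⊆ H' → cl H ⊆ cl H'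
  idem : ∀ H, cl (cl H) ⊆ cl H
  exchange : ∀ H e f, f ∈ cl (insert e H) → f ∉ cl H → e ∈ cl (insert f H)

theorem IsMatroidClosure.le {C : Type*} {cl : Set C → Set C}
    (hcl : IsMatroidClosure cl) {H H' : Set C} (h : H ⊆ cl H') :
    cl H ⊆ cl H' := (hcl.mono _ _ h).trans (hcl.idem _)

theorem IsMatroidClosure.insert_eq {C : Type*} {cl : Set C → Set C}
    (hcl : IsMatroidClosure cl) {H : Set C} {f : C}
    (h : f ∈ cl H) : cl (insert f H) = cl H :=
  (hcl.le (Set.insert_subset h (hcl.subset H))).antisymm (hcl.mono _ _ (Set.subset_insert f H))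

section Activity

variable {C : Type*} [LinearOrder C] (cl : Set C → Set C)

/-- `e` is a loop after the elements of `H` above `e` are contracted. -/
def ExtActive (H : Set C) (e : C) : Prop := e ∈ cl {x ∈ H | e < x}

/-- `e` is a coloop after the elements outside of `H` above `e` are deleted. -/
def IntActive (H : Set C) (e : C) : Prop := e ∉ cl ({x ∈ H | e < x} ∪ {x | x < e})

/-- The basis whose activity interval contains `H`. -/
def baseOf (H : Set C) : Set C := {e | ¬ ExtActive cl H e ∧ (e ∈ H ∨ IntActive cl H e)}

/-- `T` is a basis of the matroid. -/
def IsMatroidBase (T : Set C) : Prop := (∀ e, e ∈ cl T) ∧ ∀ e ∈ T, e ∉ cl (T \ {e})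

variable {cl}

theorem not_extActive_and_intActive (hcl : IsMatroidClosure cl) {H : Set C} {e : C}
    (h : ExtActive cl H e) : ¬ IntActive cl H e :=
  fun h' => h' (hcl.mono _ _ Set.subset_union_left h)

/-- For an element of a basis, internal activity means to be the least element of the fundamental
cut. -/
theorem intActive_iff_of_mem_base (hcl : IsMatroidClosure cl) {T : Set C}
    (hT : IsMatroidBase cl T) {e : C} (he : e ∈ T) :
    IntActive cl T e ↔ ∀ f, f ∉ cl (T \ {e}) → e ≤ f := by
  constructor
  · intro h f hf
    by_contra hfe
    rw [not_le] at hfe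
    refine h (hcl.mono _ _ ?_ (hcl.exchange (T \ {e}) e f ?_ hf))
    · rintro x (rfl | ⟨hx, hxe⟩)
      · exact Or.inr hfe
      · exact (lt_or_gt_of_ne hxe).elim Or.inr fun h => Or.inl ⟨hx, h⟩
    · rw [Set.insert_sdiff_singleton, Set.insert_eq_of_mem he]
      exact hT.1 f
  · intro h h'
    refine hT.2 e he (hcl.le ?_ h')
    rintro x (⟨hx, hex⟩ | hx)
    · exact hcl.subset _ ⟨hx, hex.ne'⟩
    · by_contra hx'
      exact absurd (h x hx') (not_le.2 hx)

theorem not_intActive_of_notMem_base (hcl : IsMatroidClosure cl) {T : Set C}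
    (hT : IsMatroidBase cl T) {e : C} (he : e ∉ T) : ¬ IntActive cl T e := by
  refine fun h => h (hcl.mono _ _ (fun x hx => ?_) (hT.1 e))
  have hxe : x ≠ e := by rintro rfl; exact he hx
  exact (lt_or_gt_of_ne hxe).elim Or.inr fun h => Or.inl ⟨hx, h⟩

theorem not_extActive_of_mem_base (hcl : IsMatroidClosure cl) {T : Set C}
    (hT : IsMatroidBase cl T) {e : C} (he : e ∈ T) : ¬ ExtActive cl T e := by
  have hsub : {x ∈ T | e < x} ⊆ T \ {e} := fun x hx => ⟨hx.1, hx.2.ne'⟩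
  exact fun h => hT.2 e he (hcl.mono _ _ hsub h)

/-- Outside of a basis, external activity means to be the least element of the fundamental circuit.
-/
theorem extActive_iff_of_notMem_base [Finite C] (hcl : IsMatroidClosure cl) {T : Set C}
    (hT : IsMatroidBase cl T) {e : C} (he : e ∉ T) :
    ExtActive cl T e ↔ ∀ f, (f ∈ T ∨ f = e) → f ∈ cl ((T ∪ {e}) \ {f}) → e ≤ f := by
  constructor
  · rintro h f (hf | rfl) hf'
    · by_contra hfe
      rw [not_le] at hfe
      have hsub : {x ∈ T | e < x} ⊆ T \ {f} := fun x hx => ⟨hx.1, by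
        rintro rfl
        exact lt_asymm hfe hx.2⟩
      refine hT.2 f hf (hcl.le ?_ hf')
      rintro x ⟨hx | rfl, hxf⟩
      · exact hcl.subset _ ⟨hx, hxf⟩
      · exact hcl.mono _ _ hsub h
    · exact le_rfl
  · intro h
    obtain ⟨X, hX⟩ := exists_minimal_of_wellFoundedLT
      (fun X : Set C => X ⊆ T ∧ e ∈ cl X) ⟨T, le_rfl, hT.1 e⟩
    suffices hsub : X ⊆ {x ∈ T | e < x} from hcl.mono _ _ hsub hX.prop.2
    refine fun f hf => ⟨hX.prop.1 hf, ?_⟩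
    have hfT := hX.prop.1 hf
    have hef : e ≠ f := by rintro rfl; exact he hfT
    -- As `X` is minimal, `f` lies in the closure of `X` with `f` replaced by `e`.
    have hnot : e ∉ cl (X \ {f}) := fun h' =>
      (hX.2 (y := X \ {f}) ⟨Set.sdiff_subset.trans hX.prop.1, h'⟩ Set.sdiff_subset hf).2 rfl
    refine lt_of_le_of_ne (h f (Or.inl hfT) (hcl.mono _ _ ?_
      (hcl.exchange (X \ {f}) f e ?_ hnot))) hef
    · rintro x (rfl | ⟨hx, hxf⟩)
      · exact ⟨Or.inr rfl, hef⟩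
      · exact ⟨Or.inl (hX.prop.1 hx), hxf⟩
    · rw [Set.insert_sdiff_singleton, Set.insert_eq_of_mem hf]
      exact hX.prop.2

/-- Inserting an active element does not change the activity of any element. -/
theorem active_insert (hcl : IsMatroidClosure cl) {H : Set C} {f : C} (hf : f ∉ H)
    (hact : ExtActive cl H f ∨ IntActive cl H f) (e : C) :
    (ExtActive cl (insert f H) e ↔ ExtActive cl H e) ∧
      (IntActive cl (insert f H) e ↔ IntActive cl H e) := by
  rcases lt_or_ge e f with hef | hfe
  · have hins : {x ∈ insert f H | e < x} = insert f {x ∈ H | e < x} := by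
      ext x
      simp only [Set.mem_insert_iff, Set.mem_ofPred_eq]
      constructor
      · rintro ⟨rfl | h, h'⟩
        · exact Or.inl rfl
        · exact Or.inr ⟨h, h'⟩
      · rintro (rfl | ⟨h, h'⟩)
        · exact ⟨Or.inl rfl, hef⟩
        · exact ⟨Or.inr h, h'⟩
    have hsub : {x ∈ H | f < x} ⊆ {x ∈ H | e < x} := fun x hx => ⟨hx.1, hef.trans hx.2⟩
    unfold ExtActive IntActive
    rw [hins, Set.insert_union]
    rcases hact with hact | hact
    · rw [hcl.insert_eq (hcl.mono _ _ hsub hact),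
        hcl.insert_eq (hcl.mono _ _ (hsub.trans Set.subset_union_left) hact)]
      exact ⟨Iff.rfl, Iff.rfl⟩
    · have hsub' : insert e ({x ∈ H | e < x} ∪ {x | x < e}) ⊆ {x ∈ H | f < x} ∪ {x | x < f} := by
        rintro x (rfl | ⟨hx, hx'⟩ | hx)
        · exact Or.inr hef
        · rcases lt_trichotomy x f with h | rfl | h
          · exact Or.inr h
          · exact (hf hx).elim
          · exact Or.inl ⟨hx, h⟩
        · exact Or.inr (lt_trans hx hef)
      refine ⟨⟨fun h => ?_, fun h => hcl.mono _ _ (Set.subset_insert _ _) h⟩, not_congr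
        ⟨fun h => ?_, fun h => hcl.mono _ _ (Set.subset_insert _ _) h⟩⟩
      · by_contra h'
        exact hact (hcl.mono _ _ ((Set.insert_subset_insert Set.subset_union_left).trans hsub')
          (hcl.exchange _ _ _ h h'))
      · by_contra h'
        exact hact (hcl.mono _ _ hsub' (hcl.exchange _ _ _ h h'))
  · have hins : {x ∈ insert f H | e < x} = {x ∈ H | e < x} := by
      ext x
      simp only [Set.mem_insert_iff, Set.mem_ofPred_eq]
      refine ⟨?_, fun h => ⟨Or.inr h.1, h.2⟩⟩
      rintro ⟨rfl | h, h'⟩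
      · exact absurd h' (not_lt.2 hfe)
      · exact ⟨h, h'⟩
    unfold ExtActive IntActive
    rw [hins]
    exact ⟨Iff.rfl, Iff.rfl⟩

/-- Sets that agree at the inactive elements of one of them have the same activities. -/
theorem active_congr [Finite C] (hcl : IsMatroidClosure cl) {H H' : Set C}
    (h : ∀ f, ¬ ExtActive cl H f → ¬ IntActive cl H f → (f ∈ H ↔ f ∈ H')) (e : C) :
    (ExtActive cl H' e ↔ ExtActive cl H e) ∧ (IntActive cl H' e ↔ IntActive cl H e) := by
  classical
  have := Fintype.ofFinite C
  -- Change the elements of `H` to those of `H'` one at a time.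
  have key : ∀ s : Finset C, ∀ e,
      (ExtActive cl {x | if x ∈ s then x ∈ H' else x ∈ H} e ↔ ExtActive cl H e) ∧
        (IntActive cl {x | if x ∈ s then x ∈ H' else x ∈ H} e ↔ IntActive cl H e) := by
    intro s
    induction s using Finset.induction_on with
    | empty => intro e; simp
    | insert f s hfs ih =>
      set A : Set C := {x | if x ∈ s then x ∈ H' else x ∈ H} with hA
      set B : Set C := {x | if x ∈ insert f s then x ∈ H' else x ∈ H} with hB
      have hAf : f ∈ A ↔ f ∈ H := by simp [hA, hfs]
      have hBf : f ∈ B ↔ f ∈ H' := by simp [hB]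
      have hAB : ∀ x, x ≠ f → (x ∈ B ↔ x ∈ A) := fun x hx => by simp [hA, hB, hx]
      by_cases hact : ExtActive cl H f ∨ IntActive cl H f
      · by_cases hfA : f ∈ A
        · by_cases hfB : f ∈ B
          · have : B = A := by
              ext x
              by_cases hx : x = f
              · simp [hx, hfA, hfB]
              · exact hAB x hx
            rw [this]; exact ih
          · have hAB' : A = insert f B := by
              ext x
              by_cases hx : x = f
              · simp [hx, hfA]
              · simp [hx, hAB x hx]
            intro e
            have h1 : ∀ e, (ExtActive cl A e ↔ ExtActive cl B e) ∧
                (IntActive cl A e ↔ IntActive cl B e) := by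
              rw [hAB']
              refine active_insert hcl hfB ?_
              -- The activity of `f` only depends on the elements above `f`.
              have hgt : {x ∈ B | f < x} = {x ∈ A | f < x} := by
                ext x
                constructor
                · exact fun hx => ⟨(hAB x hx.2.ne').1 hx.1, hx.2⟩
                · exact fun hx => ⟨(hAB x hx.2.ne').2 hx.1, hx.2⟩
              have h2 : ExtActive cl A f ∨ IntActive cl A f := by rwa [(ih f).1, (ih f).2]
              unfold ExtActive IntActive at h2 ⊢
              rwa [hgt]
            rw [← (h1 e).1, ← (h1 e).2]
            exact ih e
        · by_cases hfB : f ∈ B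
          · have hAB' : B = insert f A := by
              ext x
              by_cases hx : x = f
              · simp [hx, hfB]
              · simp [hx, hAB x hx]
            intro e
            have h1 := active_insert hcl hfA (by rwa [(ih f).1, (ih f).2]) e
            rw [hAB', h1.1, h1.2]
            exact ih e
          · have : B = A := by
              ext x
              by_cases hx : x = f
              · simp [hx, hfA, hfB]
              · exact hAB x hx
            rw [this]; exact ih
      · have hff := h f (fun h => hact (Or.inl h)) (fun h => hact (Or.inr h))
        have : B = A := by
          ext x
          by_cases hx : x = f
          · rw [hx, hAf, hBf, hff]
          · exact hAB x hx
        rw [this]; exact ih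
  have h1 := key Finset.univ e
  simpa using h1

theorem baseOf_congr [Finite C] (hcl : IsMatroidClosure cl) {H H' : Set C}
    (h : ∀ f, ¬ ExtActive cl H f → ¬ IntActive cl H f → (f ∈ H ↔ f ∈ H')) :
    baseOf cl H' = baseOf cl H := by
  ext e
  have h1 := active_congr hcl h e
  simp only [baseOf, Set.mem_ofPred_eq, h1.1, h1.2]
  by_cases hE : ExtActive cl H e
  · simp [hE]
  · by_cases hI : IntActive cl H e
    · simp [hI]
    · simp [hE, hI, h e hE hI]

theorem baseOf_base (hcl : IsMatroidClosure cl) {T : Set C} (hT : IsMatroidBase cl T) :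
    baseOf cl T = T := by
  ext e
  by_cases he : e ∈ T
  · simp [baseOf, he, not_extActive_of_mem_base hcl hT he]
  · simp [baseOf, he, not_intActive_of_notMem_base hcl hT he]

theorem mem_baseOf_iff {H : Set C} {e : C} (hE : ¬ ExtActive cl H e) (hI : ¬ IntActive cl H e) :
    e ∈ H ↔ e ∈ baseOf cl H := by
  simp [baseOf, hE, hI]

/-- Crapo's interval theorem, existence: every set lies in the activity interval of a basis. -/
theorem isMatroidBase_baseOf [Finite C] (hcl : IsMatroidClosure cl) (H : Set C) :
    IsMatroidBase cl (baseOf cl H) := by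
  set T := baseOf cl H with hT
  have hact := active_congr hcl (H := H) (H' := T) fun f => mem_baseOf_iff
  refine ⟨fun e => ?_, fun e he hecl => ?_⟩
  · induction e using WellFoundedLT.induction with
    | ind e ih =>
      by_cases he : e ∈ T
      · exact hcl.subset _ he
      · have h1 : ¬ IntActive cl T e := by
          rw [(hact e).2]
          intro hI
          exact he ⟨fun hE => not_extActive_and_intActive hcl hE hI, Or.inr hI⟩
        refine hcl.le ?_ (not_not.1 h1)
        rintro x (hx | hx)
        · exact hcl.subset _ hx.1
        · exact ih x hx
  · have hE : ∀ g ∈ T, g ∉ cl {x ∈ T | g < x} := fun g hg h => hg.1 ((hact g).1.1 h)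
    -- In a minimal circuit through `e` the least element would be externally active.
    obtain ⟨X, hX⟩ := exists_minimal_of_wellFoundedLT
      (fun X : Set C => X ⊆ T \ {e} ∧ e ∈ cl X) ⟨_, le_rfl, hecl⟩
    obtain ⟨g, hg⟩ := exists_minimal_of_wellFoundedLT (fun g => g ∈ insert e X) ⟨e, Or.inl rfl⟩
    have hle : ∀ x ∈ insert e X, g ≤ x := fun x hx =>
      (le_total g x).elim id fun h => hg.le_of_le hx h
    rcases hg.prop with rfl | hgX
    · have hsub : X ⊆ {x ∈ T | g < x} := fun x hx => ⟨(hX.prop.1 hx).1, lt_of_le_of_ne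
        (hle x (Or.inr hx)) (Ne.symm (hX.prop.1 hx).2)⟩
      exact hE g he (hcl.mono _ _ hsub hX.prop.2)
    · have hge := hX.prop.1 hgX
      have hnot : e ∉ cl (X \ {g}) := fun h' =>
        (hX.2 (y := X \ {g}) ⟨Set.sdiff_subset.trans hX.prop.1, h'⟩ Set.sdiff_subset hgX).2 rfl
      refine hE g hge.1 (hcl.mono _ _ ?_ (hcl.exchange (X \ {g}) g e ?_ hnot))
      · rintro x (rfl | ⟨hx, hxg⟩)
        · exact ⟨he, lt_of_le_of_ne (hle _ (Or.inl rfl)) hge.2⟩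
        · exact ⟨(hX.prop.1 hx).1, lt_of_le_of_ne (hle x (Or.inr hx)) (Ne.symm hxg)⟩
      · rw [Set.insert_sdiff_singleton, Set.insert_eq_of_mem hgX]
        exact hX.prop.2

/-- Crapo's interval theorem, uniqueness: the basis is determined by each set in its activity
interval. -/
theorem baseOf_eq_of_agree [Finite C] (hcl : IsMatroidClosure cl) {T H : Set C}
    (hT : IsMatroidBase cl T)
    (h : ∀ f, ¬ ExtActive cl T f → ¬ IntActive cl T f → (f ∈ T ↔ f ∈ H)) :
    baseOf cl H = T := (baseOf_congr hcl h).trans (baseOf_base hcl hT)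

end Activity

/-- Connectivity of the ends of an edge is the closure operator of the cycle matroid. -/
theorem isMatroidClosure_edgeConn {C X : Type*} (a b : C → X) :
    IsMatroidClosure fun H : Set C => {e | EdgeConn a b H (a e) (b e)} where
  subset _ _ he := edgeConn_ends he
  mono _ _ h _ he := he.mono h
  idem H e he := he.of_equivalence (edgeConn_equivalence a b H) fun _ hf => hf
  exchange H e f hf hf' := by
    have hm : ∀ {x y}, EdgeConn a b H x y → EdgeConn a b (insert f H) x y :=
      fun h => h.mono (Set.subset_insert f H)
    have hff : EdgeConn a b (insert f H) (a f) (b f) := edgeConn_ends (Set.mem_insert f H)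
    rcases (edgeConn_insert e _ _).1 hf with h | ⟨h1, h2⟩ | ⟨h1, h2⟩
    · exact (hf' h).elim
    · exact ((hm h1).symm.trans _ _ _ hff).trans _ _ _ (hm h2).symm
    · exact ((hm h2).trans _ _ _ hff.symm).trans _ _ _ (hm h1)

namespace ConnectedLinkDiagram.Checkerboard

variable {Arc C : Type*} {D : ConnectedLinkDiagram Arc C} (χ : D.Checkerboard)

/-! ### The circles of a state as the cycles of a permutation -/

theorem black_corner (c : C) (k : Fin 4) :
    χ.black (D.corner c k) = decide (k = χ.blackCorner c ∨ k = χ.blackCorner c + 2) := by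
  have h0 := χ.black_succ c 0
  have h1 := χ.black_succ c 1
  have h2 := χ.black_succ c 2
  simp only [Fin.isValue, zero_add] at h0
  rw [show (1 : Fin 4) + 1 = 2 from rfl] at h1
  rw [show (2 : Fin 4) + 1 = 3 from rfl] at h2
  unfold blackCorner positive
  cases h : χ.black (D.corner c 1) <;> fin_cases k <;> simp_all

/-- If every arc is oriented with the black region on its left, two arcs leave each crossing: the
first ends of the two black corners. -/
def startArc (p : C × Bool) : Arc :=
  D.arc p.1 (if p.2 then χ.blackCorner p.1 + 2 else χ.blackCorner p.1)

/-- If every arc is oriented with the black region on its left, two arcs arrive at each crossing: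
the second ends of the two black corners. -/
def endArc (p : C × Bool) : Arc :=
  D.arc p.1 (if p.2 then χ.blackCorner p.1 + 3 else χ.blackCorner p.1 + 1)

theorem end_eq_of_black_eq {c c' : C} {k k' : Fin 4} (h : D.arc c k = D.arc c' k')
    (hb : χ.black (D.corner c k) = χ.black (D.corner c' k')) : c = c' ∧ k = k' := by
  have hout : D.out c k = D.out c' k' := by
    by_contra hne
    unfold corner at hb
    rw [h] at hb
    have hne' := χ.black_ne (D.arc c' k')
    cases h1 : D.out c k <;> cases h2 : D.out c' k' <;> simp_all
  rcases D.arc_ends (D.arc c' k') with hfree | ⟨⟨p, -, hp⟩, ⟨q, -, hq⟩⟩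
  · exact (hfree c' k' rfl).elim
  · cases h2 : D.out c' k'
    · have h3 := (hq (c, k) ⟨h, hout.trans h2⟩).trans (hq (c', k') ⟨rfl, h2⟩).symm
      exact Prod.mk.inj h3
    · have h3 := (hp (c, k) ⟨h, hout.trans h2⟩).trans (hp (c', k') ⟨rfl, h2⟩).symm
      exact Prod.mk.inj h3

theorem exists_end_black_ne (c : C) (k : Fin 4) :
    ∃ c' k', D.arc c' k' = D.arc c k ∧ χ.black (D.corner c' k') ≠ χ.black (D.corner c k) := by
  rcases D.arc_ends (D.arc c k) with hfree | ⟨⟨p, hp, -⟩, ⟨q, hq, -⟩⟩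
  · exact (hfree c k rfl).elim
  · have hne := χ.black_ne (D.arc c k)
    cases h : D.out c k
    · refine ⟨p.1, p.2, hp.1, ?_⟩
      unfold corner
      rw [hp.1, hp.2, h]
      exact hne
    · refine ⟨q.1, q.2, hq.1, ?_⟩
      unfold corner
      rw [hq.1, hq.2, h]
      exact hne.symm

theorem startArc_injective : Function.Injective χ.startArc := by
  rintro ⟨c, i⟩ ⟨c', i'⟩ h
  obtain ⟨rfl, h2⟩ := χ.end_eq_of_black_eq h (by
    rw [black_corner, black_corner]; cases i <;> cases i' <;> simp)
  cases i <;> cases i' <;> simp_all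

theorem endArc_injective : Function.Injective χ.endArc := by
  have h4 : ∀ k : Fin 4, k + 3 ≠ k ∧ k + 1 ≠ k ∧ k + 3 ≠ k + 2 ∧ k + 1 ≠ k + 2 ∧ k + 3 ≠ k + 1 := by
    decide
  rintro ⟨c, i⟩ ⟨c', i'⟩ h
  obtain ⟨rfl, h2⟩ := χ.end_eq_of_black_eq h (by
    rw [black_corner, black_corner]
    cases i <;> cases i' <;> simp [h4])
  have := h4 (χ.blackCorner c)
  cases i <;> cases i' <;> simp_all

theorem mem_range_startArc_iff (a : Arc) :
    a ∈ Set.range χ.startArc ↔ ∃ c k, D.arc c k = a ∧ χ.black (D.corner c k) = true := by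
  constructor
  · rintro ⟨⟨c, i⟩, rfl⟩
    exact ⟨c, _, rfl, by rw [black_corner]; cases i <;> simp⟩
  · rintro ⟨c, k, rfl, h⟩
    rw [black_corner] at h
    rcases of_decide_eq_true h with h | h
    · exact ⟨(c, false), by simp [startArc, h]⟩
    · exact ⟨(c, true), by simp [startArc, h]⟩

theorem mem_range_endArc_iff (a : Arc) :
    a ∈ Set.range χ.endArc ↔ ∃ c k, D.arc c k = a ∧ χ.black (D.corner c k) = false := by
  have h4 : ∀ k l : Fin 4, l = k ∨ l = k + 1 ∨ l = k + 2 ∨ l = k + 3 := by decide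
  constructor
  · rintro ⟨⟨c, i⟩, rfl⟩
    exact ⟨c, _, rfl, by rw [black_corner]; cases i <;> simp⟩
  · rintro ⟨c, k, rfl, h⟩
    rw [black_corner] at h
    have h := of_decide_eq_false h
    rcases h4 (χ.blackCorner c) k with h' | h' | h' | h'
    · exact (h (Or.inl h')).elim
    · exact ⟨(c, false), by simp [endArc, h']⟩
    · exact (h (Or.inr h')).elim
    · exact ⟨(c, true), by simp [endArc, h']⟩

theorem range_startArc : Set.range χ.startArc = Set.range χ.endArc := by
  ext a
  rw [mem_range_startArc_iff, mem_range_endArc_iff]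
  constructor
  · rintro ⟨c, k, rfl, h⟩
    obtain ⟨c', k', h1, h2⟩ := χ.exists_end_black_ne c k
    exact ⟨c', k', h1, by rw [h] at h2; simpa using h2⟩
  · rintro ⟨c, k, rfl, h⟩
    obtain ⟨c', k', h1, h2⟩ := χ.exists_end_black_ne c k
    exact ⟨c', k', h1, by rw [h] at h2; simpa using h2⟩

open Classical in
/-- The arc that follows `endArc p` on a circle of the state `H`. -/
noncomputable def successor (H : Finset C) (p : C × Bool) : Arc :=
  χ.startArc (p.1, p.2 ^^ decide (p.1 ∈ H))

theorem joined_iff (H : Finset C) (a b : Arc) :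
    (χ.Joined H a b ∨ χ.Joined H b a) ↔
      ∃ p, (a = χ.endArc p ∧ b = χ.successor H p) ∨ (b = χ.endArc p ∧ a = χ.successor H p) := by
  have key : ∀ c, ((match χ.res H c with
      | .A => (a = D.arc c 0 ∧ b = D.arc c 1) ∨ (a = D.arc c 2 ∧ b = D.arc c 3)
      | .B => (a = D.arc c 1 ∧ b = D.arc c 2) ∨ (a = D.arc c 3 ∧ b = D.arc c 0)) ∨
      (match χ.res H c with
      | .A => (b = D.arc c 0 ∧ a = D.arc c 1) ∨ (b = D.arc c 2 ∧ a = D.arc c 3)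
      | .B => (b = D.arc c 1 ∧ a = D.arc c 2) ∨ (b = D.arc c 3 ∧ a = D.arc c 0))) ↔
      ∃ i, (a = χ.endArc (c, i) ∧ b = χ.successor H (c, i)) ∨
        (b = χ.endArc (c, i) ∧ a = χ.successor H (c, i)) := by
    intro c
    rw [Bool.exists_bool]
    unfold successor endArc startArc blackCorner res
    have e1 : (1 : Fin 4) + 3 = 0 := rfl
    have e2 : (1 : Fin 4) + 2 = 3 := rfl
    have e3 : (1 : Fin 4) + 1 = 2 := rfl
    by_cases hc : c ∈ H <;> cases hp : χ.positive c <;> simp [hc, e1, e2, e3] <;> tauto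
  unfold Joined
  rw [← exists_or, Prod.exists]
  exact exists_congr key

theorem face_eq_iff (H : Finset C) (a b : Arc) :
    χ.face H a = χ.face H b ↔ Relation.EqvGen (χ.Joined H) a b := Quot.eq

theorem face_equivalence (H : Finset C) : Equivalence fun a b => χ.face H a = χ.face H b :=
  ⟨fun _ => rfl, fun h => h.symm, fun h h' => h.trans h'⟩

theorem face_eq_of_equivalence {H : Finset C} {s : Arc → Arc → Prop} (hs : Equivalence s)
    (h : ∀ p, s (χ.endArc p) (χ.successor H p)) {a b : Arc} (hab : χ.face H a = χ.face H b) :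
    s a b := by
  refine Relation.EqvGen.le_of_equivalence hs (fun x y hxy => ?_) ((χ.face_eq_iff H a b).1 hab)
  obtain ⟨p, ⟨rfl, rfl⟩ | ⟨rfl, rfl⟩⟩ := (χ.joined_iff H x y).1 (Or.inl hxy)
  · exact h p
  · exact hs.symm (h p)

theorem face_endArc (H : Finset C) (p : C × Bool) :
    χ.face H (χ.endArc p) = χ.face H (χ.successor H p) := by
  rcases (χ.joined_iff H _ _).2 ⟨p, Or.inl ⟨rfl, rfl⟩⟩ with h | h
  · exact Quot.sound h
  · exact (Quot.sound h).symm

theorem successor_injective (H : Finset C) : Function.Injective (χ.successor H) := by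
  rintro ⟨c, i⟩ ⟨c', i'⟩ h
  have h1 := χ.startArc_injective h
  simp only [Prod.mk.injEq] at h1
  obtain ⟨rfl, h2⟩ := h1
  simpa using h2

open Classical in
/-- The successor on the circles of the state `H`, for all arcs. -/
noncomputable def successorFun (H : Finset C) (a : Arc) : Arc :=
  if h : ∃ p, χ.endArc p = a then χ.successor H h.choose else a

theorem successorFun_endArc (H : Finset C) (p : C × Bool) :
    χ.successorFun H (χ.endArc p) = χ.successor H p := by
  have h : ∃ q, χ.endArc q = χ.endArc p := ⟨p, rfl⟩
  rw [successorFun, dif_pos h, χ.endArc_injective h.choose_spec]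

theorem successorFun_of_notMem (H : Finset C) {a : Arc} (ha : a ∉ Set.range χ.endArc) :
    χ.successorFun H a = a := dif_neg ha

theorem successor_mem_range (H : Finset C) (p : C × Bool) :
    χ.successor H p ∈ Set.range χ.endArc := χ.range_startArc ▸ ⟨_, rfl⟩

theorem successorFun_injective (H : Finset C) : Function.Injective (χ.successorFun H) := by
  intro a b h
  by_cases ha : a ∈ Set.range χ.endArc <;> by_cases hb : b ∈ Set.range χ.endArc
  · obtain ⟨p, rfl⟩ := ha
    obtain ⟨q, rfl⟩ := hb
    rw [successorFun_endArc, successorFun_endArc] at h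
    rw [χ.successor_injective H h]
  · obtain ⟨p, rfl⟩ := ha
    rw [successorFun_endArc, χ.successorFun_of_notMem H hb] at h
    exact (hb (h ▸ χ.successor_mem_range H p)).elim
  · obtain ⟨p, rfl⟩ := hb
    rw [successorFun_endArc, χ.successorFun_of_notMem H ha] at h
    exact (ha (h ▸ χ.successor_mem_range H p)).elim
  · rwa [χ.successorFun_of_notMem H ha, χ.successorFun_of_notMem H hb] at h

/-- The state `H'` arises from `H` by changing the smoothing of the crossing `e`. -/
def IsToggle (H H' : Finset C) (e : C) : Prop :=
  (∀ c, c ≠ e → (c ∈ H' ↔ c ∈ H)) ∧ (e ∈ H' ↔ e ∉ H)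

variable {χ} in
theorem IsToggle.symm {H H' : Finset C} {e : C} (h : IsToggle H H' e) : IsToggle H' H e :=
  ⟨fun c hc => (h.1 c hc).symm, by rw [h.2, not_not]⟩

section Finite

variable [Finite Arc]

/-- The permutation of the arcs whose cycles are the circles of the state `H`. -/
noncomputable def statePerm (H : Finset C) : Equiv.Perm Arc :=
  Equiv.ofBijective (χ.successorFun H)
    (Finite.injective_iff_bijective.1 (χ.successorFun_injective H))

theorem statePerm_endArc (H : Finset C) (p : C × Bool) :
    χ.statePerm H (χ.endArc p) = χ.successor H p := χ.successorFun_endArc H p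

theorem statePerm_of_notMem (H : Finset C) {a : Arc} (ha : a ∉ Set.range χ.endArc) :
    χ.statePerm H a = a := χ.successorFun_of_notMem H ha

theorem sameCycle_statePerm_iff (H : Finset C) (a b : Arc) :
    (χ.statePerm H).SameCycle a b ↔ χ.face H a = χ.face H b := by
  constructor
  · intro h
    obtain ⟨n, rfl⟩ := h.exists_nat_pow_eq
    have h1 : ∀ a, χ.face H (χ.statePerm H a) = χ.face H a := by
      intro a
      by_cases ha : a ∈ Set.range χ.endArc
      · obtain ⟨p, rfl⟩ := ha
        rw [statePerm_endArc, χ.face_endArc]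
      · rw [χ.statePerm_of_notMem H ha]
    clear h
    induction n with
    | zero => rfl
    | succ n ih => rw [pow_succ', Equiv.Perm.mul_apply, h1, ih]
  · refine χ.face_eq_of_equivalence (s := (χ.statePerm H).SameCycle)
      ⟨Equiv.Perm.SameCycle.refl _, fun h => h.symm, fun h h' => h.trans h'⟩ fun p => ?_
    rw [← statePerm_endArc]
    exact (Equiv.Perm.SameCycle.refl _ _).apply_right

theorem statePerm_toggle [DecidableEq Arc] {H H' : Finset C} {e : C} (h : IsToggle H H' e) :
    χ.statePerm H' = Equiv.swap (χ.startArc (e, false)) (χ.startArc (e, true)) * χ.statePerm H := by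
  ext a
  rw [Equiv.Perm.mul_apply]
  by_cases ha : a ∈ Set.range χ.endArc
  · obtain ⟨⟨c, i⟩, rfl⟩ := ha
    rw [statePerm_endArc, statePerm_endArc]
    unfold successor
    by_cases hc : c = e
    · subst hc
      have h2 := h.2
      by_cases hcH : c ∈ H <;> cases i <;> simp_all
    · rw [Equiv.swap_apply_of_ne_of_ne]
      · rw [decide_eq_decide.2 (h.1 c hc)]
      · exact fun h' => hc (Prod.mk.inj (χ.startArc_injective h')).1
      · exact fun h' => hc (Prod.mk.inj (χ.startArc_injective h')).1
  · rw [χ.statePerm_of_notMem H ha, χ.statePerm_of_notMem H' ha, Equiv.swap_apply_of_ne_of_ne]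
    · rintro rfl
      exact ha (χ.range_startArc ▸ ⟨_, rfl⟩)
    · rintro rfl
      exact ha (χ.range_startArc ▸ ⟨_, rfl⟩)

end Finite

theorem arc_eq_or (c : C) (k : Fin 4) : ∃ i, D.arc c k = χ.startArc (c, i) ∨
    D.arc c k = χ.endArc (c, i) := by
  have h4 : ∀ k l : Fin 4, l = k ∨ l = k + 1 ∨ l = k + 2 ∨ l = k + 3 := by decide
  rcases h4 (χ.blackCorner c) k with h | h | h | h <;> rw [h]
  · exact ⟨false, Or.inl rfl⟩
  · exact ⟨false, Or.inr rfl⟩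
  · exact ⟨true, Or.inl rfl⟩
  · exact ⟨true, Or.inr rfl⟩

/-- The ends `0` and `2` of a crossing lie on the two strands of any smoothing, as do the
two starting ends. -/
theorem face_startArc (H : Finset C) (c : C) :
    (χ.face H (χ.startArc (c, false)) = χ.face₁ H c ∧
        χ.face H (χ.startArc (c, true)) = χ.face₂ H c) ∨
      (χ.face H (χ.startArc (c, false)) = χ.face₂ H c ∧
        χ.face H (χ.startArc (c, true)) = χ.face₁ H c) := by
  have e2 : (1 : Fin 4) + 2 = 3 := rfl
  have h0 := χ.face_endArc H (c, false)
  have h1 := χ.face_endArc H (c, true)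
  cases hp : χ.positive c
  · exact Or.inl ⟨by simp [startArc, face₁, blackCorner, hp],
      by simp [startArc, face₂, blackCorner, hp]⟩
  · have e3 : (1 : Fin 4) + 3 = 0 := rfl
    have e1 : (1 : Fin 4) + 1 = 2 := rfl
    have h2 : χ.face₁ H c = χ.face H (χ.endArc (c, true)) := by
      simp [endArc, face₁, blackCorner, hp, e3]
    have h3 : χ.face₂ H c = χ.face H (χ.endArc (c, false)) := by
      simp [endArc, face₂, blackCorner, hp, e1]
    rw [h2, h3, h0, h1]
    unfold successor
    by_cases hc : c ∈ H <;> simp [hc]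

/-- Each arc at a crossing lies on one of the two circles that meet there. -/
theorem face_arc (H : Finset C) (c : C) (k : Fin 4) :
    χ.face H (D.arc c k) = χ.face₁ H c ∨ χ.face H (D.arc c k) = χ.face₂ H c := by
  have hs : ∀ i, χ.face H (χ.startArc (c, i)) = χ.face₁ H c ∨
      χ.face H (χ.startArc (c, i)) = χ.face₂ H c := by
    rcases χ.face_startArc H c with ⟨h1, h2⟩ | ⟨h1, h2⟩ <;> rintro (_ | _) <;> simp [h1, h2]
  obtain ⟨i, h | h⟩ := χ.arc_eq_or c k
  · rw [h]; exact hs i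
  · rw [h, χ.face_endArc]; exact hs _

theorem face_startArc_eq_iff (H : Finset C) (c : C) :
    χ.face H (χ.startArc (c, false)) = χ.face H (χ.startArc (c, true)) ↔
      χ.face₁ H c = χ.face₂ H c := by
  rcases χ.face_startArc H c with ⟨h1, h2⟩ | ⟨h1, h2⟩ <;> rw [h1, h2]
  exact eq_comm

/-- Changing one smoothing merges the two circles that meet at the crossing, or
splits the one circle that meets itself there. -/
theorem face₁_eq_face₂_toggle [Finite Arc] {H H' : Finset C} {e : C} (h : IsToggle H H' e) :
    χ.face₁ H' e = χ.face₂ H' e ↔ χ.face₁ H e ≠ χ.face₂ H e := by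
  classical
  have hne : χ.startArc (e, false) ≠ χ.startArc (e, true) := fun h => by
    simpa using χ.startArc_injective h
  rw [Ne, ← face_startArc_eq_iff, ← face_startArc_eq_iff, ← sameCycle_statePerm_iff,
    ← sameCycle_statePerm_iff, χ.statePerm_toggle h]
  exact sameCycle_swap_mul _ hne

theorem successor_toggle {H H' : Finset C} {e : C} (h : IsToggle H H' e) {p : C × Bool}
    (hp : p.1 ≠ e) : χ.successor H' p = χ.successor H p := by
  unfold successor
  rw [decide_eq_decide.2 (h.1 p.1 hp)]

/-- If two different circles meet at the crossing `e`, changing the smoothing of `e` joins them. -/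
theorem isJoin_face [Finite Arc] {H H' : Finset C} {e : C} (h : IsToggle H H' e)
    (hne : χ.face₁ H e ≠ χ.face₂ H e) :
    IsJoin (fun a b => χ.face H a = χ.face H b) (fun a b => χ.face H' a = χ.face H' b)
      (D.arc e 0) (D.arc e 2) := by
  have heq := (χ.face₁_eq_face₂_toggle h).2 hne
  have hends : ∀ p : C × Bool, p.1 = e → ∃ (k : Fin 4) (l : Finset C → Fin 4),
      χ.endArc p = D.arc e k ∧ ∀ H, χ.successor H p = D.arc e (l H) := by
    rintro ⟨c, i⟩ rfl
    exact ⟨_, _, rfl, fun H => rfl⟩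
  have hall : ∀ k, χ.face H' (D.arc e k) = χ.face₁ H' e := fun k =>
    (χ.face_arc H' e k).elim id fun h => h.trans heq.symm
  have hle : ∀ {a b}, χ.face H a = χ.face H b → χ.face H' a = χ.face H' b := by
    refine χ.face_eq_of_equivalence (χ.face_equivalence H') fun p => ?_
    by_cases hp : p.1 = e
    · obtain ⟨k, l, h1, h2⟩ := hends p hp
      rw [h1, h2, hall, hall]
    · rw [← χ.successor_toggle h hp]
      exact χ.face_endArc H' p
  intro a b
  constructor
  · refine χ.face_eq_of_equivalence ((χ.face_equivalence H).join _ _) fun p => ?_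
    by_cases hp : p.1 = e
    · obtain ⟨k, l, h1, h2⟩ := hends p hp
      rw [h1, h2]
      change _ ∨ (_ = χ.face₁ H e ∧ χ.face₂ H e = _) ∨ (_ = χ.face₂ H e ∧ χ.face₁ H e = _)
      rcases χ.face_arc H e k with h3 | h3 <;> rcases χ.face_arc H e (l H') with h4 | h4 <;>
        simp [h3, h4]
    · rw [χ.successor_toggle h hp]
      exact Or.inl (χ.face_endArc H p)
  · rintro (h1 | ⟨h1, h2⟩ | ⟨h1, h2⟩)
    · exact hle h1
    · exact (hle h1).trans (heq.trans (hle h2))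
    · exact (hle h1).trans (heq.symm.trans (hle h2))

end ConnectedLinkDiagram.Checkerboard

namespace ConnectedLinkDiagram.Checkerboard

variable {Arc C : Type*} {D : ConnectedLinkDiagram Arc C} (χ : D.Checkerboard)

/-! ### Planarity: circles of a state and components of a subgraph -/

/-- One end of the edge `c` of the Tait graph. -/
def end₁ (c : C) : D.Region := D.corner c (χ.blackCorner c)

/-- The other end of the edge `c` of the Tait graph. -/
def end₂ (c : C) : D.Region := D.corner c (χ.blackCorner c + 2)

theorem reachable_eq (H : Set C) : χ.Reachable H = EdgeConn χ.end₁ χ.end₂ H := rfl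

theorem endsReachable_iff (H : Set C) (e : C) :
    χ.EndsReachable H e ↔ EdgeConn χ.end₁ χ.end₂ H (χ.end₁ e) (χ.end₂ e) := by
  constructor
  · exact fun h => h _ _ (Or.inl ⟨rfl, rfl⟩)
  · rintro h r s (⟨rfl, rfl⟩ | ⟨rfl, rfl⟩)
    · exact h
    · exact h.symm

/-- The closure operator of the cycle matroid of the Tait graph. -/
theorem isMatroidClosure_endsReachable :
    IsMatroidClosure fun H : Set C => {e | χ.EndsReachable H e} := by
  simp only [endsReachable_iff]
  exact isMatroidClosure_edgeConn χ.end₁ χ.end₂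

/-- The region of the colour `β` at the arc `a`. -/
def sideRegion (β : Bool) (a : Arc) : D.Region :=
  D.region a (χ.black (D.region a true) == β)

theorem black_sideRegion (β : Bool) (a : Arc) : χ.black (χ.sideRegion β a) = β := by
  have h := χ.black_ne a
  unfold sideRegion
  cases h1 : χ.black (D.region a true) <;> cases h2 : χ.black (D.region a false) <;>
    cases β <;> simp_all

theorem sideRegion_eq {β : Bool} {a : Arc} {side : Bool} (h : χ.black (D.region a side) = β) :
    χ.sideRegion β a = D.region a side := by
  have h' := χ.black_ne a
  unfold sideRegion
  cases h1 : χ.black (D.region a true) <;> cases h2 : χ.black (D.region a false) <;>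
    cases β <;> cases side <;> simp_all

theorem sideRegion_arc {β : Bool} {c : C} {k : Fin 4} (h : χ.black (D.corner c k) = β) :
    χ.sideRegion β (D.arc c k) = D.corner c k ∧ χ.sideRegion β (D.arc c (k + 1)) = D.corner c k :=
  ⟨χ.sideRegion_eq h, by rw [D.corner_eq] at h ⊢; exact χ.sideRegion_eq h⟩

theorem sideRegion_startArc (p : C × Bool) :
    χ.sideRegion true (χ.startArc p) = if p.2 then χ.end₂ p.1 else χ.end₁ p.1 := by
  rcases p with ⟨c, _ | _⟩
  · exact (χ.sideRegion_arc (χ.black_blackCorner c).1).1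
  · exact (χ.sideRegion_arc (χ.black_blackCorner c).2).1

theorem sideRegion_endArc (p : C × Bool) :
    χ.sideRegion true (χ.endArc p) = if p.2 then χ.end₂ p.1 else χ.end₁ p.1 := by
  rcases p with ⟨c, _ | _⟩
  · exact (χ.sideRegion_arc (χ.black_blackCorner c).1).2
  · have h := (χ.sideRegion_arc (χ.black_blackCorner c).2).2
    rw [add_assoc] at h
    exact h

/-- The arcs whose black regions lie in the same component of the spanning subgraph `H`. -/
def SameComponent (H : Set C) (a b : Arc) : Prop :=
  χ.Reachable H (χ.sideRegion true a) (χ.sideRegion true b)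

theorem sameComponent_equivalence (H : Set C) : Equivalence (χ.SameComponent H) :=
  ⟨fun _ => .refl _, fun h => h.symm, fun h h' => h.trans _ _ _ h'⟩

/-- A circle of the state `H` runs along one component of `H`. -/
theorem sameComponent_of_face_eq {H : Finset C} {a b : Arc} (h : χ.face H a = χ.face H b) :
    χ.SameComponent (H : Set C) a b := by
  refine χ.face_eq_of_equivalence (χ.sameComponent_equivalence _) (fun p => ?_) h
  unfold SameComponent successor
  rw [sideRegion_endArc, sideRegion_startArc, reachable_eq]
  by_cases hp : p.1 ∈ H
  · rcases p with ⟨c, _ | _⟩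
    · simpa [hp] using edgeConn_ends (a := χ.end₁) (b := χ.end₂) (Finset.mem_coe.2 hp)
    · simpa [hp] using (edgeConn_equivalence χ.end₁ χ.end₂ H).symm
        (edgeConn_ends (Finset.mem_coe.2 hp))
  · simpa [hp] using (edgeConn_equivalence χ.end₁ χ.end₂ H).refl _

theorem isJoin_sameComponent (H : Set C) (e : C) :
    IsJoin (χ.SameComponent H) (χ.SameComponent (insert e H))
      (χ.startArc (e, false)) (χ.startArc (e, true)) := by
  intro a b
  have h := edgeConn_insert (a := χ.end₁) (b := χ.end₂) (H := H) e
    (χ.sideRegion true a) (χ.sideRegion true b)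
  unfold SameComponent
  rw [sideRegion_startArc, sideRegion_startArc]
  exact h

/-- The state whose circles bound the regions of the colour `β`. -/
def colourState [Fintype C] (β : Bool) : Finset C := if β then ∅ else Finset.univ

theorem exists_corner_of_successor [Fintype C] (β : Bool) (p : C × Bool) :
    ∃ k, χ.black (D.corner p.1 k) = β ∧
      ((χ.endArc p = D.arc p.1 (k + 1) ∧ χ.successor (colourState β) p = D.arc p.1 k) ∨
        (χ.endArc p = D.arc p.1 k ∧ χ.successor (colourState β) p = D.arc p.1 (k + 1))) := by
  have h4 : ∀ k : Fin 4, k + 1 + 1 = k + 2 ∧ k + 2 + 1 = k + 3 ∧ k + 3 + 1 = k ∧ k + 1 ≠ k ∧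
      k + 1 ≠ k + 2 ∧ k + 3 ≠ k ∧ k + 3 ≠ k + 2 := by decide
  obtain ⟨c, i⟩ := p
  have := h4 (χ.blackCorner c)
  unfold successor colourState startArc endArc
  simp only [black_corner]
  cases β <;> cases i
  · exact ⟨χ.blackCorner c + 1, by simp [this]⟩
  · exact ⟨χ.blackCorner c + 3, by simp [this]⟩
  · exact ⟨χ.blackCorner c, by simp⟩
  · exact ⟨χ.blackCorner c + 2, by simp [this]⟩

theorem face_arc_succ [Fintype C] {β : Bool} {c : C} {k : Fin 4} (h : χ.black (D.corner c k) = β) :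
    χ.face (colourState β) (D.arc c k) = χ.face (colourState β) (D.arc c (k + 1)) := by
  have h4 : ∀ k l : Fin 4, l = k ∨ l = k + 1 ∨ l = k + 2 ∨ l = k + 3 := by decide
  have h5 : ∀ k : Fin 4, k + 1 + 1 = k + 2 ∧ k + 2 + 1 = k + 3 ∧ k + 3 + 1 = k ∧ k + 1 ≠ k ∧
      k + 1 ≠ k + 2 ∧ k + 3 ≠ k ∧ k + 3 ≠ k + 2 := by decide
  have h6 := h5 (χ.blackCorner c)
  have h0 := χ.face_endArc (colourState β) (c, false)
  have h1 := χ.face_endArc (colourState β) (c, true)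
  unfold successor colourState startArc endArc at h0 h1
  unfold colourState
  rw [black_corner] at h
  rcases h4 (χ.blackCorner c) k with rfl | rfl | rfl | rfl <;> cases β <;> simp_all

theorem face_colourState_eq_iff [Fintype C] (β : Bool) (a b : Arc) :
    χ.face (colourState β) a = χ.face (colourState β) b ↔
      χ.sideRegion β a = χ.sideRegion β b := by
  constructor
  · refine χ.face_eq_of_equivalence (s := fun a b => χ.sideRegion β a = χ.sideRegion β b)
      ⟨fun _ => rfl, fun h => h.symm, fun h h' => h.trans h'⟩ fun p => ?_
    obtain ⟨k, hk, ⟨h1, h2⟩ | ⟨h1, h2⟩⟩ := χ.exists_corner_of_successor β p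
    · rw [h1, h2, (χ.sideRegion_arc hk).1, (χ.sideRegion_arc hk).2]
    · rw [h1, h2, (χ.sideRegion_arc hk).1, (χ.sideRegion_arc hk).2]
  · -- The circle around a region of colour `β` is well defined.
    let Φ : D.Region → Option (χ.Face (colourState β)) := Quot.lift
      (fun s => if χ.black (D.region s.1 s.2) = β then some (χ.face (colourState β) s.1) else none)
      (by
        rintro _ _ ⟨c, k, rfl, rfl⟩
        have h : D.region (D.arc c (k + 1)) (!D.out c (k + 1)) = D.corner c k :=
          (D.corner_eq c k).symm
        simp only [h]
        change (if χ.black (D.corner c k) = β then _ else _) = _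
        split_ifs with hk
        · rw [χ.face_arc_succ hk]
        · rfl)
    have hΦ : ∀ a, Φ (χ.sideRegion β a) = some (χ.face (colourState β) a) :=
      fun a => if_pos (χ.black_sideRegion β a)
    intro h
    have h1 := congrArg Φ h
    rw [hΦ, hΦ] at h1
    exact Option.some.inj h1

theorem card_face_colourState [Fintype C] (β : Bool) :
    Nat.card (χ.Face (colourState β)) = Nat.card {r : D.Region // χ.black r = β} := by
  refine Nat.card_eq_of_bijective (Quot.lift
    (fun a => ⟨χ.sideRegion β a, χ.black_sideRegion β a⟩) fun a b hab => Subtype.ext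
      ((χ.face_colourState_eq_iff β a b).1 (Quot.sound hab))) ⟨?_, ?_⟩
  · rintro ⟨a⟩ ⟨b⟩ h
    exact (χ.face_colourState_eq_iff β a b).2 (congrArg Subtype.val h)
  · rintro ⟨⟨a, side⟩, h⟩
    exact ⟨Quot.mk _ a, Subtype.ext (χ.sideRegion_eq h)⟩

/-- Euler's formula for the sphere, in terms of the regions of the two colours. -/
theorem card_black_add_card_white [Finite Arc] :
    Nat.card {r : D.Region // χ.black r = true} + Nat.card {r : D.Region // χ.black r = false} =
      Nat.card C + 2 := by
  have : Finite D.Region := inferInstanceAs (Finite (Quot _))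
  rw [← D.planar, ← Nat.card_sum]
  refine Nat.card_congr ((Equiv.sumCongr (Equiv.refl _) (Equiv.subtypeEquivRight fun r => ?_)).trans
    (Equiv.sumCompl fun r : D.Region => χ.black r = true))
  simp

theorem sameComponent_univ (a b : Arc) : χ.SameComponent Set.univ a b := by
  refine Relation.EqvGen.le_of_equivalence (χ.sameComponent_equivalence _) ?_ (D.connected a b)
  rintro _ _ ⟨c, k, l, rfl, rfl⟩
  have h : ∀ k, χ.Reachable Set.univ (χ.sideRegion true (D.arc c k)) (χ.end₁ c) := by
    have h0 : χ.Reachable Set.univ (χ.end₂ c) (χ.end₁ c) :=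
      (edgeConn_ends (a := χ.end₁) (b := χ.end₂) (Set.mem_univ c)).symm
    intro k
    obtain ⟨i, h | h⟩ := χ.arc_eq_or c k <;> rw [h]
    · rw [sideRegion_startArc]
      cases i
      · exact .refl _
      · exact h0
    · rw [sideRegion_endArc]
      cases i
      · exact .refl _
      · exact h0
  exact (h k).trans _ _ _ (h l).symm

/-- Twice the number of components plus the number of edges minus the number of circles. This is
monotone under the insertion of edges for any ribbon graph; it is constant if the graph is
planar. -/
noncomputable def eulerDefect (H : Finset C) : ℤ :=
  2 * (Nat.card (Quot (χ.SameComponent (H : Set C))) : ℤ) + H.card - Nat.card (χ.Face H)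

theorem isToggle_insert [DecidableEq C] {H : Finset C} {e : C} (he : e ∉ H) :
    IsToggle H (insert e H) e :=
  ⟨fun c hc => by simp [hc], by simp [he]⟩

theorem card_face_toggle [Finite Arc] {H H' : Finset C} {e : C} (h : IsToggle H H' e)
    (hne : χ.face₁ H e ≠ χ.face₂ H e) : Nat.card (χ.Face H) = Nat.card (χ.Face H') + 1 := by
  have hj := χ.isJoin_face h hne
  refine card_quot_of_isJoin (u := D.arc e 0) (v := D.arc e 2) (fun a b => ?_) ?_
  · have := hj a b
    simpa only [face_eq_iff] using this
  · rw [← face_eq_iff]; exact hne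

/-- A new edge merges two circles if it joins two components; otherwise it may split or merge, and a
merge increases the defect. -/
theorem eulerDefect_insert [Finite Arc] [DecidableEq C] {H : Finset C} {e : C} (he : e ∉ H) :
    χ.eulerDefect H ≤ χ.eulerDefect (insert e H) ∧
      (χ.eulerDefect H = χ.eulerDefect (insert e H) → χ.EndsReachable (H : Set C) e →
        χ.face₁ H e = χ.face₂ H e) := by
  have hcard := Finset.card_insert_of_notMem he
  have hj := χ.isJoin_sameComponent (H : Set C) e
  rw [← Finset.coe_insert] at hj
  have hE : ∀ (H : Set C) a b, Relation.EqvGen (χ.SameComponent H) a b ↔ χ.SameComponent H a b :=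
    fun H a b => (χ.sameComponent_equivalence H).eqvGen_iff
  have hends : χ.SameComponent (H : Set C) (χ.startArc (e, false)) (χ.startArc (e, true)) ↔
      χ.EndsReachable (H : Set C) e := by
    unfold SameComponent
    rw [sideRegion_startArc, sideRegion_startArc, endsReachable_iff]
    rfl
  have ht := isToggle_insert he
  unfold eulerDefect
  by_cases hr : χ.EndsReachable (H : Set C) e
  · have h1 : Nat.card (Quot (χ.SameComponent (H : Set C))) =
        Nat.card (Quot (χ.SameComponent ((insert e H : Finset C) : Set C))) := by
      refine card_quot_congr fun a b => ?_
      rw [hE, hE, hj.of_rel (χ.sameComponent_equivalence _) (hends.2 hr)]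
    by_cases hf : χ.face₁ H e = χ.face₂ H e
    · have h2 := χ.card_face_toggle ht.symm
        (by rw [Ne, χ.face₁_eq_face₂_toggle ht]; exact not_not.2 hf)
      exact ⟨by omega, fun _ _ => hf⟩
    · have h2 := χ.card_face_toggle ht hf
      exact ⟨by omega, by omega⟩
  · have h1 : Nat.card (Quot (χ.SameComponent (H : Set C))) =
        Nat.card (Quot (χ.SameComponent ((insert e H : Finset C) : Set C))) + 1 := by
      refine card_quot_of_isJoin (fun a b => ?_) ?_ (u := χ.startArc (e, false))
        (v := χ.startArc (e, true))
      · simp only [hE]; exact hj a b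
      · rw [hE, hends]; exact hr
    have hf : χ.face₁ H e ≠ χ.face₂ H e := by
      rw [Ne, ← face_startArc_eq_iff]
      exact fun hf => hr (hends.1 (χ.sameComponent_of_face_eq hf))
    have h2 := χ.card_face_toggle ht hf
    exact ⟨by omega, fun _ h => (hr h).elim⟩

theorem eulerDefect_mono [Finite Arc] [DecidableEq C] {H H' : Finset C} (h : H ⊆ H') :
    χ.eulerDefect H ≤ χ.eulerDefect H' := by
  have key : ∀ t : Finset C, χ.eulerDefect H ≤ χ.eulerDefect (H ∪ t) := by
    intro t
    induction t using Finset.induction_on with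
    | empty => simp
    | insert e t _ ih =>
      rw [Finset.union_insert]
      by_cases he : e ∈ H ∪ t
      · rwa [Finset.insert_eq_of_mem he]
      · exact ih.trans (χ.eulerDefect_insert he).1
  have := key H'
  rwa [Finset.union_eq_right.2 h] at this

/-- For a planar diagram the defect of the full graph agrees with that of the empty one; as the
defect is monotone, it is constant. -/
theorem eulerDefect_univ [Finite Arc] [Nonempty Arc] [Fintype C] :
    χ.eulerDefect (∅ : Finset C) = χ.eulerDefect Finset.univ := by
  have h1 : Nat.card (Quot (χ.SameComponent ((∅ : Finset C) : Set C))) =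
      Nat.card (χ.Face (∅ : Finset C)) := by
    refine card_quot_congr fun a b => ?_
    rw [(χ.sameComponent_equivalence _).eqvGen_iff, ← face_eq_iff]
    refine ⟨fun h => ?_, χ.sameComponent_of_face_eq⟩
    have h' := EdgeConn.of_equivalence (s := Eq) ⟨fun _ => rfl, fun h => h.symm,
      fun h h' => h.trans h'⟩ (by simp) h
    exact (χ.face_colourState_eq_iff true a b).2 h'
  have h2 : Nat.card (Quot (χ.SameComponent ((Finset.univ : Finset C) : Set C))) = 1 := by
    rw [Finset.coe_univ, Nat.card_eq_one_iff_unique]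
    refine ⟨⟨?_⟩, ⟨Quot.mk _ (Classical.arbitrary Arc)⟩⟩
    rintro ⟨a⟩ ⟨b⟩
    exact Quot.sound (χ.sameComponent_univ a b)
  have h3 := χ.card_face_colourState true
  have h4 := χ.card_face_colourState false
  have h5 := χ.card_black_add_card_white
  simp only [colourState, if_true, Bool.false_eq_true, if_false] at h3 h4
  unfold eulerDefect
  rw [h1, h2, h3, h4, Finset.card_empty, Finset.card_univ, ← Nat.card_eq_fintype_card]
  push_cast
  omega

/-- Planarity: inserting an edge splits a circle if its ends are already connected, and otherwise
merges two circles. -/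
theorem face₁_eq_face₂_iff [Finite Arc] [Fintype C] {H : Finset C} {e : C} (he : e ∉ H) :
    χ.face₁ H e = χ.face₂ H e ↔ χ.EndsReachable (H : Set C) e := by
  classical
  have : Nonempty Arc := ⟨D.arc e 0⟩
  constructor
  · intro h
    rw [← face_startArc_eq_iff] at h
    have h' := χ.sameComponent_of_face_eq h
    unfold SameComponent at h'
    rw [sideRegion_startArc, sideRegion_startArc] at h'
    exact (χ.endsReachable_iff _ e).2 h'
  · have h1 := χ.eulerDefect_mono (Finset.empty_subset H)
    have h2 := χ.eulerDefect_mono (Finset.subset_univ (insert e H))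
    have h3 := χ.eulerDefect_insert he
    exact h3.2 (h3.1.antisymm ((h2.trans χ.eulerDefect_univ.ge).trans h1))

theorem face₁_eq_face₂_iff_of_mem [Finite Arc] [Fintype C] {H : Finset C} {e : C} (he : e ∈ H) :
    χ.face₁ H e = χ.face₂ H e ↔ ¬ χ.EndsReachable ((H : Set C) \ {e}) e := by
  classical
  have ht : IsToggle (H.erase e) H e := ⟨fun c hc => by simp [hc], by simp [he]⟩
  rw [χ.face₁_eq_face₂_toggle ht, Ne, χ.face₁_eq_face₂_iff (Finset.notMem_erase e H),
    Finset.coe_erase]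

end ConnectedLinkDiagram.Checkerboard

namespace ConnectedLinkDiagram.Checkerboard

variable {Arc C : Type*} {D : ConnectedLinkDiagram Arc C} {χ : D.Checkerboard}

/-! ### Circles touched and not touched by a change of smoothing -/

section Toggle

variable [Finite Arc] {H H' : Finset C} {e : C}

theorem IsToggle.touched_iff (h : IsToggle H H' e) (a : Arc) :
    (χ.face H' a = χ.face₁ H' e ∨ χ.face H' a = χ.face₂ H' e) ↔
      (χ.face H a = χ.face₁ H e ∨ χ.face H a = χ.face₂ H e) := by
  have key : ∀ {H H' : Finset C}, IsToggle H H' e → χ.face₁ H e ≠ χ.face₂ H e →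
      ((χ.face H' a = χ.face₁ H' e ∨ χ.face H' a = χ.face₂ H' e) ↔
      (χ.face H a = χ.face₁ H e ∨ χ.face H a = χ.face₂ H e)) := by
    intro H H' h hne
    have h1 := χ.isJoin_face h hne a (D.arc e 0)
    rw [← (χ.face₁_eq_face₂_toggle h).2 hne, or_self]
    unfold face₁ face₂ at *
    refine h1.trans ?_
    constructor
    · rintro (h | ⟨h, -⟩ | ⟨h, -⟩)
      · exact Or.inl h
      · exact Or.inl h
      · exact Or.inr h
    · rintro (h | h)
      · exact Or.inl h
      · exact Or.inr (Or.inr ⟨h, rfl⟩)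
  by_cases hne : χ.face₁ H e = χ.face₂ H e
  · refine (key h.symm ?_).symm
    rw [Ne, χ.face₁_eq_face₂_toggle h]
    exact not_not.2 hne
  · exact key h hne

theorem IsToggle.face_eq_iff_of_untouched (h : IsToggle H H' e) {a b : Arc}
    (h1 : χ.face H a ≠ χ.face₁ H e) (h2 : χ.face H a ≠ χ.face₂ H e) :
    χ.face H' a = χ.face H' b ↔ χ.face H a = χ.face H b := by
  have key : ∀ {H H' : Finset C}, IsToggle H H' e → χ.face₁ H e ≠ χ.face₂ H e →
      χ.face H a ≠ χ.face₁ H e → χ.face H a ≠ χ.face₂ H e →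
      (χ.face H' a = χ.face H' b ↔ χ.face H a = χ.face H b) := by
    intro H H' h hne h1 h2
    refine (χ.isJoin_face h hne a b).trans ⟨?_, Or.inl⟩
    rintro (h | ⟨h, -⟩ | ⟨h, -⟩)
    · exact h
    · exact (h1 h).elim
    · exact (h2 h).elim
  by_cases hne : χ.face₁ H e = χ.face₂ H e
  · have h3 : ¬ (χ.face H' a = χ.face₁ H' e ∨ χ.face H' a = χ.face₂ H' e) := by
      rw [h.touched_iff]; simp [h1, h2]
    rw [not_or] at h3
    refine (key h.symm ?_ h3.1 h3.2).symm
    rw [Ne, χ.face₁_eq_face₂_toggle h]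
    exact not_not.2 hne
  · exact key h hne h1 h2

/-- If the circle at `e` splits, its arcs are distributed to the two new circles at `e`. -/
theorem IsToggle.face_eq_or_of_split (h : IsToggle H H' e) {a : Arc}
    (ha : χ.face H a = χ.face₁ H e) :
    χ.face H' a = χ.face₁ H' e ∨ χ.face H' a = χ.face₂ H' e :=
  (h.touched_iff a).2 (Or.inl ha)

end Toggle

namespace EnhancedSubgraph

/-! ### Labels as functions on the arcs -/

/-- The label of the circle that contains the arc `a`. -/
def lab (S : χ.EnhancedSubgraph) (a : Arc) : Label := S.ε (χ.face S.H a)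

theorem lab_congr {S : χ.EnhancedSubgraph} {a b : Arc} (h : χ.face S.H a = χ.face S.H b) :
    S.lab a = S.lab b := congrArg S.ε h

theorem ext_lab {S S' : χ.EnhancedSubgraph} (hH : S.H = S'.H) (h : ∀ a, S.lab a = S'.lab a) :
    S = S' := by
  obtain ⟨H, ε⟩ := S
  obtain ⟨H', ε'⟩ := S'
  obtain rfl : H = H' := hH
  congr 1
  funext F
  obtain ⟨a, rfl⟩ := Quot.exists_rep F
  exact h a

theorem exists_of_lab (χ : D.Checkerboard) (H : Finset C) (l : Arc → Label)
    (h : ∀ a b, χ.face H a = χ.face H b → l a = l b) :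
    ∃ S : χ.EnhancedSubgraph, S.H = H ∧ ∀ a, S.lab a = l a :=
  ⟨⟨H, Quot.lift l fun a b hab => h a b (Quot.sound hab)⟩, rfl, fun _ => rfl⟩

theorem IsTerm.toggle {S S' : χ.EnhancedSubgraph} {e : C} (h : S.IsTerm S' e) :
    IsToggle S.H S'.H e := by
  refine ⟨h.2.2.1, ?_⟩
  rw [h.2.1]
  rcases h.1 with ⟨h1, h2⟩ | ⟨h1, h2⟩ <;> simp [h1, h2]

theorem mem_aEdges_iff {S : χ.EnhancedSubgraph} {e : C} :
    e ∈ S.aEdges ↔ (e ∈ S.H ↔ χ.positive e = true) := by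
  unfold aEdges
  cases h : χ.positive e <;> simp [h]

/-- The differential in terms of the labels of the arcs. -/
theorem isTerm_iff {S S' : χ.EnhancedSubgraph} {e : C} :
    S.IsTerm S' e ↔ e ∈ S.aEdges ∧ IsToggle S.H S'.H e ∧
      (∀ a, χ.face S.H a ≠ χ.face₁ S.H e → χ.face S.H a ≠ χ.face₂ S.H e → S'.lab a = S.lab a) ∧
      (χ.face₁ S.H e ≠ χ.face₂ S.H e →
        Label.merge (S.lab (D.arc e 0)) (S.lab (D.arc e 2)) = some (S'.lab (D.arc e 0))) ∧
      (χ.face₁ S.H e = χ.face₂ S.H e →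
        (S'.lab (D.arc e 0), S'.lab (D.arc e 2)) ∈ Label.split (S.lab (D.arc e 0))) := by
  constructor
  · exact fun h => ⟨h.1, h.toggle, h.2.2.2⟩
  · rintro ⟨h1, h2, h3⟩
    refine ⟨h1, ?_, h2.1, h3⟩
    rw [h2.2, mem_aEdges_iff.1 h1]
    cases χ.positive e <;> simp

theorem notMem_aEdges_of_toggle {S S' : χ.EnhancedSubgraph} {e : C} (h : IsToggle S.H S'.H e)
    (he : e ∈ S.aEdges) (c : C) : c ∉ S'.aEdges ↔ c = e ∨ c ∉ S.aEdges := by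
  rw [mem_aEdges_iff] at he ⊢
  rw [mem_aEdges_iff]
  by_cases hc : c = e
  · subst hc
    rw [h.2]
    simp only [true_or, iff_true]
    intro h'
    tauto
  · rw [h.1 c hc]
    simp [hc]

/-! ### The degrees -/

theorem iDeg_eq [Finite C] (S : χ.EnhancedSubgraph) :
    S.iDeg = ({c | c ∉ S.aEdges}.ncard : ℤ) - D.nMinus := by
  unfold iDeg
  have h1 : {c | c ∉ S.aEdges} =
      {c | χ.positive c = true ∧ c ∉ S.H} ∪ {c | χ.positive c = false ∧ c ∈ S.H} := by
    ext c
    simp only [Set.mem_ofPred_eq, mem_aEdges_iff, Set.mem_union]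
    cases χ.positive c <;> simp
  have h2 : Disjoint {c | χ.positive c = true ∧ c ∉ S.H} {c | χ.positive c = false ∧ c ∈ S.H} :=
    Set.disjoint_left.2 fun c hc hc' => by simpa [hc'.1] using hc.1
  rw [h1, Set.ncard_union_eq h2]
  push_cast
  rfl

theorem iDeg_of_toggle [Finite C] {S S' : χ.EnhancedSubgraph} {e : C} (h : IsToggle S.H S'.H e)
    (he : e ∈ S.aEdges) : S'.iDeg = S.iDeg + 1 := by
  have h1 : {c | c ∉ S'.aEdges} = insert e {c | c ∉ S.aEdges} :=
    Set.ext fun c => notMem_aEdges_of_toggle h he c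
  have h2 : e ∉ {c | c ∉ S.aEdges} := fun h' => h' he
  rw [iDeg_eq, iDeg_eq, h1, Set.ncard_insert_of_notMem h2]
  push_cast
  ring

/-- The contribution of a circle with a given label to the quantum degree. -/
def _root_.Label.sign : Label → ℤ
  | .one => 1
  | .x => -1

theorem card_one_sub_card_x [Finite Arc] (S : χ.EnhancedSubgraph) [Fintype (χ.Face S.H)] :
    (Nat.card {F // S.ε F = .one} : ℤ) - (Nat.card {F // S.ε F = .x} : ℤ) =
      ∑ F, (S.ε F).sign := by
  classical
  have h : ∀ F, (S.ε F).sign = (if S.ε F = .one then 1 else 0) - (if S.ε F = .x then 1 else 0) := by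
    intro F
    cases S.ε F <;> simp [Label.sign]
  simp only [h, Finset.sum_sub_distrib, Finset.sum_boole, Nat.card_eq_fintype_card,
    Fintype.card_subtype]

/-- The multiplication and the comultiplication lower the quantum degree of the labels by one, which
compensates the increase of the homological degree. -/
theorem sum_sign_of_isTerm [Finite Arc] {S S' : χ.EnhancedSubgraph} {e : C} (h : S.IsTerm S' e)
    [Fintype (χ.Face S.H)] [Fintype (χ.Face S'.H)] :
    ∑ F, (S'.ε F).sign = ∑ F, (S.ε F).sign - 1 := by
  obtain ⟨-, ht, h1, h2, h3⟩ := isTerm_iff.1 h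
  have hjoin : ∀ {H H' : Finset C}, IsToggle H H' e → χ.face₁ H e ≠ χ.face₂ H e →
      IsJoin (Relation.EqvGen (χ.Joined H)) (Relation.EqvGen (χ.Joined H'))
        (D.arc e 0) (D.arc e 2) := fun ht hf a b => by
    have := χ.isJoin_face ht hf a b
    simpa only [face_eq_iff] using this
  let _ : Fintype (Quot (χ.Joined S.H)) := inferInstanceAs (Fintype (χ.Face S.H))
  let _ : Fintype (Quot (χ.Joined S'.H)) := inferInstanceAs (Fintype (χ.Face S'.H))
  by_cases hf : χ.face₁ S.H e = χ.face₂ S.H e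
  · have hf' : χ.face₁ S'.H e ≠ χ.face₂ S'.H e := by
      rw [Ne, χ.face₁_eq_face₂_toggle ht]; exact not_not.2 hf
    have h4 := sum_quot_of_isJoin (hjoin ht.symm hf') (by rw [← face_eq_iff]; exact hf')
      (fun F => (S'.ε F).sign) (fun F => (S.ε F).sign) fun a ha1 ha2 => by
        rw [← face_eq_iff] at ha1 ha2
        have h5 : ¬ (χ.face S.H a = χ.face₁ S.H e ∨ χ.face S.H a = χ.face₂ S.H e) := by
          rw [← ht.touched_iff]; exact not_or.2 ⟨ha1, ha2⟩
        rw [not_or] at h5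
        exact congrArg Label.sign (h1 a h5.1 h5.2).symm
    have h5 := h3 hf
    have h6 : (S'.lab (D.arc e 0)).sign + (S'.lab (D.arc e 2)).sign =
        (S.lab (D.arc e 0)).sign - 1 := by
      revert h5
      cases S.lab (D.arc e 0) <;> cases S'.lab (D.arc e 0) <;> cases S'.lab (D.arc e 2) <;>
        simp [Label.split, Label.sign]
    change ∑ F, (S'.ε F).sign + (S.lab (D.arc e 0)).sign = ∑ F, (S.ε F).sign +
      ((S'.lab (D.arc e 0)).sign + (S'.lab (D.arc e 2)).sign) at h4
    linarith
  · have h4 := sum_quot_of_isJoin (hjoin ht hf) (by rw [← face_eq_iff]; exact hf)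
      (fun F => (S.ε F).sign) (fun F => (S'.ε F).sign) fun a ha1 ha2 => by
        rw [← face_eq_iff] at ha1 ha2
        exact congrArg Label.sign (h1 a ha1 ha2)
    have h5 := h2 hf
    have h6 : (S'.lab (D.arc e 0)).sign =
        (S.lab (D.arc e 0)).sign + (S.lab (D.arc e 2)).sign - 1 := by
      revert h5
      cases S.lab (D.arc e 0) <;> cases S'.lab (D.arc e 0) <;> cases S.lab (D.arc e 2) <;>
        simp [Label.merge, Label.sign]
    change ∑ F, (S.ε F).sign + (S'.lab (D.arc e 0)).sign = ∑ F, (S'.ε F).sign +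
      ((S.lab (D.arc e 0)).sign + (S.lab (D.arc e 2)).sign) at h4
    linarith

theorem jDeg_of_isTerm [Finite Arc] [Finite C] {S S' : χ.EnhancedSubgraph} {e : C}
    (h : S.IsTerm S' e) : S'.jDeg = S.jDeg := by
  have := Fintype.ofFinite (χ.Face S.H)
  have := Fintype.ofFinite (χ.Face S'.H)
  unfold jDeg
  rw [card_one_sub_card_x, card_one_sub_card_x, sum_sign_of_isTerm h, iDeg_of_toggle h.toggle h.1]
  ring

end EnhancedSubgraph

end ConnectedLinkDiagram.Checkerboard

namespace ConnectedLinkDiagram.Checkerboard.EnhancedSubgraph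

variable {Arc C : Type*} {D : ConnectedLinkDiagram Arc C} {χ : D.Checkerboard}

/-! ### Multiplication by the variable of a circle -/

open Classical in
/-- Change the label of the circle that contains the arc `a` to `l`. -/
noncomputable def setLabel (S : χ.EnhancedSubgraph) (a : Arc) (l : Label) : χ.EnhancedSubgraph :=
  ⟨S.H, Function.update S.ε (χ.face S.H a) l⟩

theorem lab_setLabel_of_eq {S : χ.EnhancedSubgraph} {a b : Arc} (l : Label)
    (h : χ.face S.H b = χ.face S.H a) : (S.setLabel a l).lab b = l := by
  classical
  change Function.update S.ε (χ.face S.H a) l (χ.face S.H b) = l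
  rw [h, Function.update_self]

theorem lab_setLabel_of_ne {S : χ.EnhancedSubgraph} {a b : Arc} (l : Label)
    (h : χ.face S.H b ≠ χ.face S.H a) : (S.setLabel a l).lab b = S.lab b := by
  classical
  exact Function.update_of_ne h _ _

theorem setLabel_setLabel (S : χ.EnhancedSubgraph) (a : Arc) (l l' : Label) :
    (S.setLabel a l).setLabel a l' = S.setLabel a l' := by
  refine ext_lab rfl fun b => ?_
  by_cases hb : χ.face S.H b = χ.face S.H a
  · rw [lab_setLabel_of_eq (S := S.setLabel a l) _ hb, lab_setLabel_of_eq _ hb]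
  · rw [lab_setLabel_of_ne (S := S.setLabel a l) _ hb, lab_setLabel_of_ne _ hb,
      lab_setLabel_of_ne _ hb]

theorem setLabel_eq_self {S : χ.EnhancedSubgraph} {a : Arc} {l : Label} (h : S.lab a = l) :
    S.setLabel a l = S := by
  subst h
  exact ext_lab rfl fun b => by
    by_cases hb : χ.face S.H b = χ.face S.H a
    · rw [lab_setLabel_of_eq _ hb, lab_congr hb]
    · rw [lab_setLabel_of_ne _ hb]

theorem setLabel_congr (S : χ.EnhancedSubgraph) {a b : Arc} (l : Label)
    (h : χ.face S.H a = χ.face S.H b) : S.setLabel a l = S.setLabel b l := by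
  unfold setLabel; rw [h]

theorem setLabel_comm (S : χ.EnhancedSubgraph) {a b : Arc} (l l' : Label)
    (h : χ.face S.H a ≠ χ.face S.H b) :
    (S.setLabel a l).setLabel b l' = (S.setLabel b l').setLabel a l := by
  refine ext_lab rfl fun c => ?_
  by_cases ha : χ.face S.H c = χ.face S.H a
  · have hb : χ.face S.H c ≠ χ.face S.H b := fun hb => h (ha.symm.trans hb)
    rw [lab_setLabel_of_ne (S := S.setLabel a l) _ hb, lab_setLabel_of_eq _ ha,
      lab_setLabel_of_eq (S := S.setLabel b l') _ ha]
  · rw [lab_setLabel_of_ne (S := S.setLabel b l') _ ha]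
    by_cases hb : χ.face S.H c = χ.face S.H b
    · rw [lab_setLabel_of_eq (S := S.setLabel a l) _ hb, lab_setLabel_of_eq _ hb]
    · rw [lab_setLabel_of_ne (S := S.setLabel a l) _ hb, lab_setLabel_of_ne _ hb,
        lab_setLabel_of_ne _ ha]

open Classical in
/-- Multiplication by the variable of the circle through the arc `a`, in terms of coefficient
functions. -/
noncomputable def mulX (χ : D.Checkerboard) (a : Arc) :
    (χ.EnhancedSubgraph → ℤ) →ₗ[ℤ] (χ.EnhancedSubgraph → ℤ) where
  toFun φ S := if S.lab a = .x then φ (S.setLabel a .one) else 0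
  map_add' φ ψ := by ext S; simp only [Pi.add_apply]; split_ifs <;> simp
  map_smul' c φ := by ext S; simp

open Classical in
theorem mulX_apply (a : Arc) (φ : χ.EnhancedSubgraph → ℤ) (S : χ.EnhancedSubgraph) :
    mulX χ a φ S = if S.lab a = .x then φ (S.setLabel a .one) else 0 := rfl

theorem mulX_comm (a b : Arc) (φ : χ.EnhancedSubgraph → ℤ) :
    mulX χ a (mulX χ b φ) = mulX χ b (mulX χ a φ) := by
  ext S
  simp only [mulX_apply]
  by_cases hab : χ.face S.H a = χ.face S.H b
  · rw [lab_setLabel_of_eq _ hab.symm, lab_setLabel_of_eq _ hab]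
    simp
  · rw [lab_setLabel_of_ne _ (Ne.symm hab), lab_setLabel_of_ne _ hab, S.setLabel_comm _ _ hab]
    by_cases h1 : S.lab a = .x <;> by_cases h2 : S.lab b = .x <;> simp [h1, h2]

open Classical in
/-- The coefficient function of a basis element. -/
noncomputable def delta (S : χ.EnhancedSubgraph) : χ.EnhancedSubgraph → ℤ := Pi.single S 1

open Classical in
theorem delta_apply (S S' : χ.EnhancedSubgraph) : delta S S' = if S' = S then 1 else 0 :=
  Pi.single_apply S 1 S'

theorem mulX_delta {S : χ.EnhancedSubgraph} {a : Arc} (h : S.lab a = .x) :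
    mulX χ a (delta (S.setLabel a .one)) = delta S := by
  classical
  ext S'
  rw [mulX_apply, delta_apply, delta_apply]
  by_cases hS : S' = S
  · subst hS; simp [h]
  · rw [if_neg hS]
    split_ifs with h1 h2
    · refine (hS ?_).elim
      have h3 := congrArg (fun S => S.setLabel a .x) h2
      simp only [setLabel_setLabel] at h3
      rwa [setLabel_eq_self h1, setLabel_eq_self h] at h3
    · rfl
    · rfl

/-- The state `H` with all labels `1`. -/
def unit (χ : D.Checkerboard) (H : Finset C) : χ.EnhancedSubgraph := ⟨H, fun _ => .one⟩

theorem mulX_delta_unit_congr {H : Finset C} {a b : Arc} (h : χ.face H a = χ.face H b) :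
    mulX χ a (delta (unit χ H)) = mulX χ b (delta (unit χ H)) := by
  classical
  ext S
  rw [mulX_apply, mulX_apply, delta_apply, delta_apply]
  by_cases hS : S.H = H
  · subst hS
    rw [lab_congr h, S.setLabel_congr _ h]
  · have h1 : ∀ a, S.setLabel a .one ≠ unit χ H := fun a h' => hS (congrArg (·.H) h')
    simp [h1]

open Classical in
/-- The factor `1` of a merge, and the factor `x₁ + x₂` of a split. -/
noncomputable def factor (χ : D.Checkerboard) (e : C) (H : Finset C) :
    (χ.EnhancedSubgraph → ℤ) →ₗ[ℤ] (χ.EnhancedSubgraph → ℤ) :=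
  if χ.face₁ H e = χ.face₂ H e then mulX χ (D.arc e 0) + mulX χ (D.arc e 2) else LinearMap.id

theorem lab_unit (H : Finset C) (a : Arc) : (unit χ H).lab a = .one := rfl

section Finite

variable [Finite Arc]

/-- The differential is linear over multiplication by the variable of the circle of any arc. -/
theorem isTerm_iff_setLabel {S S' : χ.EnhancedSubgraph} {e : C} {a : Arc} (ha : S.lab a = .x) :
    S.IsTerm S' e ↔ S'.lab a = .x ∧ (S.setLabel a .one).IsTerm (S'.setLabel a .one) e := by
  rw [isTerm_iff, isTerm_iff (S := S.setLabel a .one)]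
  change _ ↔ _ ∧ e ∈ S.aEdges ∧ IsToggle S.H S'.H e ∧
      (∀ b, χ.face S.H b ≠ χ.face₁ S.H e → χ.face S.H b ≠ χ.face₂ S.H e →
        (S'.setLabel a .one).lab b = (S.setLabel a .one).lab b) ∧
      (χ.face₁ S.H e ≠ χ.face₂ S.H e → Label.merge ((S.setLabel a .one).lab (D.arc e 0))
        ((S.setLabel a .one).lab (D.arc e 2)) = some ((S'.setLabel a .one).lab (D.arc e 0))) ∧
      (χ.face₁ S.H e = χ.face₂ S.H e → ((S'.setLabel a .one).lab (D.arc e 0),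
        (S'.setLabel a .one).lab (D.arc e 2)) ∈ Label.split ((S.setLabel a .one).lab (D.arc e 0)))
  by_cases he : e ∈ S.aEdges
  swap
  · simp [he]
  by_cases ht : IsToggle S.H S'.H e
  swap
  · simp [ht]
  simp only [he, ht, true_and]
  have htt := ht.touched_iff (χ := χ) a
  by_cases hta : χ.face S.H a = χ.face₁ S.H e ∨ χ.face S.H a = χ.face₂ S.H e
  · -- The circle of `a` is touched: only the labels at `e` matter.
    have hta' := htt.2 hta
    have hun : (∀ b, χ.face S.H b ≠ χ.face₁ S.H e → χ.face S.H b ≠ χ.face₂ S.H e →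
        (S'.setLabel a .one).lab b = (S.setLabel a .one).lab b) ↔
        (∀ b, χ.face S.H b ≠ χ.face₁ S.H e → χ.face S.H b ≠ χ.face₂ S.H e →
          S'.lab b = S.lab b) := by
      refine forall_congr' fun b => forall_congr' fun h1 => forall_congr' fun h2 => ?_
      have h3 : χ.face S.H b ≠ χ.face S.H a := fun h => hta.elim (fun h' => h1 (h.trans h'))
        fun h' => h2 (h.trans h')
      rw [lab_setLabel_of_ne _ h3, lab_setLabel_of_ne]
      rwa [Ne, ht.face_eq_iff_of_untouched h1 h2]
    rw [hun]
    by_cases hf : χ.face₁ S.H e = χ.face₂ S.H e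
    · have hf' : χ.face₁ S'.H e ≠ χ.face₂ S'.H e := by
        rw [Ne, χ.face₁_eq_face₂_toggle ht]; exact not_not.2 hf
      have ha1 : χ.face S.H a = χ.face₁ S.H e := hta.elim id fun h => h.trans hf.symm
      have h1 : (S.setLabel a .one).lab (D.arc e 0) = .one := lab_setLabel_of_eq _ ha1.symm
      have h2 : S.lab (D.arc e 0) = .x := (lab_congr ha1.symm).trans ha
      rw [h1, h2]
      simp only [hf, ne_eq, not_true_eq_false, false_imp_iff, true_imp_iff, true_and]
      rcases hta' with h3 | h3
      · have h4 : (S'.setLabel a .one).lab (D.arc e 0) = .one := lab_setLabel_of_eq _ h3.symm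
        have h5 : (S'.setLabel a .one).lab (D.arc e 2) = S'.lab (D.arc e 2) :=
          lab_setLabel_of_ne _ (by rw [h3]; exact hf'.symm)
        have h6 : S'.lab a = S'.lab (D.arc e 0) := lab_congr h3
        rw [h4, h5, h6]
        cases S'.lab (D.arc e 0) <;> cases S'.lab (D.arc e 2) <;> simp [Label.split]
      · have h4 : (S'.setLabel a .one).lab (D.arc e 2) = .one := lab_setLabel_of_eq _ h3.symm
        have h5 : (S'.setLabel a .one).lab (D.arc e 0) = S'.lab (D.arc e 0) :=
          lab_setLabel_of_ne _ (by rw [h3]; exact hf')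
        have h6 : S'.lab a = S'.lab (D.arc e 2) := lab_congr h3
        rw [h4, h5, h6]
        cases S'.lab (D.arc e 0) <;> cases S'.lab (D.arc e 2) <;> simp [Label.split]
    · have hf' : χ.face₁ S'.H e = χ.face₂ S'.H e := (χ.face₁_eq_face₂_toggle ht).2 hf
      have h3 : χ.face S'.H a = χ.face₁ S'.H e := hta'.elim id fun h => h.trans hf'.symm
      have h4 : (S'.setLabel a .one).lab (D.arc e 0) = .one := lab_setLabel_of_eq _ h3.symm
      have h6 : S'.lab a = S'.lab (D.arc e 0) := lab_congr h3
      rw [h4, h6]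
      simp only [hf, ne_eq, not_false_eq_true, false_imp_iff, true_imp_iff, and_true]
      rcases hta with h1 | h1
      · have h7 : (S.setLabel a .one).lab (D.arc e 0) = .one := lab_setLabel_of_eq _ h1.symm
        have h8 : (S.setLabel a .one).lab (D.arc e 2) = S.lab (D.arc e 2) :=
          lab_setLabel_of_ne _ (by rw [h1]; exact Ne.symm hf)
        have h9 : S.lab (D.arc e 0) = .x := (lab_congr h1.symm).trans ha
        rw [h7, h8, h9]
        cases S'.lab (D.arc e 0) <;> cases S.lab (D.arc e 2) <;> simp [Label.merge]
      · have h7 : (S.setLabel a .one).lab (D.arc e 2) = .one := lab_setLabel_of_eq _ h1.symm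
        have h8 : (S.setLabel a .one).lab (D.arc e 0) = S.lab (D.arc e 0) :=
          lab_setLabel_of_ne _ (by rw [h1]; exact hf)
        have h9 : S.lab (D.arc e 2) = .x := (lab_congr h1.symm).trans ha
        rw [h7, h8, h9]
        cases S'.lab (D.arc e 0) <;> cases S.lab (D.arc e 0) <;> simp [Label.merge]
  · -- The circle of `a` is not touched, and its label is unchanged.
    have hta' := mt htt.1 hta
    rw [not_or] at hta hta'
    have h0 : (S.setLabel a .one).lab (D.arc e 0) = S.lab (D.arc e 0) :=
      lab_setLabel_of_ne _ (Ne.symm hta.1)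
    have h2 : (S.setLabel a .one).lab (D.arc e 2) = S.lab (D.arc e 2) :=
      lab_setLabel_of_ne _ (Ne.symm hta.2)
    have h0' : (S'.setLabel a .one).lab (D.arc e 0) = S'.lab (D.arc e 0) :=
      lab_setLabel_of_ne _ (Ne.symm hta'.1)
    have h2' : (S'.setLabel a .one).lab (D.arc e 2) = S'.lab (D.arc e 2) :=
      lab_setLabel_of_ne _ (Ne.symm hta'.2)
    rw [h0, h2, h0', h2']
    refine Iff.trans (and_congr_left fun _ => ?_) and_assoc
    have hcl : ∀ b, χ.face S'.H b = χ.face S'.H a ↔ χ.face S.H b = χ.face S.H a := fun b => by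
      rw [eq_comm, ht.face_eq_iff_of_untouched hta.1 hta.2, eq_comm]
    constructor
    · intro h
      refine ⟨(h a hta.1 hta.2).trans ha, fun b hb1 hb2 => ?_⟩
      by_cases hb : χ.face S.H b = χ.face S.H a
      · rw [lab_setLabel_of_eq _ hb, lab_setLabel_of_eq _ ((hcl b).2 hb)]
      · rw [lab_setLabel_of_ne _ hb, lab_setLabel_of_ne _ (mt (hcl b).1 hb), h b hb1 hb2]
    · rintro ⟨h, h'⟩ b hb1 hb2
      by_cases hb : χ.face S.H b = χ.face S.H a
      · rw [lab_congr hb, lab_congr ((hcl b).2 hb), h, ha]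
      · have := h' b hb1 hb2
        rwa [lab_setLabel_of_ne _ hb, lab_setLabel_of_ne _ (mt (hcl b).1 hb)] at this

theorem IsTerm.lab_eq_x {S S' : χ.EnhancedSubgraph} {e : C} {a : Arc} (h : S.IsTerm S' e)
    (ha : S.lab a = .x) : S'.lab a = .x := ((isTerm_iff_setLabel ha).1 h).1

variable [Finite C]

open Classical in
/-- The part of the Khovanov differential that changes the crossing `e`, without signs, in terms of
coefficient functions. -/
noncomputable def edgeMap (χ : D.Checkerboard) (e : C) :
    (χ.EnhancedSubgraph → ℤ) →ₗ[ℤ] (χ.EnhancedSubgraph → ℤ) :=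
  let _ := Fintype.ofFinite χ.EnhancedSubgraph
  { toFun φ S' := ∑ S, if S.IsTerm S' e then φ S else 0
    map_add' φ ψ := by
      ext S'
      simp only [Pi.add_apply, ← Finset.sum_add_distrib]
      exact Finset.sum_congr rfl fun S _ => by split_ifs <;> simp
    map_smul' c φ := by
      ext S'
      simp only [Pi.smul_apply, smul_eq_mul, Finset.mul_sum, RingHom.id_apply]
      exact Finset.sum_congr rfl fun S _ => by split_ifs <;> simp }

open Classical in
theorem edgeMap_apply [Fintype χ.EnhancedSubgraph] (e : C) (φ : χ.EnhancedSubgraph → ℤ)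
    (S' : χ.EnhancedSubgraph) :
    edgeMap χ e φ S' = ∑ S, if S.IsTerm S' e then φ S else 0 := by
  unfold edgeMap
  simp only [LinearMap.coe_mk, AddHom.coe_mk]
  exact Finset.sum_congr (by ext; simp) fun _ _ => rfl

theorem edgeMap_mulX (e : C) (a : Arc) (φ : χ.EnhancedSubgraph → ℤ) :
    edgeMap χ e (mulX χ a φ) = mulX χ a (edgeMap χ e φ) := by
  classical
  have := Fintype.ofFinite χ.EnhancedSubgraph
  ext S'
  rw [mulX_apply, edgeMap_apply, edgeMap_apply]
  simp only [mulX_apply]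
  by_cases hS' : S'.lab a = .x
  · rw [if_pos hS', ← Finset.sum_filter, ← Finset.sum_filter, Finset.sum_ite, Finset.sum_const_zero,
      add_zero, Finset.filter_filter]
    refine Finset.sum_bij' (fun S _ => S.setLabel a .one) (fun S _ => S.setLabel a .x)
      ?_ ?_ ?_ ?_ ?_
    · intro S hS
      simp only [Finset.mem_filter, Finset.mem_univ, true_and] at hS ⊢
      exact ((isTerm_iff_setLabel hS.2).1 hS.1).2
    · intro S hS
      simp only [Finset.mem_filter, Finset.mem_univ, true_and] at hS ⊢
      have h1 : (S.setLabel a .x).lab a = .x := lab_setLabel_of_eq _ rfl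
      refine ⟨(isTerm_iff_setLabel h1).2 ⟨hS', ?_⟩, h1⟩
      have h2 : S.lab a = .one := by
        cases h : S.lab a
        · rfl
        · have h3 := hS.lab_eq_x h
          rw [lab_setLabel_of_eq _ rfl] at h3
          cases h3
      rwa [setLabel_setLabel, setLabel_eq_self h2]
    · intro S hS
      simp only [Finset.mem_filter, Finset.mem_univ, true_and] at hS
      rw [setLabel_setLabel, setLabel_eq_self hS.2]
    · intro S hS
      simp only [Finset.mem_filter, Finset.mem_univ, true_and] at hS
      have h2 : S.lab a = .one := by
        cases h : S.lab a
        · rfl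
        · have h3 := hS.lab_eq_x h
          rw [lab_setLabel_of_eq _ rfl] at h3
          cases h3
      rw [setLabel_setLabel, setLabel_eq_self h2]
    · exact fun _ _ => rfl
  · rw [if_neg hS']
    refine Finset.sum_eq_zero fun S _ => ?_
    split_ifs with h1 h2
    · exact (hS' (h1.lab_eq_x h2)).elim
    · rfl
    · rfl

open Classical in
theorem edgeMap_delta (e : C) (S S' : χ.EnhancedSubgraph) :
    edgeMap χ e (delta S) S' = if S.IsTerm S' e then 1 else 0 := by
  have := Fintype.ofFinite χ.EnhancedSubgraph
  rw [edgeMap_apply, Finset.sum_eq_single S]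
  · rw [delta_apply, if_pos rfl]
  · intro T _ hT
    rw [delta_apply, if_neg hT, ite_self]
  · simp

theorem edgeMap_factor (e f : C) (H : Finset C) (φ : χ.EnhancedSubgraph → ℤ) :
    edgeMap χ e (factor χ f H φ) = factor χ f H (edgeMap χ e φ) := by
  unfold factor
  split_ifs
  · simp only [LinearMap.add_apply, map_add, edgeMap_mulX]
  · rfl

theorem edgeMap_unit_of_notMem {H : Finset C} {e : C} (he : e ∉ (unit χ H).aEdges) :
    edgeMap χ e (delta (unit χ H)) = 0 := by
  classical
  ext S'
  rw [edgeMap_delta, if_neg fun h => he h.1]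
  rfl

/-- On a state with all labels `1`, the map of a crossing is `1 ↦ 1` for a merge and `1 ↦ x₁ + x₂`
for a split. -/
theorem edgeMap_unit {H H' : Finset C} {e : C} (he : e ∈ (unit χ H).aEdges)
    (ht : IsToggle H H' e) :
    edgeMap χ e (delta (unit χ H)) = factor χ e H (delta (unit χ H')) := by
  classical
  ext S'
  have hH : IsToggle H S'.H e ↔ S'.H = H' := by
    refine ⟨fun h => ?_, fun h => h ▸ ht⟩
    ext c
    by_cases hc : c = e
    · rw [hc, h.2, ht.2]
    · rw [h.1 c hc, ht.1 c hc]
  have hT : (unit χ H).IsTerm S' e ↔ S'.H = H' ∧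
      (∀ a, χ.face H a ≠ χ.face₁ H e → χ.face H a ≠ χ.face₂ H e → S'.lab a = .one) ∧
      (χ.face₁ H e ≠ χ.face₂ H e → Label.merge .one .one = some (S'.lab (D.arc e 0))) ∧
      (χ.face₁ H e = χ.face₂ H e →
        (S'.lab (D.arc e 0), S'.lab (D.arc e 2)) ∈ Label.split .one) := by
    rw [isTerm_iff, ← hH]
    exact and_iff_right he
  rw [edgeMap_delta, if_congr hT rfl rfl]
  unfold factor
  by_cases hS' : S'.H = H'
  swap
  · rw [if_neg fun h => hS' h.1]
    have h1 : ∀ a, S'.setLabel a .one ≠ unit χ H' := fun a h' => hS' (congrArg (·.H) h')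
    have h2 : S' ≠ unit χ H' := fun h' => hS' (congrArg (·.H) h')
    split_ifs
    · simp [mulX_apply, delta_apply, h1]
    · simp [delta_apply, h2]
  subst hS'
  by_cases hf : χ.face₁ H e = χ.face₂ H e
  · have hf' : χ.face₁ S'.H e ≠ χ.face₂ S'.H e := by
      rw [Ne, χ.face₁_eq_face₂_toggle ht]; exact not_not.2 hf
    -- `S'` has exactly one label `x`, on the circle of the end `k` of `e`
    have key : ∀ k l, (k = 0 ∧ l = 2 ∨ k = 2 ∧ l = 0) → (S'.setLabel (D.arc e k) .one =
        unit χ S'.H ↔ (∀ a, χ.face H a ≠ χ.face₁ H e → χ.face H a ≠ χ.face₂ H e →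
          S'.lab a = .one) ∧ S'.lab (D.arc e l) = .one) := by
      intro k l hkl
      have hkl' : χ.face S'.H (D.arc e l) ≠ χ.face S'.H (D.arc e k) := by
        rcases hkl with ⟨rfl, rfl⟩ | ⟨rfl, rfl⟩
        · exact hf'.symm
        · exact hf'
      have hun : ∀ a, χ.face S'.H a ≠ χ.face S'.H (D.arc e k) →
          χ.face S'.H a ≠ χ.face S'.H (D.arc e l) →
            χ.face H a ≠ χ.face₁ H e ∧ χ.face H a ≠ χ.face₂ H e := by
        intro a h1 h2
        rw [← not_or, ← ht.touched_iff]
        rcases hkl with ⟨rfl, rfl⟩ | ⟨rfl, rfl⟩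
        · exact not_or.2 ⟨h1, h2⟩
        · exact not_or.2 ⟨h2, h1⟩
      constructor
      · intro h
        have h1 : ∀ a, (S'.setLabel (D.arc e k) .one).lab a = .one := fun a => by rw [h]; rfl
        refine ⟨fun a ha1 ha2 => ?_, by rw [← h1 (D.arc e l), lab_setLabel_of_ne _ hkl']⟩
        rw [← h1 a, lab_setLabel_of_ne]
        have h3 : ¬ (χ.face S'.H a = χ.face₁ S'.H e ∨ χ.face S'.H a = χ.face₂ S'.H e) := by
          rw [ht.touched_iff]; exact not_or.2 ⟨ha1, ha2⟩
        rw [not_or] at h3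
        rcases hkl with ⟨rfl, rfl⟩ | ⟨rfl, rfl⟩
        · exact h3.1
        · exact h3.2
      · rintro ⟨h1, h2⟩
        refine ext_lab rfl fun a => ?_
        rw [lab_unit]
        by_cases hak : χ.face S'.H a = χ.face S'.H (D.arc e k)
        · exact lab_setLabel_of_eq _ hak
        · rw [lab_setLabel_of_ne _ hak]
          by_cases hal : χ.face S'.H a = χ.face S'.H (D.arc e l)
          · rw [lab_congr hal, h2]
          · exact h1 a (hun a hak hal).1 (hun a hak hal).2
    rw [if_pos hf, LinearMap.add_apply, Pi.add_apply, mulX_apply, mulX_apply, delta_apply,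
      delta_apply, key 0 2 (by simp), key 2 0 (by simp)]
    simp only [hf, ne_eq, not_true_eq_false, false_imp_iff, true_imp_iff, true_and, Label.split]
    cases S'.lab (D.arc e 0) <;> cases S'.lab (D.arc e 2) <;> simp
  · have hf' : χ.face₁ S'.H e = χ.face₂ S'.H e := (χ.face₁_eq_face₂_toggle ht).2 hf
    rw [if_neg hf, LinearMap.id_apply, delta_apply]
    refine if_congr ?_ rfl rfl
    simp only [hf, ne_eq, not_false_eq_true, false_imp_iff, true_imp_iff, and_true, true_and,
      Label.merge, Option.some.injEq]
    constructor
    · rintro ⟨h1, h2⟩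
      refine ext_lab rfl fun a => ?_
      rw [lab_unit]
      by_cases hta : χ.face H a = χ.face₁ H e ∨ χ.face H a = χ.face₂ H e
      · have h3 := (ht.touched_iff a).2 hta
        rw [← hf', or_self] at h3
        rw [lab_congr h3]
        exact h2.symm
      · rw [not_or] at hta
        exact h1 a hta.1 hta.2
    · intro h
      rw [h]
      exact ⟨fun _ _ _ => rfl, rfl⟩

end Finite

end ConnectedLinkDiagram.Checkerboard.EnhancedSubgraph

namespace ConnectedLinkDiagram.Checkerboard

variable {Arc C : Type*} {D : ConnectedLinkDiagram Arc C} {χ : D.Checkerboard}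

theorem exists_isToggle (H : Finset C) (e : C) : ∃ H', IsToggle H H' e := by
  classical
  by_cases he : e ∈ H
  · exact ⟨H.erase e, fun c hc => by simp [hc], by simp [he]⟩
  · exact ⟨insert e H, isToggle_insert he⟩

theorem exists_isToggle_square {H He Hf : Finset C} {e f : C} (hef : e ≠ f)
    (he : IsToggle H He e) (hf : IsToggle H Hf f) :
    ∃ K, IsToggle He K f ∧ IsToggle Hf K e := by
  obtain ⟨K, hK⟩ := exists_isToggle He f
  refine ⟨K, hK, fun c hc => ?_, ?_⟩
  · by_cases hcf : c = f
    · subst hcf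
      rw [hK.2, hf.2, he.1 c hc]
    · rw [hK.1 c hcf, hf.1 c hcf, he.1 c hc]
  · rw [hK.1 e hef, he.2, hf.1 e hef]

/-! ### Two changes of smoothings commute -/

section Square

variable [Finite Arc] {H He Hf K : Finset C} {e f : C}

/-- If merges happen first in both orders, the two circles at `e` in the final state are also the
two circles at `f`. -/
theorem faces_eq_of_merge_split (he : IsToggle H He e)
    (hK : IsToggle He K f) (hK' : IsToggle Hf K e)
    (h1 : χ.face₁ H e ≠ χ.face₂ H e) (h2 : χ.face₁ He f = χ.face₂ He f)
    (h3 : χ.face₁ H f ≠ χ.face₂ H f) (h4 : χ.face₁ Hf e = χ.face₂ Hf e) :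
    (χ.face₁ K e = χ.face₁ K f ∧ χ.face₂ K e = χ.face₂ K f) ∨
      (χ.face₁ K e = χ.face₂ K f ∧ χ.face₂ K e = χ.face₁ K f) := by
  have h5 : χ.face₁ K e ≠ χ.face₂ K e := by
    rw [Ne, χ.face₁_eq_face₂_toggle hK']; exact not_not.2 h4
  have h1' : χ.face₁ He e = χ.face₂ He e := (χ.face₁_eq_face₂_toggle he).2 h1
  have hj := χ.isJoin_face he h1
  -- After the change of `e`, all the arcs in question lie on one circle.
  have h6 : χ.face He (D.arc e 0) = χ.face₁ He f := by
    rcases (hj (D.arc f 0) (D.arc f 2)).1 h2 with h | ⟨h, -⟩ | ⟨h, -⟩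
    · exact (h3 h).elim
    · exact ((hj _ _).2 (Or.inl h)).symm
    · exact h1'.trans ((hj _ _).2 (Or.inl h)).symm
  have h7 := hK.face_eq_or_of_split h6
  have h8 := hK.face_eq_or_of_split (χ := χ) (a := D.arc e 2) (h1'.symm.trans h6)
  change χ.face₁ K e = _ ∨ χ.face₁ K e = _ at h7
  change χ.face₂ K e = _ ∨ χ.face₂ K e = _ at h8
  rcases h7 with h7 | h7 <;> rcases h8 with h8 | h8
  · exact (h5 (h7.trans h8.symm)).elim
  · exact Or.inl ⟨h7, h8⟩
  · exact Or.inr ⟨h7, h8⟩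
  · exact (h5 (h7.trans h8.symm)).elim

/-- If splits happen first in both orders, all arcs at `e` and `f` lie on the same circle in the
final state. -/
theorem faces_eq_of_split_merge (he : IsToggle H He e)
    (hK : IsToggle He K f) (hK' : IsToggle Hf K e)
    (h1 : χ.face₁ H e = χ.face₂ H e) (h2 : χ.face₁ He f ≠ χ.face₂ He f)
    (h3 : χ.face₁ H f = χ.face₂ H f) (h4 : χ.face₁ Hf e ≠ χ.face₂ Hf e) :
    χ.face₁ K e = χ.face₁ K f ∧ χ.face₂ K e = χ.face₂ K f := by
  have h5 : χ.face₁ K e = χ.face₂ K e := (χ.face₁_eq_face₂_toggle hK').2 h4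
  have h6 : χ.face₁ K f = χ.face₂ K f := (χ.face₁_eq_face₂_toggle hK).2 h2
  have h1' : χ.face₁ He e ≠ χ.face₂ He e := by
    rw [Ne, χ.face₁_eq_face₂_toggle he]; exact not_not.2 h1
  have hle : ∀ {a b}, χ.face He a = χ.face He b → χ.face K a = χ.face K b :=
    fun h => (χ.isJoin_face hK h2 _ _).2 (Or.inl h)
  have h7 : χ.face₁ K e = χ.face₁ K f := by
    rcases (χ.isJoin_face he.symm h1' (D.arc f 0) (D.arc f 2)).1 h3 with h | ⟨h, -⟩ | ⟨h, -⟩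
    · exact (h2 h).elim
    · exact (hle h).symm
    · exact h5.trans (hle h).symm
  exact ⟨h7, h5.symm.trans (h7.trans h6)⟩

open Classical in
theorem card_face_toggle_eq (h : IsToggle H K e) :
    (Nat.card (χ.Face K) : ℤ) = Nat.card (χ.Face H) +
      if χ.face₁ H e = χ.face₂ H e then 1 else -1 := by
  split_ifs with hf
  · have := χ.card_face_toggle h.symm (by rw [Ne, χ.face₁_eq_face₂_toggle h]; exact not_not.2 hf)
    omega
  · have := χ.card_face_toggle h hf
    omega

end Square

namespace EnhancedSubgraph

theorem mem_aEdges_unit_toggle {H H' : Finset C} {e f : C} (hef : e ≠ f) (h : IsToggle H H' e) :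
    f ∈ (unit χ H').aEdges ↔ f ∈ (unit χ H).aEdges := by
  rw [mem_aEdges_iff, mem_aEdges_iff]
  change (f ∈ H' ↔ _) ↔ (f ∈ H ↔ _)
  rw [h.1 f hef.symm]

/-- The two ways around a square of states have the same factors on the state with all labels `1`.
The numbers of circles leave six cases: two splits, two merges, a split and a merge that do not
interact (in either order), and the two cases in which each crossing splits (or each one merges)
circles if it is changed first, and does the opposite if it is changed second. -/
theorem factor_square [Finite Arc] {H He Hf K : Finset C} {e f : C} (he : IsToggle H He e)
    (hf : IsToggle H Hf f) (hK : IsToggle He K f) (hK' : IsToggle Hf K e) :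
    factor χ e H (factor χ f He (delta (unit χ K))) =
      factor χ f H (factor χ e Hf (delta (unit χ K))) := by
  have c1 := card_face_toggle_eq (χ := χ) he
  have c2 := card_face_toggle_eq (χ := χ) hK
  have c3 := card_face_toggle_eq (χ := χ) hf
  have c4 := card_face_toggle_eq (χ := χ) hK'
  unfold factor
  by_cases h1 : χ.face₁ H e = χ.face₂ H e <;> by_cases h2 : χ.face₁ He f = χ.face₂ He f <;>
    by_cases h3 : χ.face₁ H f = χ.face₂ H f <;> by_cases h4 : χ.face₁ Hf e = χ.face₂ Hf e <;>
    simp only [h1, h2, h3, h4, if_true, if_false] at c1 c2 c3 c4 ⊢ <;>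
    first | omega | skip
  · simp only [LinearMap.add_apply, map_add, mulX_comm (D.arc f 0), mulX_comm (D.arc f 2)]
    abel
  · obtain ⟨h5, h6⟩ := faces_eq_of_split_merge he hK hK' h1 h2 h3 h4
    simp only [LinearMap.id_apply, LinearMap.add_apply]
    rw [mulX_delta_unit_congr h5, mulX_delta_unit_congr h6]
  · rfl
  · rfl
  · simp only [LinearMap.id_apply, LinearMap.add_apply]
    rcases faces_eq_of_merge_split he hK hK' h1 h2 h3 h4 with ⟨h5, h6⟩ | ⟨h5, h6⟩
    · rw [mulX_delta_unit_congr h5, mulX_delta_unit_congr h6]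
    · rw [mulX_delta_unit_congr h5, mulX_delta_unit_congr h6, add_comm]

section Complex

variable [Finite Arc] [Finite C]

theorem edgeMap_comm_unit {e f : C} (hef : e ≠ f) (H : Finset C) :
    edgeMap χ f (edgeMap χ e (delta (unit χ H))) =
      edgeMap χ e (edgeMap χ f (delta (unit χ H))) := by
  obtain ⟨He, he⟩ := exists_isToggle H e
  obtain ⟨Hf, hf⟩ := exists_isToggle H f
  obtain ⟨K, hK, hK'⟩ := exists_isToggle_square hef he hf
  by_cases hea : e ∈ (unit χ H).aEdges
  · have hea' : e ∈ (unit χ Hf).aEdges := (mem_aEdges_unit_toggle hef.symm hf).2 hea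
    by_cases hfa : f ∈ (unit χ H).aEdges
    · have hfa' : f ∈ (unit χ He).aEdges := (mem_aEdges_unit_toggle hef he).2 hfa
      rw [edgeMap_unit hea he, edgeMap_unit hfa hf, edgeMap_factor, edgeMap_factor,
        edgeMap_unit hfa' hK, edgeMap_unit hea' hK']
      exact factor_square he hf hK hK'
    · have hfa' : f ∉ (unit χ He).aEdges := mt (mem_aEdges_unit_toggle hef he).1 hfa
      rw [edgeMap_unit hea he, edgeMap_factor, edgeMap_unit_of_notMem hfa',
        edgeMap_unit_of_notMem hfa, map_zero, map_zero]
  · have hea' : e ∉ (unit χ Hf).aEdges := mt (mem_aEdges_unit_toggle hef.symm hf).1 hea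
    by_cases hfa : f ∈ (unit χ H).aEdges
    · rw [edgeMap_unit hfa hf, edgeMap_factor, edgeMap_unit_of_notMem hea',
        edgeMap_unit_of_notMem hea, map_zero, map_zero]
    · rw [edgeMap_unit_of_notMem hea, edgeMap_unit_of_notMem hfa, map_zero, map_zero]

/-- Without signs, the maps of two crossings commute. -/
theorem edgeMap_comm {e f : C} (hef : e ≠ f) (φ : χ.EnhancedSubgraph → ℤ) :
    edgeMap χ f (edgeMap χ e φ) = edgeMap χ e (edgeMap χ f φ) := by
  classical
  -- The state space is generated from the states with all labels `1` by multiplication.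
  have key : ∀ n : ℕ, ∀ S : χ.EnhancedSubgraph, {F | S.ε F = .x}.ncard = n →
      edgeMap χ f (edgeMap χ e (delta S)) = edgeMap χ e (edgeMap χ f (delta S)) := by
    intro n
    induction n with
    | zero =>
      intro S hS
      rw [Set.ncard_eq_zero (Set.toFinite _)] at hS
      have h : S = unit χ S.H := by
        refine ext_lab rfl fun a => ?_
        cases h : S.lab a
        · rfl
        · exact (Set.eq_empty_iff_forall_notMem.1 hS (χ.face S.H a) h).elim
      rw [h]
      exact edgeMap_comm_unit hef S.H
    | succ n ih =>
      intro S hS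
      obtain ⟨F, hF⟩ : {F | S.ε F = .x}.Nonempty := by
        rw [← Set.ncard_pos (Set.toFinite _)]; omega
      obtain ⟨a, rfl⟩ := Quot.exists_rep F
      have ha : S.lab a = .x := hF
      have h1 : {F | (S.setLabel a .one).ε F = .x} = {F | S.ε F = .x} \ {χ.face S.H a} := by
        ext F
        obtain ⟨b, rfl⟩ := Quot.exists_rep F
        change (S.setLabel a .one).lab b = .x ↔ S.lab b = .x ∧ χ.face S.H b ≠ χ.face S.H a
        by_cases hb : χ.face S.H b = χ.face S.H a
        · rw [lab_setLabel_of_eq _ hb]; simp [hb]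
        · rw [lab_setLabel_of_ne _ hb]; simp [hb]
      have h2 : {F | (S.setLabel a .one).ε F = .x}.ncard = n := by
        have hF' : χ.face S.H a ∈ {F | S.ε F = .x} := hF
        exact (congrArg Set.ncard h1).trans ((Set.ncard_sdiff_singleton_of_mem hF').trans
          (by rw [hS, Nat.add_sub_cancel]))
      rw [← mulX_delta ha, edgeMap_mulX, edgeMap_mulX, edgeMap_mulX, edgeMap_mulX, ih _ h2]
  have h : edgeMap χ f ∘ₗ edgeMap χ e = edgeMap χ e ∘ₗ edgeMap χ f := by
    refine LinearMap.pi_ext' fun S => LinearMap.ext_ring ?_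
    have h1 := key _ S rfl
    simpa [delta] using h1
  exact LinearMap.congr_fun h φ

end Complex

end EnhancedSubgraph

/-! ### The reduced Khovanov complex -/

section ReducedKhovanov

open EnhancedSubgraph

theorem signExponent_toggle [Finite C] [LinearOrder C] {S S' : χ.EnhancedSubgraph} {e f : C}
    (h : S.IsTerm S' e) :
    S'.signExponent f = S.signExponent f + if e < f then 1 else 0 := by
  have h1 : ∀ S : χ.EnhancedSubgraph, S.signExponent f = {g | g < f ∧ g ∉ S.aEdges}.ncard :=
    fun S => rfl
  rw [h1, h1]
  have h2 := notMem_aEdges_of_toggle h.toggle h.1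
  split_ifs with hlt
  · have h3 : {g | g < f ∧ g ∉ S'.aEdges} = insert e {g | g < f ∧ g ∉ S.aEdges} := by
      ext g
      simp only [Set.mem_ofPred_eq, Set.mem_insert_iff, h2]
      by_cases hg : g = e
      · simp [hg, hlt]
      · simp [hg]
    have h4 : e ∉ {g | g < f ∧ g ∉ S.aEdges} := fun h' => h'.2 h.1
    rw [h3, Set.ncard_insert_of_notMem h4]
  · have h3 : {g | g < f ∧ g ∉ S'.aEdges} = {g | g < f ∧ g ∉ S.aEdges} := by
      ext g
      simp only [Set.mem_ofPred_eq, h2]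
      by_cases hg : g = e
      · simp [hg, hlt]
      · simp [hg]
    rw [h3, add_zero]

variable [Finite Arc] [Fintype C] [LinearOrder C] (χ) (dot : Arc)

theorem isHomogeneous_reducedKhovanov :
    (χ.reducedKhovanov dot).IsHomogeneous 1 (Matrix.of (χ.reducedKhovanov dot).inc) := by
  classical
  intro S S' h
  obtain ⟨e, -, he⟩ := Finset.exists_ne_zero_of_sum_ne_zero h
  have h1 : S.1.IsTerm S'.1 e := by
    by_contra h1
    exact he (if_neg h1)
  exact ⟨iDeg_of_toggle h1.toggle h1.1, jDeg_of_isTerm h1⟩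

variable {χ}

/-- With signs, the maps of two crossings anticommute, and the map of one crossing squares to zero.
-/
theorem inc_sum_eq_zero [Fintype χ.EnhancedSubgraph] (S S'' : χ.EnhancedSubgraph) :
    ∑ S', S.inc S' * S'.inc S'' = 0 := by
  classical
  set n : C → C → ℤ := fun e f => edgeMap χ f (edgeMap χ e (delta S)) S'' with hn
  have hn' : ∀ e f, n e f =
      ∑ S', if S.IsTerm S' e then (if S'.IsTerm S'' f then 1 else 0 : ℤ) else 0 := by
    intro e f
    rw [hn]
    dsimp only
    rw [edgeMap_apply]
    refine Finset.sum_congr rfl fun S' _ => ?_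
    rw [edgeMap_delta]
    split_ifs <;> rfl
  have hself : ∀ e, n e e = 0 := by
    intro e
    rw [hn']
    refine Finset.sum_eq_zero fun S' _ => ?_
    split_ifs with h1 h2
    · exact ((notMem_aEdges_of_toggle h1.toggle h1.1 e).2 (Or.inl rfl) h2.1).elim
    · rfl
    · rfl
  set σ : C → C → ℤ := fun e f =>
    (-1) ^ S.signExponent e * (-1) ^ (S.signExponent f + if e < f then 1 else 0) with hσ
  have h1 : ∑ S', S.inc S' * S'.inc S'' = ∑ e, ∑ f, σ e f * n e f := by
    have h2 : ∀ S', S.inc S' * S'.inc S'' = ∑ e, ∑ f, (σ e f *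
        if S.IsTerm S' e then (if S'.IsTerm S'' f then 1 else 0 : ℤ) else 0) := by
      intro S'
      unfold inc
      rw [Finset.sum_mul_sum]
      refine Finset.sum_congr rfl fun e _ => Finset.sum_congr rfl fun f _ => ?_
      split_ifs with h3 h4
      · rw [signExponent_toggle h3, hσ, mul_one]
      all_goals simp
    rw [Finset.sum_congr rfl fun S' _ => h2 S', Finset.sum_comm]
    refine Finset.sum_congr rfl fun e _ => ?_
    rw [Finset.sum_comm]
    refine Finset.sum_congr rfl fun f _ => ?_
    rw [hn', Finset.mul_sum]
  have h2 : ∀ e f, σ e f * n e f = -(σ f e * n f e) := by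
    intro e f
    by_cases hef : e = f
    · subst hef; rw [hself]; simp
    · have h3 : n e f = n f e := congrFun (edgeMap_comm hef (delta S)) S''
      rw [h3, hσ]
      dsimp only
      rcases lt_or_gt_of_ne hef with h | h
      · rw [if_pos h, if_neg (not_lt.2 h.le), pow_succ]; ring
      · rw [if_pos h, if_neg (not_lt.2 h.le), pow_succ]; ring
  have h3 : ∑ e, ∑ f, σ e f * n e f = -∑ e, ∑ f, σ e f * n e f := by
    conv_lhs => rw [Finset.sum_comm]
    simp only [← Finset.sum_neg_distrib]
    exact Finset.sum_congr rfl fun e _ => Finset.sum_congr rfl fun f _ => h2 f e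
  rw [h1]
  linarith

theorem isComplex_reducedKhovanov : (χ.reducedKhovanov dot).IsComplex := by
  classical
  intro i j
  have := Fintype.ofFinite χ.EnhancedSubgraph
  have hsq : Matrix.of (χ.reducedKhovanov dot).inc * Matrix.of (χ.reducedKhovanov dot).inc = 0 := by
    ext S S''
    rw [Matrix.mul_apply]
    change ∑ S' : χ.ReducedSubgraph dot, S.1.inc S'.1 * S'.1.inc S''.1 = 0
    rw [← inc_sum_eq_zero S.1 S''.1]
    refine Finset.sum_of_injOn Subtype.val Subtype.val_injective.injOn (by simp) ?_
      fun _ _ => rfl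
    -- A term with label `x` at the dotted circle does not contribute to terms with label `1` there.
    intro S' _ hS'
    have hx : S'.lab dot = .x := by
      cases h : S'.lab dot
      · exact (hS' ⟨⟨S', h⟩, by simp, rfl⟩).elim
      · rfl
    have h0 : S'.inc S''.1 = 0 := by
      refine Finset.sum_eq_zero fun e _ => if_neg fun h => ?_
      have h1 : S''.1.lab dot = .one := S''.2
      rw [h.lab_eq_x hx] at h1
      cases h1
    rw [h0, mul_zero]
  have hK := χ.isHomogeneous_reducedKhovanov dot
  have h := blockMap_comp (a := (Subtype.val : (χ.reducedKhovanov dot).Basis (i - 1) j → _))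
    (b := (Subtype.val : (χ.reducedKhovanov dot).Basis i j → _))
    (c := (Subtype.val : (χ.reducedKhovanov dot).Basis (i + 1) j → _)) Subtype.val_injective
    (B := Matrix.of (χ.reducedKhovanov dot).inc) (B' := Matrix.of (χ.reducedKhovanov dot).inc)
    fun x u _ hx _ => by
      have h1 := hK _ _ hx
      exact ⟨⟨u, by rw [h1.1, x.2.1]; ring, by rw [h1.2, x.2.2]⟩, rfl⟩
  rw [hsq] at h
  exact h.trans (blockMap_ext fun _ _ => rfl).symm

end ReducedKhovanov

end ConnectedLinkDiagram.Checkerboard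

/-! ### Leaves of rooted forests -/

section Forest

variable {C X : Type*} {a b : C → X}

/-- A multigraph, given by the ends `a e` and `b e` of its edges `e ∈ L`, is a forest: no edge lies
on a cycle. -/
def IsForest (a b : C → X) (L : Set C) : Prop := ∀ e ∈ L, ¬ EdgeConn a b (L \ {e}) (a e) (b e)

/-- Every edge of `R` lies in the component of the root. -/
def IsRooted (a b : C → X) (root : X) (R : Set C) : Prop := ∀ e ∈ R, EdgeConn a b R (a e) root

/-- `v`, different from the root, is a vertex whose only edge in `R` is `e`. -/
def IsPendant (a b : C → X) (root : X) (R : Set C) (e : C) (v : X) : Prop :=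
  e ∈ R ∧ v ≠ root ∧ (v = a e ∨ v = b e) ∧ ∀ e' ∈ R, (v = a e' ∨ v = b e') → e' = e

theorem IsForest.mono {L R : Set C} (hL : IsForest a b L) (h : R ⊆ L) : IsForest a b R :=
  fun e he hc => hL e (h he) (hc.mono (Set.sdiff_subset_sdiff_left h))

theorem EdgeConn.refl (R : Set C) (x : X) : EdgeConn a b R x x :=
  (edgeConn_equivalence a b R).refl x

theorem EdgeConn.symm {R : Set C} {x y : X} (h : EdgeConn a b R x y) : EdgeConn a b R y x :=
  (edgeConn_equivalence a b R).symm h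

theorem EdgeConn.trans {R : Set C} {x y z : X} (h : EdgeConn a b R x y) (h' : EdgeConn a b R y z) :
    EdgeConn a b R x z := (edgeConn_equivalence a b R).trans h h'

/-- A vertex without edges is isolated. -/
theorem EdgeConn.eq_of_isolated {R : Set C} {v x : X} (hv : ∀ e ∈ R, v ≠ a e ∧ v ≠ b e)
    (h : EdgeConn a b R v x) : x = v := by
  have h1 : Equivalence fun x y : X => x = v ↔ y = v :=
    ⟨fun _ => Iff.rfl, fun h => h.symm, fun h h' => h.trans h'⟩
  have h2 := h.of_equivalence h1 fun e he => by
    have := hv e he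
    exact ⟨fun h => (this.1 h.symm).elim, fun h => (this.2 h.symm).elim⟩
  exact h2.1 rfl

/-- A forest with an edge has a leaf other than a given vertex. -/
theorem IsForest.exists_isPendant (R : Finset C) (hR : IsForest a b (R : Set C))
    (hne : R.Nonempty) (root : X) : ∃ e v, IsPendant a b root (R : Set C) e v := by
  classical
  induction R using Finset.strongInduction generalizing root with
  | H R ih =>
    obtain ⟨e, he⟩ := hne
    have hsplit := hR e he
    -- After the removal of `e`, one end `w` of `e` is separated from the root and from the other
    -- end `u`. The edges that stay connected to `w` form a smaller forest, with root `w`.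
    obtain ⟨w, u, hw, hwr, hwu⟩ : ∃ w u, (w = a e ∧ u = b e ∨ w = b e ∧ u = a e) ∧
        ¬ EdgeConn a b ((R : Set C) \ {e}) w root ∧ ¬ EdgeConn a b ((R : Set C) \ {e}) w u := by
      by_cases h : EdgeConn a b ((R : Set C) \ {e}) (a e) root
      · exact ⟨b e, a e, Or.inr ⟨rfl, rfl⟩, fun h' => hsplit (h.trans h'.symm),
          fun h' => hsplit h'.symm⟩
      · exact ⟨a e, b e, Or.inl ⟨rfl, rfl⟩, h, hsplit⟩
    have hends : ∀ x, (x = a e ∨ x = b e) ↔ (x = w ∨ x = u) := by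
      intro x
      rcases hw with ⟨rfl, rfl⟩ | ⟨rfl, rfl⟩
      · rfl
      · exact or_comm
    set R' : Finset C := R.filter fun f => f ≠ e ∧ EdgeConn a b ((R : Set C) \ {e}) (a f) w with hR'
    have hsub : R' ⊆ R := Finset.filter_subset _ _
    have hmem : ∀ f ∈ R, ∀ x, EdgeConn a b ((R : Set C) \ {e}) x w → f ≠ e →
        (x = a f ∨ x = b f) → f ∈ R' := by
      rintro f hf x hx hfe (rfl | rfl)
      · exact Finset.mem_filter.2 ⟨hf, hfe, hx⟩
      · exact Finset.mem_filter.2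
          ⟨hf, hfe, (edgeConn_ends (H := (R : Set C) \ {e}) ⟨hf, hfe⟩).trans hx⟩
    by_cases hne' : R'.Nonempty
    · have hlt : R' ⊂ R := Finset.ssubset_iff_subset_ne.2
        ⟨hsub, fun h => (Finset.mem_filter.1 (h ▸ he : e ∈ R')).2.1 rfl⟩
      obtain ⟨f, v, hf, hvw, hvf, hv⟩ := ih R' hlt (hR.mono (Finset.coe_subset.2 hsub)) hne' w
      have hf' := Finset.mem_filter.1 (Finset.mem_coe.1 hf)
      have hvw' : EdgeConn a b ((R : Set C) \ {e}) v w := by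
        rcases hvf with rfl | rfl
        · exact hf'.2.2
        · exact (edgeConn_ends (H := (R : Set C) \ {e}) ⟨hf'.1, hf'.2.1⟩).symm.trans hf'.2.2
      refine ⟨f, v, hf'.1, fun h => hwr (h ▸ hvw'.symm), hvf, fun g hg hvg => ?_⟩
      by_cases hge : g = e
      · subst hge
        rcases (hends v).1 hvg with rfl | rfl
        · exact (hvw rfl).elim
        · exact (hwu hvw'.symm).elim
      · exact hv g (hmem g hg v hvw' hge hvg) hvg
    · refine ⟨e, w, he, fun h => hwr (h ▸ EdgeConn.refl _ _), (hends w).2 (Or.inl rfl),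
        fun g hg hwg => ?_⟩
      by_contra hge
      exact hne' ⟨g, hmem g hg w (EdgeConn.refl _ _) hge hwg⟩

section Pendant

variable {root : X} {R : Set C} {e : C} {v : X}

theorem IsRooted.conn_of_incident (hR : IsRooted a b root R) (he : e ∈ R) (hv : v = a e ∨ v = b e) :
    EdgeConn a b R v root := by
  rcases hv with rfl | rfl
  · exact hR e he
  · exact (edgeConn_ends he).symm.trans (hR e he)

/-- The end of the leaf edge that is not the root is determined by the edge. -/
theorem IsPendant.unique (hR : IsRooted a b root R) {v' : X} (h : IsPendant a b root R e v)
    (h' : IsPendant a b root R e v') : v = v' := by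
  by_contra hne
  have hends : ∀ x, (x = a e ∨ x = b e) → x = v ∨ x = v' := by
    intro x hx
    rcases h.2.2.1 with h1 | h1 <;> rcases h'.2.2.1 with h2 | h2 <;> rcases hx with h3 | h3 <;>
      simp_all
  have h1 : Equivalence fun x y : X => (x = v ∨ x = v') ↔ (y = v ∨ y = v') :=
    ⟨fun _ => Iff.rfl, fun h => h.symm, fun h h' => h.trans h'⟩
  have h2 := (hR.conn_of_incident h.1 h.2.2.1).of_equivalence h1 fun f hf => by
    have key : ∀ x, (x = a f ∨ x = b f) → (x = v ∨ x = v') → f = e := by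
      rintro x hx (rfl | rfl)
      · exact h.2.2.2 f hf hx
      · exact h'.2.2.2 f hf hx
    constructor
    · intro hx
      exact hends _ (key _ (Or.inl rfl) hx ▸ Or.inr rfl)
    · intro hx
      exact hends _ (key _ (Or.inr rfl) hx ▸ Or.inl rfl)
  rcases h2.1 (Or.inl rfl) with h3 | h3
  · exact h.2.1 h3.symm
  · exact h'.2.1 h3.symm

theorem IsPendant.eq_of_conn (h : IsPendant a b root R e v) {R' : Set C} (hR' : R' ⊆ R)
    (he : e ∉ R') {x : X} (hx : EdgeConn a b R' v x) : x = v :=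
  hx.eq_of_isolated fun f hf => by
    have : ¬ (v = a f ∨ v = b f) := fun hvf => he (h.2.2.2 f (hR' hf) hvf ▸ hf)
    exact not_or.1 this

/-- Removing a leaf disconnects from the root exactly its end. -/
theorem IsPendant.conn_root_iff (h : IsPendant a b root R e v) (x : X) :
    EdgeConn a b (R \ {e}) x root ↔ EdgeConn a b R x root ∧ x ≠ v := by
  have hiso : ∀ {x}, EdgeConn a b (R \ {e}) v x → x = v :=
    fun hx => h.eq_of_conn (R' := R \ {e}) Set.sdiff_subset (fun h => h.2 rfl) hx
  constructor
  · refine fun hx => ⟨hx.mono Set.sdiff_subset, ?_⟩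
    rintro rfl
    exact h.2.1 (hiso hx).symm
  · rintro ⟨hx, hxv⟩
    have hj := edgeConn_insert (a := a) (b := b) (H := R \ {e}) e
    rw [Set.insert_sdiff_singleton, Set.insert_eq_of_mem h.1] at hj
    have hve := h.2.2.1
    rcases (hj x root).1 hx with hx | ⟨hx, hx'⟩ | ⟨hx, hx'⟩
    · exact hx
    · rcases hve with rfl | rfl
      · exact (hxv (hiso hx.symm)).elim
      · exact (h.2.1 (hiso hx').symm).elim
    · rcases hve with rfl | rfl
      · exact (h.2.1 (hiso hx').symm).elim
      · exact (hxv (hiso hx.symm)).elim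

theorem IsPendant.isRooted_sdiff (h : IsPendant a b root R e v) (hR : IsRooted a b root R) :
    IsRooted a b root (R \ {e}) := by
  rintro f ⟨hf, hfe⟩
  refine (h.conn_root_iff _).2 ⟨hR f hf, ?_⟩
  rintro rfl
  exact hfe (h.2.2.2 f hf (Or.inl rfl))

end Pendant

end Forest

namespace ConnectedLinkDiagram.Checkerboard

variable {Arc C : Type*} {D : ConnectedLinkDiagram Arc C} (χ : D.Checkerboard)

/-! ### Activities and twisted unknots -/

/-- The closure operator of the cycle matroid of the Tait graph. -/
abbrev cycleClosure (H : Set C) : Set C := {e | χ.EndsReachable H e}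

/-- As the diagram is connected, so is its Tait graph, and a set of edges connects all vertices iff
its closure contains all edges. -/
theorem isSpanningTree_iff (T : Finset C) :
    χ.IsSpanningTree T ↔ IsMatroidBase χ.cycleClosure (T : Set C) := by
  refine and_congr_left fun _ => ⟨fun h e r s hrs => ?_, fun h r hr s hs => ?_⟩
  · exact h r hrs.left_mem s hrs.right_mem
  · have hsurj : ∀ r ∈ χ.taitGraph.vertexSet, ∃ a, χ.sideRegion true a = r := by
      intro r hr
      obtain ⟨⟨a, side⟩, rfl⟩ := Quot.exists_rep r
      exact ⟨a, χ.sideRegion_eq hr⟩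
    obtain ⟨a, rfl⟩ := hsurj r hr
    obtain ⟨b, rfl⟩ := hsurj s hs
    exact EdgeConn.of_equivalence (edgeConn_equivalence χ.end₁ χ.end₂ (T : Set C))
      (fun e _ => (χ.endsReachable_iff _ e).1 (h e)) (χ.sameComponent_univ a b)

section Linear

theorem res_eq_A_iff (H : Finset C) (c : C) :
    χ.res H c = .A ↔ (χ.positive c = true ↔ c ∈ H) := by
  unfold res
  split_ifs with h <;> simp [h]

theorem treeSmoothing_eq_A_iff [LinearOrder C] (T : Finset C) (c : C) :
    χ.treeSmoothing T c = .A ↔ (χ.positive c = true ↔ (c ∈ T ↔ ¬ χ.IsLive T c)) := by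
  unfold treeSmoothing activity
  by_cases h1 : c ∈ T <;> by_cases h2 : χ.IsLive T c <;> cases h3 : χ.positive c <;>
    simp [h1, h2, Activity.smoothing]

variable [Fintype C] [LinearOrder C] {T : Finset C}

variable {χ} in
theorem isLive_iff (hT : χ.IsSpanningTree T) (e : C) :
    χ.IsLive T e ↔ ExtActive χ.cycleClosure (T : Set C) e ∨
      IntActive χ.cycleClosure (T : Set C) e := by
  have hcl := χ.isMatroidClosure_endsReachable
  have hT' := (χ.isSpanningTree_iff T).1 hT
  unfold IsLive
  by_cases he : e ∈ T
  · have h1 := not_extActive_of_mem_base hcl hT' (Finset.mem_coe.2 he)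
    have h2 := intActive_iff_of_mem_base hcl hT' (Finset.mem_coe.2 he)
    simp only [he, not_true_eq_false, false_and, or_false, true_and]
    rw [or_iff_right h1, h2]
    rfl
  · have h1 := not_intActive_of_notMem_base hcl hT' (mt Finset.mem_coe.1 he)
    have h2 := extActive_iff_of_notMem_base hcl hT' (mt Finset.mem_coe.1 he)
    simp only [he, not_false_eq_true, false_and, false_or, true_and]
    rw [or_iff_left h1, h2]
    simp only [cyc, Set.mem_ofPred_eq, and_imp]
    rfl

theorem mem_treeState_iff (c : C) : c ∈ χ.treeState T ↔ (c ∈ T ↔ ¬ χ.IsLive T c) := by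
  unfold treeState
  rw [Finset.mem_filter, treeSmoothing_eq_A_iff]
  have := Finset.mem_univ c
  tauto

theorem _root_.Smoothing.eq_iff_eq_A {s t : Smoothing} :
    s = t ↔ (s = .A ↔ t = .A) := by
  cases s <;> cases t <;> simp

theorem res_eq_treeSmoothing_iff (H : Finset C) (c : C) :
    χ.res H c = χ.treeSmoothing T c ↔ (c ∈ H ↔ c ∈ χ.treeState T) := by
  rw [Smoothing.eq_iff_eq_A, res_eq_A_iff, treeSmoothing_eq_A_iff, mem_treeState_iff]
  tauto

/-- The live edges of `T` whose smoothing in the state `H` is opposite to the one in the activity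
word. -/
def toggled (T H : Finset C) : Set C := {c | ¬ (c ∈ H ↔ c ∈ χ.treeState T)}

variable {χ}

theorem inTreeSubgraph_iff (S : χ.EnhancedSubgraph) (c : C) :
    χ.InTreeSubgraph T S c ↔ c ∈ χ.toggled T S.H :=
  not_congr (χ.res_eq_treeSmoothing_iff S.H c)

theorem inTwistedUnknot_iff (S : χ.EnhancedSubgraph) :
    χ.InTwistedUnknot T S ↔ χ.toggled T S.H ⊆ {c | χ.IsLive T c} := by
  unfold InTwistedUnknot
  refine forall_congr' fun c => ?_
  rw [res_eq_treeSmoothing_iff]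
  exact not_imp_comm

theorem mem_iff_of_dead {H : Finset C} (h : χ.toggled T H ⊆ {c | χ.IsLive T c}) {c : C}
    (hc : ¬ χ.IsLive T c) : c ∈ T ↔ c ∈ H := by
  have h1 : c ∉ χ.toggled T H := fun h' => hc (h h')
  have h2 : c ∈ H ↔ c ∈ χ.treeState T := not_not.1 h1
  rw [h2, mem_treeState_iff]
  tauto

theorem agree_of_toggled (hT : χ.IsSpanningTree T) {H : Finset C}
    (h : χ.toggled T H ⊆ {c | χ.IsLive T c}) (f : C)
    (hE : ¬ ExtActive χ.cycleClosure (T : Set C) f)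
    (hI : ¬ IntActive χ.cycleClosure (T : Set C) f) : f ∈ (T : Set C) ↔ f ∈ (H : Set C) :=
  mem_iff_of_dead h fun hl => ((isLive_iff hT f).1 hl).elim hE hI

theorem baseOf_eq_tree (hT : χ.IsSpanningTree T) {H : Finset C}
    (h : χ.toggled T H ⊆ {c | χ.IsLive T c}) : baseOf χ.cycleClosure (H : Set C) = T :=
  baseOf_eq_of_agree χ.isMatroidClosure_endsReachable ((χ.isSpanningTree_iff T).1 hT)
    (agree_of_toggled hT h)

/-- The live edges of `T` are active for every state of `U(T)`. -/
theorem isLive_iff_of_toggled (hT : χ.IsSpanningTree T) {H : Finset C}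
    (h : χ.toggled T H ⊆ {c | χ.IsLive T c}) (e : C) :
    χ.IsLive T e ↔ ExtActive χ.cycleClosure (H : Set C) e ∨
      IntActive χ.cycleClosure (H : Set C) e := by
  have h1 := active_congr χ.isMatroidClosure_endsReachable (agree_of_toggled hT h) e
  rw [isLive_iff hT, h1.1, h1.2]

/-- Every state belongs to the twisted unknot of some spanning tree. -/
theorem exists_spanningTree (χ : D.Checkerboard) (H : Finset C) :
    ∃ T, χ.IsSpanningTree T ∧ χ.toggled T H ⊆ {c | χ.IsLive T c} := by
  classical
  have hcl := χ.isMatroidClosure_endsReachable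
  set T : Finset C := (baseOf χ.cycleClosure (H : Set C)).toFinite.toFinset with hTdef
  have hTc : (T : Set C) = baseOf χ.cycleClosure (H : Set C) := Set.Finite.coe_toFinset _
  have hT : χ.IsSpanningTree T := by
    rw [isSpanningTree_iff, hTc]
    exact isMatroidBase_baseOf hcl _
  refine ⟨T, hT, fun c hc => ?_⟩
  by_contra hl
  change ¬ χ.IsLive T c at hl
  have h1 := active_congr hcl (H := (H : Set C)) (H' := baseOf χ.cycleClosure (H : Set C))
    (fun f => mem_baseOf_iff) c
  rw [isLive_iff hT, hTc, h1.1, h1.2, not_or] at hl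
  have h2 : c ∈ H ↔ c ∈ T := by
    have := mem_baseOf_iff hl.1 hl.2
    rwa [← hTc] at this
  refine hc (h2.trans ?_)
  rw [mem_treeState_iff, isLive_iff hT, hTc, h1.1, h1.2]
  tauto

theorem toggled_treeState : χ.toggled T (χ.treeState T) = ∅ := by
  ext c; simp [toggled]

theorem eq_of_toggled_eq {H H' : Finset C} (h : χ.toggled T H = χ.toggled T H') : H = H' := by
  ext c
  have := Set.ext_iff.1 h c
  change ¬ _ ↔ ¬ _ at this
  tauto

theorem IsToggle.toggled_eq {H H' : Finset C} {e : C} (h : IsToggle H H' e)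
    (he : e ∉ χ.toggled T H') : χ.toggled T H = insert e (χ.toggled T H') := by
  ext c
  by_cases hc : c = e
  · subst hc
    have h1 : c ∈ χ.toggled T H := by
      have h2 : c ∈ H' ↔ c ∈ χ.treeState T := not_not.1 he
      intro h3
      have := h.2
      tauto
    simp [h1]
  · have h1 := h.1 c hc
    have h2 : c ∈ χ.toggled T H ↔ c ∈ χ.toggled T H' := by
      change ¬ _ ↔ ¬ _
      rw [h1]
    simp [hc, h2]

theorem exists_toggled_eq (χ : D.Checkerboard) (T : Finset C) (R : Set C) :
    ∃ H, χ.toggled T H = R := by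
  classical
  refine ⟨Finset.univ.filter fun c => ¬ (c ∈ R ↔ c ∈ χ.treeState T), ?_⟩
  ext c
  simp only [toggled, Set.mem_ofPred_eq, Finset.mem_filter, Finset.mem_univ, true_and]
  tauto

end Linear

/-! ### The circles of a state of a twisted unknot -/

section States

variable [Finite Arc] [Fintype C] [LinearOrder C] {T : Finset C}

variable {χ}

/-- By planarity, the smoothing of a live edge is opposite to the one in the activity word iff a
single circle meets itself at its crossing: the ends of an externally active edge are always
connected by the rest of the state, those of an internally active one never are. -/
theorem mem_toggled_iff_face_eq (hT : χ.IsSpanningTree T) {H : Finset C}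
    (h : χ.toggled T H ⊆ {c | χ.IsLive T c}) {e : C} (he : χ.IsLive T e) :
    e ∈ χ.toggled T H ↔ χ.face₁ H e = χ.face₂ H e := by
  have hcl := χ.isMatroidClosure_endsReachable
  have hT' := (χ.isSpanningTree_iff T).1 hT
  have h1 := active_congr hcl (agree_of_toggled hT h) e
  have hmem : e ∈ χ.toggled T H ↔ ¬ (e ∈ H ↔ (e ∈ T ↔ ¬ χ.IsLive T e)) := by
    rw [← mem_treeState_iff]; rfl
  rw [hmem]
  simp only [he, not_true_eq_false, iff_false]
  rcases (isLive_iff hT e).1 he with hE | hI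
  · have heT : e ∉ T := fun h' => not_extActive_of_mem_base hcl hT' (Finset.mem_coe.2 h') hE
    have hE' := h1.1.2 hE
    have hsub : {x ∈ (H : Set C) | e < x} ⊆ (H : Set C) \ {e} := fun x hx => ⟨hx.1, hx.2.ne'⟩
    have hr : χ.EndsReachable ((H : Set C) \ {e}) e := hcl.mono _ _ hsub hE'
    by_cases heH : e ∈ H
    · simp [heH, heT, χ.face₁_eq_face₂_iff_of_mem heH, hr]
    · have hr' : χ.EndsReachable (H : Set C) e := hcl.mono _ _ Set.sdiff_subset hr
      simp [heH, heT, χ.face₁_eq_face₂_iff heH, hr']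
  · have heT : e ∈ T := by
      by_contra h'
      exact not_intActive_of_notMem_base hcl hT' (mt Finset.mem_coe.1 h') hI
    have hI' := h1.2.2 hI
    have hr : ¬ χ.EndsReachable ((H : Set C) \ {e}) e := by
      refine fun h' => hI' (hcl.mono _ _ (fun x hx => ?_) h')
      exact (lt_or_gt_of_ne (show x ≠ e from hx.2)).elim Or.inr fun hl => Or.inl ⟨hx.1, hl⟩
    by_cases heH : e ∈ H
    · simp [heH, heT, χ.face₁_eq_face₂_iff_of_mem heH, hr]
    · have hr' : ¬ χ.EndsReachable (H : Set C) e := by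
        rwa [Set.sdiff_singleton_eq_self (mt Finset.mem_coe.1 heH)] at hr
      simp [heH, heT, χ.face₁_eq_face₂_iff heH, hr']

/-- The circles of a state of `U(T)` are the components of the corresponding subgraph
of the tree `G(T)`. -/
theorem face_eq_iff_edgeConn (hT : χ.IsSpanningTree T) {H : Finset C}
    (h : χ.toggled T H ⊆ {c | χ.IsLive T c}) (a b : Arc) :
    χ.face H a = χ.face H b ↔
      EdgeConn (χ.face₁ (χ.treeState T)) (χ.face₂ (χ.treeState T)) (χ.toggled T H)
        (χ.face (χ.treeState T) a) (χ.face (χ.treeState T) b) := by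
  classical
  suffices key : ∀ (s : Finset C) (H : Finset C), χ.toggled T H = s →
      χ.toggled T H ⊆ {c | χ.IsLive T c} → ∀ a b, χ.face H a = χ.face H b ↔
      EdgeConn (χ.face₁ (χ.treeState T)) (χ.face₂ (χ.treeState T)) (s : Set C)
        (χ.face (χ.treeState T) a) (χ.face (χ.treeState T) b) by
    have hs := (χ.toggled T H).toFinite.coe_toFinset
    rw [key _ H hs.symm h, hs]
  intro s
  induction s using Finset.induction_on with
  | empty =>
    intro H hs _ a b
    have hH : H = χ.treeState T :=
      eq_of_toggled_eq (hs.trans (Finset.coe_empty.trans toggled_treeState.symm))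
    subst hH
    refine ⟨fun h => h ▸ EdgeConn.refl _ _, fun h => ?_⟩
    exact (h.symm.eq_of_isolated (by simp))
  | insert e s he ih =>
    intro H hs h a b
    obtain ⟨H', hH'⟩ := exists_toggled_eq χ T (s : Set C)
    have ht : IsToggle H' H e := by
      have hm : ∀ c, (c ∈ χ.toggled T H ↔ c = e ∨ c ∈ χ.toggled T H') := by
        intro c; rw [hs, hH']; simp
      refine ⟨fun c hc => ?_, ?_⟩
      · have h1 := hm c
        simp only [hc, false_or] at h1
        change ¬ _ ↔ ¬ _ at h1
        tauto
      · have h1 : e ∈ χ.toggled T H := (hm e).2 (Or.inl rfl)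
        have h2 : e ∉ χ.toggled T H' := by rw [hH']; exact he
        change ¬ _ at h1
        change ¬ ¬ _ at h2
        tauto
    have hsub : χ.toggled T H' ⊆ {c | χ.IsLive T c} := by
      rw [hH']; rw [hs] at h
      exact fun c hc => h (Finset.mem_coe.2 (Finset.mem_insert_of_mem hc))
    have helive : χ.IsLive T e := by
      rw [hs] at h
      exact h (Finset.mem_coe.2 (Finset.mem_insert_self e s))
    have hne : χ.face₁ H' e ≠ χ.face₂ H' e := by
      rw [Ne, ← mem_toggled_iff_face_eq hT hsub helive, hH']
      exact he
    have hi := ih H' hH' hsub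
    refine (χ.isJoin_face ht hne a b).trans ?_
    rw [Finset.coe_insert]
    refine Iff.trans ?_ (edgeConn_insert e _ _).symm
    exact or_congr (hi _ _) (or_congr (and_congr (hi _ _) (hi _ _)) (and_congr (hi _ _) (hi _ _)))

/-- The smoothings of the activity word turn the live edges into the edges of a forest. -/
theorem isForest_liveEdges (hT : χ.IsSpanningTree T) :
    IsForest (χ.face₁ (χ.treeState T)) (χ.face₂ (χ.treeState T)) {c | χ.IsLive T c} := by
  intro e he hc
  obtain ⟨H, hH⟩ := exists_toggled_eq χ T ({c | χ.IsLive T c} \ {e})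
  have hsub : χ.toggled T H ⊆ {c | χ.IsLive T c} := hH ▸ Set.sdiff_subset
  rw [← hH] at hc
  have h1 := (mem_toggled_iff_face_eq hT hsub he).2 ((face_eq_iff_edgeConn hT hsub _ _).2 hc)
  rw [hH] at h1
  exact h1.2 rfl

/-- A spanning tree has only one face. -/
theorem face_spanningTree_eq (hT : χ.IsSpanningTree T) (a b : Arc) : χ.face T a = χ.face T b := by
  have hT' := (χ.isSpanningTree_iff T).1 hT
  have h1 : ∀ c, χ.face₁ T c = χ.face₂ T c := by
    intro c
    by_cases hc : c ∈ T
    · exact (χ.face₁_eq_face₂_iff_of_mem hc).2 (hT'.2 c (Finset.mem_coe.2 hc))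
    · exact (χ.face₁_eq_face₂_iff hc).2 (hT'.1 c)
  refine (D.connected a b).le_of_equivalence (χ.face_equivalence T) ?_
  rintro _ _ ⟨c, k, l, rfl, rfl⟩
  have h2 : ∀ k, χ.face T (D.arc c k) = χ.face₁ T c := fun k =>
    (χ.face_arc T c k).elim id fun h => h.trans (h1 c).symm
  exact (h2 k).trans (h2 l).symm

/-- The graph `G(T)` is connected. -/
theorem edgeConn_liveEdges (hT : χ.IsSpanningTree T) (v w : χ.TreeVertex T) :
    EdgeConn (χ.face₁ (χ.treeState T)) (χ.face₂ (χ.treeState T)) {c | χ.IsLive T c} v w := by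
  obtain ⟨a, rfl⟩ := Quot.exists_rep v
  obtain ⟨b, rfl⟩ := Quot.exists_rep w
  have h1 : χ.toggled T T = {c | χ.IsLive T c} := by
    ext c
    change ¬ (c ∈ T ↔ c ∈ χ.treeState T) ↔ χ.IsLive T c
    rw [mem_treeState_iff]
    by_cases hc : c ∈ T <;> simp [hc]
  have h2 := (face_eq_iff_edgeConn hT (H := T) h1.subset a b).1 (face_spanningTree_eq hT a b)
  rw [h1] at h2
  exact h2

end States

end ConnectedLinkDiagram.Checkerboard

namespace ConnectedLinkDiagram.Checkerboard

open EnhancedSubgraph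

variable {Arc C : Type*} {D : ConnectedLinkDiagram Arc C} {χ : D.Checkerboard}

/-! ### Leaf removals -/

theorem EnhancedSubgraph.mem_aEdges_iff_res {S : χ.EnhancedSubgraph} {e : C} :
    e ∈ S.aEdges ↔ χ.res S.H e = .A := by
  rw [mem_aEdges_iff, res_eq_A_iff]
  exact Iff.comm

section Leaf

variable [Fintype C] [LinearOrder C] {dot : Arc} {T R : Finset C}

theorem IsLeaf.isPendant {e : C} {v : χ.TreeVertex T} (h : χ.IsLeaf dot T R e v) :
    IsPendant (χ.face₁ (χ.treeState T)) (χ.face₂ (χ.treeState T)) (χ.face (χ.treeState T) dot)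
      (R : Set C) e v := h

/-- `R` is the edge set of a subtree of `G(T)` that contains the root. -/
structure IsRootedSubtree (χ : D.Checkerboard) (dot : Arc) (T R : Finset C) : Prop where
  isSpanningTree : χ.IsSpanningTree T
  isLive : (R : Set C) ⊆ {c | χ.IsLive T c}
  isRooted : IsRooted (χ.face₁ (χ.treeState T)) (χ.face₂ (χ.treeState T))
    (χ.face (χ.treeState T) dot) (R : Set C)

theorem IsRootedSubtree.erase (hR : χ.IsRootedSubtree dot T R) {e : C} {v : χ.TreeVertex T}
    (hl : χ.IsLeaf dot T R e v) : χ.IsRootedSubtree dot T (R.erase e) := by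
  refine ⟨hR.isSpanningTree, fun c hc => hR.isLive (Finset.mem_of_mem_erase hc), ?_⟩
  rw [Finset.coe_erase]
  exact hl.isPendant.isRooted_sdiff hR.isRooted

theorem IsLeafRemoval.isToggle {e : C} {v : χ.TreeVertex T} {l : Label} {S S' : χ.EnhancedSubgraph}
    (h : χ.IsLeafRemoval T e v l S S') : IsToggle S.H S'.H e := by
  have h1 : e ∈ χ.toggled T S.H := (inTreeSubgraph_iff S e).1 h.1
  have h2 : e ∉ χ.toggled T S'.H := mt (inTreeSubgraph_iff S' e).2 h.2.1
  refine ⟨h.2.2.1, ?_⟩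
  change ¬ _ at h1
  change ¬ ¬ _ at h2
  tauto

theorem IsLeafRemoval.toggled_eq {e : C} {v : χ.TreeVertex T} {l : Label}
    {S S' : χ.EnhancedSubgraph} (h : χ.IsLeafRemoval T e v l S S') :
    χ.toggled T S.H = insert e (χ.toggled T S'.H) :=
  h.isToggle.toggled_eq (mt (inTreeSubgraph_iff S' e).2 h.2.1)

theorem IsLeafRemoval.lab_eq {e : C} {v : χ.TreeVertex T} {l : Label} {S S' : χ.EnhancedSubgraph}
    (h : χ.IsLeafRemoval T e v l S S') {a : Arc} (ha : χ.face (χ.treeState T) a ≠ v) :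
    S'.lab a = S.lab a := h.2.2.2.2 a ha

theorem IsLeafRemoval.lab_leaf {e : C} {v : χ.TreeVertex T} {l : Label} {S S' : χ.EnhancedSubgraph}
    (h : χ.IsLeafRemoval T e v l S S') {a : Arc} (ha : χ.face (χ.treeState T) a = v) :
    S'.lab a = l := h.2.2.2.1 a ha

theorem IsLeafRemoval.unique_right {e : C} {v : χ.TreeVertex T} {l : Label}
    {S S₁ S₂ : χ.EnhancedSubgraph} (h₁ : χ.IsLeafRemoval T e v l S S₁)
    (h₂ : χ.IsLeafRemoval T e v l S S₂) : S₁ = S₂ := by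
  refine ext_lab ?_ fun a => ?_
  · ext c
    by_cases hc : c = e
    · subst hc
      rw [h₁.isToggle.2, h₂.isToggle.2]
    · rw [h₁.isToggle.1 c hc, h₂.isToggle.1 c hc]
  · by_cases ha : χ.face (χ.treeState T) a = v
    · rw [h₁.lab_leaf ha, h₂.lab_leaf ha]
    · rw [h₁.lab_eq ha, h₂.lab_eq ha]

theorem IsLeastLeaf.unique (hR : χ.IsRootedSubtree dot T R) {e e' : C} {v v' : χ.TreeVertex T}
    (h : χ.IsLeastLeaf dot T R e v) (h' : χ.IsLeastLeaf dot T R e' v') : e = e' ∧ v = v' := by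
  obtain rfl : e = e' := le_antisymm (h.2 _ _ h'.1) (h'.2 _ _ h.1)
  exact ⟨rfl, h.1.isPendant.unique hR.isRooted h'.1.isPendant⟩

end Leaf

section LeafState

variable [Finite Arc] [Fintype C] [LinearOrder C] {dot : Arc} {T R : Finset C}

theorem exists_isLeastLeaf (hR : χ.IsRootedSubtree dot T R) (hne : R.Nonempty) :
    ∃ e v, χ.IsLeastLeaf dot T R e v := by
  classical
  obtain ⟨e, v, h⟩ := IsForest.exists_isPendant R
    ((isForest_liveEdges hR.isSpanningTree).mono hR.isLive) hne (χ.face (χ.treeState T) dot)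
  obtain ⟨e₀, ⟨v₀, h₀⟩, hmin⟩ := Set.exists_min_image {e | ∃ v, χ.IsLeaf dot T R e v} id
    (Set.toFinite _) ⟨e, v, h⟩
  exact ⟨e₀, v₀, h₀, fun e' v' h' => hmin e' ⟨v', h'⟩⟩

theorem isRootedSubtree_liveEdges (hT : χ.IsSpanningTree T) (dot : Arc) :
    χ.IsRootedSubtree dot T (χ.liveEdges T) := by
  have h : ((χ.liveEdges T : Finset C) : Set C) = {c | χ.IsLive T c} := by
    ext c; simp [liveEdges]
  refine ⟨hT, h.subset, fun e _ => ?_⟩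
  rw [h]
  exact edgeConn_liveEdges hT _ _

theorem face_eq_of_treeState (hT : χ.IsSpanningTree T) {H : Finset C}
    (hH : χ.toggled T H ⊆ {c | χ.IsLive T c}) {a b : Arc}
    (h : χ.face (χ.treeState T) a = χ.face (χ.treeState T) b) : χ.face H a = χ.face H b :=
  (face_eq_iff_edgeConn hT hH a b).2 (h ▸ EdgeConn.refl _ _)

/-- The end `p` of the leaf edge `e` at the leaf `v`, and the other end `q`. -/
theorem IsLeaf.exists_ends (hR : χ.IsRootedSubtree dot T R) {e : C} {v : χ.TreeVertex T}
    (hl : χ.IsLeaf dot T R e v) : ∃ p q : Arc,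
      ((p = D.arc e 0 ∧ q = D.arc e 2) ∨ (p = D.arc e 2 ∧ q = D.arc e 0)) ∧
        χ.face (χ.treeState T) p = v ∧ χ.face (χ.treeState T) q ≠ v := by
  have hne : χ.face₁ (χ.treeState T) e ≠ χ.face₂ (χ.treeState T) e := fun h =>
    isForest_liveEdges hR.isSpanningTree e (hR.isLive hl.1) (h ▸ EdgeConn.refl _ _)
  rcases hl.2.2.1 with rfl | rfl
  · exact ⟨_, _, Or.inl ⟨rfl, rfl⟩, rfl, hne.symm⟩
  · exact ⟨_, _, Or.inr ⟨rfl, rfl⟩, rfl, hne⟩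

/-- If the leaf edge is not contained in the state, the leaf is isolated in it. -/
theorem IsLeaf.isolated (hR : χ.IsRootedSubtree dot T R) {e : C} {v : χ.TreeVertex T}
    (hl : χ.IsLeaf dot T R e v) {H : Finset C} (hH : χ.toggled T H ⊆ R) (he : e ∉ χ.toggled T H)
    {a b : Arc} (ha : χ.face (χ.treeState T) a = v) (hab : χ.face H a = χ.face H b) :
    χ.face (χ.treeState T) b = v := by
  have h := (face_eq_iff_edgeConn hR.isSpanningTree (hH.trans hR.isLive) a b).1 hab
  rw [ha] at h
  exact hl.isPendant.eq_of_conn hH he h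

/-- The leaf removals are the splits at `e` after which the leaf has the label `x`, if the
smoothing at `e` assigned by the activity word is `B`. -/
theorem isLeafRemoval_iff_isTerm_of_B (hR : χ.IsRootedSubtree dot T R) {e : C}
    {v : χ.TreeVertex T} (hl : χ.IsLeaf dot T R e v) (hB : χ.treeSmoothing T e = .B)
    {S S' : χ.EnhancedSubgraph} (hS : χ.toggled T S.H ⊆ R) :
    χ.IsLeafRemoval T e v .x S S' ↔ S.IsTerm S' e ∧ χ.HasLabel T S' v .x := by
  obtain ⟨p, q, hpq, hp, hq⟩ := hl.exists_ends hR
  have hT := hR.isSpanningTree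
  have hlive := hR.isLive hl.1
  constructor
  · intro h
    refine ⟨isTerm_iff.2 ⟨?_, h.isToggle, ?_, ?_, ?_⟩, h.2.2.2.1⟩
    · rw [mem_aEdges_iff_res]
      have h1 : χ.res S.H e ≠ .B := hB ▸ h.1
      cases h2 : χ.res S.H e
      · rfl
      · exact (h1 h2).elim
    · intro a h1 h2
      refine h.lab_eq fun ha => ?_
      have h3 := face_eq_of_treeState hT (hS.trans hR.isLive) (ha.trans hp.symm)
      rcases hpq with ⟨rfl, rfl⟩ | ⟨rfl, rfl⟩
      · exact h1 h3
      · exact h2 h3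
    · intro h1
      exact (h1 ((mem_toggled_iff_face_eq hT (hS.trans hR.isLive) hlive).1
        ((inTreeSubgraph_iff S e).1 h.1))).elim
    · intro h1
      have h2 : S.lab (D.arc e 0) = S.lab (D.arc e 2) := lab_congr h1
      have h3 := h.lab_leaf hp
      have h4 := h.lab_eq hq
      rcases hpq with ⟨rfl, rfl⟩ | ⟨rfl, rfl⟩
      · rw [h3, h4, ← h2]
        cases S.lab (D.arc e 0) <;> simp [Label.split]
      · rw [h3, h4]
        cases S.lab (D.arc e 0) <;> simp [Label.split]
  · rintro ⟨h, hx⟩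
    have hres : χ.res S.H e = .A := mem_aEdges_iff_res.1 h.1
    have ht : χ.InTreeSubgraph T S e := by
      intro h1
      rw [hres, hB] at h1
      cases h1
    obtain ⟨-, htog, hun, -, hsplit⟩ := isTerm_iff.1 h
    have ht' : ¬ χ.InTreeSubgraph T S' e := by
      rw [inTreeSubgraph_iff] at ht ⊢
      have := htog.2
      change ¬ _ at ht
      change ¬ ¬ _
      tauto
    have hS' : χ.toggled T S'.H ⊆ R := by
      refine fun c hc => ?_
      by_cases hce : c = e
      · exact hce ▸ hl.1
      · refine hS ?_
        change ¬ _
        rw [← htog.1 c hce]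
        exact hc
    have h1 := (mem_toggled_iff_face_eq hT (hS.trans hR.isLive) hlive).1
      ((inTreeSubgraph_iff S e).1 ht)
    refine ⟨ht, ht', htog.1, hx, fun a ha => ?_⟩
    change S'.lab a = S.lab a
    have hsp := hsplit h1
    have hpx : S'.lab p = .x := hx p hp
    have hqe : S'.lab q = S.lab (D.arc e 0) := by
      rcases hpq with ⟨rfl, rfl⟩ | ⟨rfl, rfl⟩
      · rw [hpx] at hsp
        cases h2 : S.lab (D.arc e 0) <;> cases h3 : S'.lab (D.arc e 2) <;>
          simp_all [Label.split]
      · rw [hpx] at hsp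
        cases h2 : S.lab (D.arc e 0) <;> cases h3 : S'.lab (D.arc e 0) <;>
          simp_all [Label.split]
    by_cases h2 : χ.face S.H a = χ.face₁ S.H e
    · have h3 : χ.face S'.H a = χ.face S'.H p ∨ χ.face S'.H a = χ.face S'.H q := by
        have := htog.face_eq_or_of_split h2
        rcases hpq with ⟨rfl, rfl⟩ | ⟨rfl, rfl⟩
        · exact this
        · exact this.symm
      rcases h3 with h3 | h3
      · exact (ha (hl.isolated hR hS' (mt (inTreeSubgraph_iff S' e).2 ht') hp h3.symm)).elim
      · rw [lab_congr h3, hqe]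
        exact (lab_congr h2).symm
    · exact hun a h2 (h1 ▸ h2)

/-- The leaf removals are, from right to left, the merges at `e` before which the leaf has the
label `1`, if the smoothing at `e` assigned by the activity word is `A`. -/
theorem isLeafRemoval_iff_isTerm_of_A (hR : χ.IsRootedSubtree dot T R) {e : C}
    {v : χ.TreeVertex T} (hl : χ.IsLeaf dot T R e v) (hA : χ.treeSmoothing T e = .A)
    {S S' : χ.EnhancedSubgraph} (hS : χ.toggled T S.H ⊆ R) :
    χ.IsLeafRemoval T e v .one S S' ↔ S'.IsTerm S e ∧ χ.HasLabel T S' v .one := by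
  obtain ⟨p, q, hpq, hp, hq⟩ := hl.exists_ends hR
  have hT := hR.isSpanningTree
  have hlive := hR.isLive hl.1
  have hsub : ∀ {S' : χ.EnhancedSubgraph}, IsToggle S.H S'.H e → χ.toggled T S'.H ⊆ R := by
    intro S' htog c hc
    by_cases hce : c = e
    · exact hce ▸ hl.1
    · refine hS ?_
      change ¬ _
      rw [← htog.1 c hce]
      exact hc
  constructor
  · intro h
    have hS' := hsub h.isToggle
    have hne : χ.face₁ S'.H e ≠ χ.face₂ S'.H e := fun h1 => h.2.1 ((inTreeSubgraph_iff S' e).2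
      ((mem_toggled_iff_face_eq hT (hS'.trans hR.isLive) hlive).2 h1))
    refine ⟨isTerm_iff.2 ⟨?_, h.isToggle.symm, ?_, ?_, fun h1 => (hne h1).elim⟩, h.2.2.2.1⟩
    · rw [mem_aEdges_iff_res, ← hA]
      exact not_not.1 h.2.1
    · intro a h1 h2
      refine (h.lab_eq fun ha => ?_).symm
      have h3 := face_eq_of_treeState hT (hS'.trans hR.isLive) (ha.trans hp.symm)
      rcases hpq with ⟨rfl, rfl⟩ | ⟨rfl, rfl⟩
      · exact h1 h3
      · exact h2 h3
    · intro _
      have h1 := (mem_toggled_iff_face_eq hT (hS.trans hR.isLive) hlive).1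
        ((inTreeSubgraph_iff S e).1 h.1)
      have h2 : S.lab (D.arc e 0) = S.lab (D.arc e 2) := lab_congr h1
      have h3 := h.lab_leaf hp
      have h4 := h.lab_eq hq
      rcases hpq with ⟨rfl, rfl⟩ | ⟨rfl, rfl⟩
      · rw [h3, h4, ← h2]; rfl
      · rw [h3, h4]
        cases S.lab (D.arc e 0) <;> rfl
  · rintro ⟨h, hx⟩
    have hres : χ.res S'.H e = .A := mem_aEdges_iff_res.1 h.1
    have ht' : ¬ χ.InTreeSubgraph T S' e := not_not.2 (hres.trans hA.symm)
    obtain ⟨-, htog, hun, hmerge, -⟩ := isTerm_iff.1 h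
    have ht : χ.InTreeSubgraph T S e := by
      rw [inTreeSubgraph_iff] at ht' ⊢
      have := htog.2
      change ¬ ¬ _ at ht'
      change ¬ _
      tauto
    have hS' := hsub htog.symm
    have hne : χ.face₁ S'.H e ≠ χ.face₂ S'.H e := fun h1 => ht' ((inTreeSubgraph_iff S' e).2
      ((mem_toggled_iff_face_eq hT (hS'.trans hR.isLive) hlive).2 h1))
    have h1 : χ.face S.H (D.arc e 0) = χ.face S.H (D.arc e 2) :=
      (mem_toggled_iff_face_eq hT (hS.trans hR.isLive) hlive).1 ((inTreeSubgraph_iff S e).1 ht)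
    refine ⟨ht, ht', htog.symm.1, hx, fun a ha => ?_⟩
    change S'.lab a = S.lab a
    have hm := hmerge hne
    have hpx : S'.lab p = .one := hx p hp
    have hqe : S'.lab q = S.lab (D.arc e 0) := by
      rcases hpq with ⟨rfl, rfl⟩ | ⟨rfl, rfl⟩
      · rw [hpx] at hm
        exact Option.some.inj hm
      · rw [hpx] at hm
        cases h3 : S'.lab (D.arc e 0) <;> rw [h3] at hm <;> exact Option.some.inj hm
    have hq0 : χ.face S.H q = χ.face S.H (D.arc e 0) := by
      rcases hpq with ⟨rfl, rfl⟩ | ⟨rfl, rfl⟩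
      · exact h1.symm
      · rfl
    by_cases h2 : χ.face S'.H a = χ.face S'.H q
    · have h3 : χ.face S.H a = χ.face S.H q := (χ.isJoin_face htog hne a q).2 (Or.inl h2)
      rw [lab_congr h2, hqe, lab_congr (h3.trans hq0)]
    · have h4 : χ.face S'.H a ≠ χ.face S'.H p := fun h3 =>
        ha (hl.isolated hR hS' (mt (inTreeSubgraph_iff S' e).2 ht') hp h3.symm)
      rcases hpq with ⟨rfl, rfl⟩ | ⟨rfl, rfl⟩
      · exact (hun a h4 h2).symm
      · exact (hun a h2 h4).symm

theorem exists_isLeafRemoval (hR : χ.IsRootedSubtree dot T R) {e : C} {v : χ.TreeVertex T}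
    (hl : χ.IsLeaf dot T R e v) (l : Label) {S : χ.EnhancedSubgraph} (hS : χ.toggled T S.H ⊆ R)
    (he : χ.InTreeSubgraph T S e) : ∃ S', χ.IsLeafRemoval T e v l S S' := by
  classical
  have hT := hR.isSpanningTree
  obtain ⟨H', hH'⟩ := exists_isToggle S.H e
  have he1 := (inTreeSubgraph_iff S e).1 he
  have he2 : e ∉ χ.toggled T H' := by
    have := hH'.2
    change ¬ _ at he1
    change ¬ ¬ _
    tauto
  have hHH' := hH'.toggled_eq he2
  have hS' : χ.toggled T H' ⊆ R := fun c hc => hS (hHH' ▸ Or.inr hc)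
  have hne : χ.face₁ H' e ≠ χ.face₂ H' e := fun h1 => he2
    ((mem_toggled_iff_face_eq hT (hS'.trans hR.isLive) (hR.isLive hl.1)).2 h1)
  obtain ⟨S', rfl, hS'lab⟩ := exists_of_lab χ H'
    (fun a => if χ.face (χ.treeState T) a = v then l else S.lab a) fun a b hab => by
      have h1 : χ.face (χ.treeState T) a = v ↔ χ.face (χ.treeState T) b = v :=
        ⟨fun h => hl.isolated hR hS' he2 h hab, fun h => hl.isolated hR hS' he2 h hab.symm⟩
      simp only [h1]
      rw [lab_congr ((χ.isJoin_face hH'.symm hne a b).2 (Or.inl hab))]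
  refine ⟨S', he, mt (inTreeSubgraph_iff S' e).1 he2, hH'.1, fun a ha => ?_, fun a ha => ?_⟩
  · exact (hS'lab a).trans (if_pos ha)
  · exact (hS'lab a).trans (if_neg ha)

/-- Attaching the isolated leaf again, it takes the label of the component at the other end of `e`.
-/
theorem exists_isLeafRemoval_of_hasLabel (hR : χ.IsRootedSubtree dot T R) {e : C}
    {v : χ.TreeVertex T} (hl : χ.IsLeaf dot T R e v) {l : Label} {S' : χ.EnhancedSubgraph}
    (hS' : χ.toggled T S'.H ⊆ R) (he : ¬ χ.InTreeSubgraph T S' e) (hv : χ.HasLabel T S' v l) :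
    ∃ S, χ.IsLeafRemoval T e v l S S' := by
  classical
  obtain ⟨p, q, hpq, hp, hq⟩ := hl.exists_ends hR
  have hT := hR.isSpanningTree
  obtain ⟨H, hH⟩ := exists_isToggle S'.H e
  have he2 := mt (inTreeSubgraph_iff S' e).2 he
  have hHH' := hH.symm.toggled_eq he2
  have hne : χ.face₁ S'.H e ≠ χ.face₂ S'.H e := fun h1 => he2
    ((mem_toggled_iff_face_eq hT (hS'.trans hR.isLive) (hR.isLive hl.1)).2 h1)
  have hjoin : IsJoin (fun a b => χ.face S'.H a = χ.face S'.H b)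
      (fun a b => χ.face H a = χ.face H b) p q := by
    rcases hpq with ⟨rfl, rfl⟩ | ⟨rfl, rfl⟩
    · exact χ.isJoin_face hH hne
    · exact fun a b => (χ.isJoin_face hH hne a b).trans (or_congr_right or_comm)
  have hiso : ∀ {a}, χ.face S'.H a = χ.face S'.H p → χ.face (χ.treeState T) a = v :=
    fun h => hl.isolated hR hS' he2 hp h.symm
  have hq' : ∀ {a}, χ.face S'.H a = χ.face S'.H q → χ.face (χ.treeState T) a ≠ v :=
    fun h h1 => hq (hl.isolated hR hS' he2 h1 h)
  obtain ⟨S, rfl, hSlab⟩ := exists_of_lab χ H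
    (fun a => if χ.face (χ.treeState T) a = v then S'.lab q else S'.lab a) fun a b hab => by
      rcases (hjoin a b).1 hab with h | ⟨h1, h2⟩ | ⟨h1, h2⟩
      · have h1 : χ.face (χ.treeState T) a = v ↔ χ.face (χ.treeState T) b = v :=
          ⟨fun h' => hl.isolated hR hS' he2 h' h, fun h' => hl.isolated hR hS' he2 h' h.symm⟩
        simp only [h1]
        rw [lab_congr h]
      · rw [if_pos (hiso h1), if_neg (hq' h2.symm), lab_congr h2]
      · rw [if_neg (hq' h1), if_pos (hiso h2.symm), lab_congr h1]
  refine ⟨S, (inTreeSubgraph_iff S e).2 (hHH' ▸ Or.inl rfl), he, hH.symm.1, hv, fun a ha => ?_⟩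
  exact ((hSlab a).trans (if_neg ha)).symm

theorem IsLeafRemoval.unique_left (hR : χ.IsRootedSubtree dot T R) {e : C}
    {v : χ.TreeVertex T} (hl : χ.IsLeaf dot T R e v) {l : Label} {S₁ S₂ S' : χ.EnhancedSubgraph}
    (hS' : χ.toggled T S'.H ⊆ R) (h₁ : χ.IsLeafRemoval T e v l S₁ S')
    (h₂ : χ.IsLeafRemoval T e v l S₂ S') : S₁ = S₂ := by
  obtain ⟨p, q, hpq, hp, hq⟩ := hl.exists_ends hR
  have hT := hR.isSpanningTree
  -- The leaf has the label of the other end of `e` as long as `e` is contained in the state.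
  have key : ∀ {S}, χ.IsLeafRemoval T e v l S S' → ∀ a, χ.face (χ.treeState T) a = v →
      S.lab a = S'.lab q := by
    intro S h a ha
    have hS : χ.toggled T S.H ⊆ {c | χ.IsLive T c} := by
      rw [h.toggled_eq]
      exact Set.insert_subset (hR.isLive hl.1) (hS'.trans hR.isLive)
    have h1 := (mem_toggled_iff_face_eq hT hS (hR.isLive hl.1)).1 ((inTreeSubgraph_iff S e).1 h.1)
    have h2 : χ.face S.H p = χ.face S.H q := by
      rcases hpq with ⟨rfl, rfl⟩ | ⟨rfl, rfl⟩
      · exact h1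
      · exact h1.symm
    rw [h.lab_eq hq, lab_congr ((face_eq_of_treeState hT hS (ha.trans hp.symm)).trans h2)]
  refine ext_lab ?_ fun a => ?_
  · ext c
    by_cases hc : c = e
    · subst hc
      rw [h₁.isToggle.symm.2, h₂.isToggle.symm.2]
    · rw [h₁.isToggle.symm.1 c hc, h₂.isToggle.symm.1 c hc]
  · by_cases ha : χ.face (χ.treeState T) a = v
    · rw [key h₁ a ha, key h₂ a ha]
    · rw [← h₁.lab_eq ha, h₂.lab_eq ha]

end LeafState

end ConnectedLinkDiagram.Checkerboard

namespace ConnectedLinkDiagram.Checkerboard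

open EnhancedSubgraph

variable {Arc C : Type*} {D : ConnectedLinkDiagram Arc C} {χ : D.Checkerboard}

/-! ### The matching of a twisted unknot -/

/-- The other label. -/
def _root_.Label.other : Label → Label
  | .one => .x
  | .x => .one

section Basic

/-- The label that a leaf gets if its edge `e` is removed by the matching. -/
noncomputable def leafLabel [LinearOrder C] (χ : D.Checkerboard) (T : Finset C) (e : C) : Label :=
  if χ.treeSmoothing T e = .B then .x else .one

theorem leafLabel_of_B [LinearOrder C] {T : Finset C} {e : C}
    (h : χ.treeSmoothing T e = .B) : χ.leafLabel T e = .x :=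
  if_pos h

theorem leafLabel_of_A [LinearOrder C] {T : Finset C} {e : C}
    (h : χ.treeSmoothing T e = .A) : χ.leafLabel T e = .one :=
  if_neg (by rw [h]; decide)

variable [Fintype C] [LinearOrder C] {dot : Arc} {T R : Finset C}

/-- The matching on `CKh(U(T))` as a symmetric relation. -/
def Matched (χ : D.Checkerboard) (dot : Arc) (T R : Finset C) (S S' : χ.EnhancedSubgraph) : Prop :=
  χ.TreeMatching dot T R S S' ∨ χ.TreeMatching dot T R S' S

/-- `S` does not contain the leaf edge `e`, and its end `v` has the label that leaves `S` to the
matching of the smaller tree. -/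
def IsDeferred (χ : D.Checkerboard) (T : Finset C) (e : C) (v : χ.TreeVertex T)
    (S : χ.EnhancedSubgraph) : Prop :=
  ¬ χ.InTreeSubgraph T S e ∧ χ.HasLabel T S v (χ.leafLabel T e).other

theorem treeMatching_iff (hR : χ.IsRootedSubtree dot T R) {e : C} {v : χ.TreeVertex T}
    (hl : χ.IsLeastLeaf dot T R e v) (S S' : χ.EnhancedSubgraph) :
    χ.TreeMatching dot T R S S' ↔
      (χ.treeSmoothing T e = .B ∧ χ.IsLeafRemoval T e v .x S S') ∨
      (χ.treeSmoothing T e = .A ∧ χ.IsLeafRemoval T e v .one S' S) ∨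
      (χ.IsDeferred T e v S ∧ χ.IsDeferred T e v S' ∧ χ.TreeMatching dot T (R.erase e) S S') := by
  constructor
  · intro h
    cases h with
    | negative _ e' v' _ _ hl' hB h =>
      obtain ⟨rfl, rfl⟩ := hl.unique hR hl'
      exact Or.inl ⟨hB, h⟩
    | positive _ e' v' _ _ hl' hA h =>
      obtain ⟨rfl, rfl⟩ := hl.unique hR hl'
      exact Or.inr (Or.inl ⟨hA, h⟩)
    | step _ e' v' l _ _ hl' hle h1 h2 h3 h4 h5 =>
      obtain ⟨rfl, rfl⟩ := hl.unique hR hl'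
      obtain rfl : l = (χ.leafLabel T e).other := by
        rcases hle with ⟨hs, rfl⟩ | ⟨hs, rfl⟩
        · rw [leafLabel_of_B hs]; rfl
        · rw [leafLabel_of_A hs]; rfl
      exact Or.inr (Or.inr ⟨⟨h1, h3⟩, ⟨h2, h4⟩, h5⟩)
  · rintro (⟨hB, h⟩ | ⟨hA, h⟩ | ⟨h1, h2, h3⟩)
    · exact .negative R e v S S' hl hB h
    · exact .positive R e v S' S hl hA h
    · refine .step R e v _ S S' hl ?_ h1.1 h2.1 h1.2 h2.2 h3
      cases hs : χ.treeSmoothing T e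
      · rw [leafLabel_of_A hs]; exact Or.inr ⟨rfl, rfl⟩
      · rw [leafLabel_of_B hs]; exact Or.inl ⟨rfl, rfl⟩

theorem matched_iff (hR : χ.IsRootedSubtree dot T R) {e : C} {v : χ.TreeVertex T}
    (hl : χ.IsLeastLeaf dot T R e v) (S S' : χ.EnhancedSubgraph) :
    χ.Matched dot T R S S' ↔
      χ.IsLeafRemoval T e v (χ.leafLabel T e) S S' ∨ χ.IsLeafRemoval T e v (χ.leafLabel T e) S' S ∨
      (χ.IsDeferred T e v S ∧ χ.IsDeferred T e v S' ∧ χ.Matched dot T (R.erase e) S S') := by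
  unfold Matched
  rw [treeMatching_iff hR hl, treeMatching_iff hR hl]
  cases hs : χ.treeSmoothing T e
  · rw [leafLabel_of_A hs]
    simp only [reduceCtorEq, false_and, false_or, true_and]
    tauto
  · rw [leafLabel_of_B hs]
    simp only [reduceCtorEq, false_and, false_or, true_and]
    tauto

theorem not_isLeastLeaf_empty {e : C} {v : χ.TreeVertex T} : ¬ χ.IsLeastLeaf dot T ∅ e v :=
  fun h => Finset.notMem_empty _ h.1.1

theorem not_treeMatching_empty (S S' : χ.EnhancedSubgraph) : ¬ χ.TreeMatching dot T ∅ S S' := by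
  intro h
  cases h with
  | negative _ _ _ _ _ hl => exact not_isLeastLeaf_empty hl
  | positive _ _ _ _ _ hl => exact not_isLeastLeaf_empty hl
  | step _ _ _ _ _ _ hl => exact not_isLeastLeaf_empty hl

theorem not_matched_empty (S S' : χ.EnhancedSubgraph) : ¬ χ.Matched dot T ∅ S S' :=
  fun h => h.elim (not_treeMatching_empty _ _) (not_treeMatching_empty _ _)

theorem HasLabel.unique {S : χ.EnhancedSubgraph} {v : χ.TreeVertex T} {l l' : Label}
    (h : χ.HasLabel T S v l) (h' : χ.HasLabel T S v l') : l = l' := by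
  obtain ⟨a, rfl⟩ := Quot.exists_rep v
  exact (h a rfl).symm.trans (h' a rfl)

theorem _root_.Label.other_ne (l : Label) : l.other ≠ l := by
  cases l <;> decide

theorem IsDeferred.not_isLeafRemoval_left {e : C} {v : χ.TreeVertex T} {S S' : χ.EnhancedSubgraph}
    {l : Label} (h : χ.IsDeferred T e v S) : ¬ χ.IsLeafRemoval T e v l S S' := fun h' => h.1 h'.1

theorem IsDeferred.not_isLeafRemoval_right {e : C} {v : χ.TreeVertex T}
    {S S' : χ.EnhancedSubgraph} (h : χ.IsDeferred T e v S') :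
    ¬ χ.IsLeafRemoval T e v (χ.leafLabel T e) S S' :=
  fun h' => Label.other_ne _ (h.2.unique h'.2.2.2.1)

theorem IsDeferred.toggled_subset {e : C} {v : χ.TreeVertex T} {S : χ.EnhancedSubgraph}
    (h : χ.IsDeferred T e v S) (hS : χ.toggled T S.H ⊆ R) :
    χ.toggled T S.H ⊆ (R.erase e : Finset C) := by
  intro c hc
  rw [Finset.coe_erase]
  exact ⟨hS hc, fun hce => h.1 ((inTreeSubgraph_iff S e).2 (hce ▸ hc))⟩

end Basic

section Tree

variable [Finite Arc] [Fintype C] [LinearOrder C] {dot : Arc} {T : Finset C}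

/-- Induction on the rooted subtrees of `G(T)` by removing the least leaf. -/
@[elab_as_elim]
theorem IsRootedSubtree.induction {P : Finset C → Prop} (empty : χ.IsSpanningTree T → P ∅)
    (step : ∀ (R : Finset C) (e : C) (v : χ.TreeVertex T), χ.IsRootedSubtree dot T R →
      χ.IsLeastLeaf dot T R e v → P (R.erase e) → P R)
    {R : Finset C} (hR : χ.IsRootedSubtree dot T R) : P R := by
  induction R using Finset.strongInduction with
  | H R ih =>
    rcases R.eq_empty_or_nonempty with rfl | hne
    · exact empty hR.isSpanningTree
    · obtain ⟨e, v, hl⟩ := exists_isLeastLeaf hR hne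
      exact step R e v hR hl (ih _ (Finset.erase_ssubset hl.1.1) (hR.erase hl.1))

variable {R : Finset C}

/-- The root label and the labels away from the tree are not changed by the matching, nor are the
smoothings outside of the tree. -/
theorem Matched.preserves (hR : χ.IsRootedSubtree dot T R) :
    ∀ S S' : χ.EnhancedSubgraph, χ.Matched dot T R S S' → χ.toggled T S.H ⊆ R →
      χ.toggled T S'.H ⊆ R ∧ S'.lab dot = S.lab dot ∧
        ∀ a, ¬ EdgeConn (χ.face₁ (χ.treeState T)) (χ.face₂ (χ.treeState T)) (R : Set C)
          (χ.face (χ.treeState T) a) (χ.face (χ.treeState T) dot) → S'.lab a = S.lab a := by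
  refine IsRootedSubtree.induction ?_ ?_ hR
  · exact fun _ S S' h => (not_matched_empty S S' h).elim
  · intro R e v hR hl ih S S' h hS
    have hdot : χ.face (χ.treeState T) dot ≠ v := hl.1.2.1.symm
    have hv := hR.isRooted.conn_of_incident hl.1.1 hl.1.2.2.1
    rcases (matched_iff hR hl S S').1 h with h | h | ⟨h1, h2, h3⟩
    · refine ⟨?_, h.lab_eq hdot, fun a ha => h.lab_eq ?_⟩
      · rw [h.toggled_eq] at hS
        exact (Set.subset_insert _ _).trans hS
      · rintro rfl
        exact ha hv
    · refine ⟨?_, (h.lab_eq hdot).symm, fun a ha => (h.lab_eq ?_).symm⟩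
      · rw [h.toggled_eq]
        exact Set.insert_subset hl.1.1 hS
      · rintro rfl
        exact ha hv
    · obtain ⟨h4, h5, h6⟩ := ih S S' h3 (h1.toggled_subset hS)
      refine ⟨h4.trans (Finset.coe_subset.2 (Finset.erase_subset e R)), h5, fun a ha => h6 a ?_⟩
      rw [Finset.coe_erase]
      exact fun h => ha ((hl.1.isPendant.conn_root_iff _).1 h).1

/-- Every state has at most one partner. -/
theorem Matched.unique (hR : χ.IsRootedSubtree dot T R) :
    ∀ S S₁ S₂ : χ.EnhancedSubgraph, χ.toggled T S.H ⊆ R → χ.Matched dot T R S S₁ →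
      χ.Matched dot T R S S₂ → S₁ = S₂ := by
  refine IsRootedSubtree.induction ?_ ?_ hR
  · exact fun _ S S₁ _ _ h => (not_matched_empty S S₁ h).elim
  · intro R e v hR hl ih S S₁ S₂ hS h₁ h₂
    rcases (matched_iff hR hl S S₁).1 h₁ with h₁ | h₁ | ⟨hd, -, h₁⟩ <;>
      rcases (matched_iff hR hl S S₂).1 h₂ with h₂ | h₂ | ⟨hd', -, h₂⟩
    · exact h₁.unique_right h₂
    · exact (h₂.2.1 h₁.1).elim
    · exact (hd'.not_isLeafRemoval_left h₁).elim
    · exact (h₁.2.1 h₂.1).elim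
    · exact h₁.unique_left hR hl.1 hS h₂
    · exact (hd'.not_isLeafRemoval_right h₁).elim
    · exact (hd.not_isLeafRemoval_left h₂).elim
    · exact (hd.not_isLeafRemoval_right h₂).elim
    · exact ih S S₁ S₂ (hd.toggled_subset hS) h₁ h₂

theorem TreeMatching.isTerm (hR : χ.IsRootedSubtree dot T R) :
    ∀ S S' : χ.EnhancedSubgraph, χ.TreeMatching dot T R S S' → χ.toggled T S.H ⊆ R →
      ∃ e, S.IsTerm S' e := by
  refine IsRootedSubtree.induction ?_ ?_ hR
  · exact fun _ S S' h => (not_treeMatching_empty S S' h).elim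
  · intro R e v hR hl ih S S' h hS
    rcases (treeMatching_iff hR hl S S').1 h with ⟨hB, h⟩ | ⟨hA, h⟩ | ⟨h1, h2, h3⟩
    · exact ⟨e, ((isLeafRemoval_iff_isTerm_of_B hR hl.1 hB hS).1 h).1⟩
    · have hS' : χ.toggled T S'.H ⊆ R := by
        rw [h.toggled_eq]
        exact Set.insert_subset hl.1.1 hS
      exact ⟨e, ((isLeafRemoval_iff_isTerm_of_A hR hl.1 hA hS').1 h).1⟩
    · exact ih S S' h3 (h1.toggled_subset hS)

theorem IsRootedSubtree.hasLabel_iff (hR : χ.IsRootedSubtree dot T R) {S : χ.EnhancedSubgraph}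
    (hS : χ.toggled T S.H ⊆ R) (a : Arc) (l : Label) :
    χ.HasLabel T S (χ.face (χ.treeState T) a) l ↔ S.lab a = l :=
  ⟨fun h => h a rfl, fun h _ hb =>
    (lab_congr (face_eq_of_treeState hR.isSpanningTree (hS.trans hR.isLive) hb)).trans h⟩

/-- Every state is contained in a leaf removal, or it is deferred to the smaller tree. -/
theorem exists_isLeafRemoval_or_isDeferred (hR : χ.IsRootedSubtree dot T R) {e : C}
    {v : χ.TreeVertex T} (hl : χ.IsLeaf dot T R e v) {S : χ.EnhancedSubgraph}
    (hS : χ.toggled T S.H ⊆ R) :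
    (∃ S', χ.IsLeafRemoval T e v (χ.leafLabel T e) S S') ∨
      (∃ S', χ.IsLeafRemoval T e v (χ.leafLabel T e) S' S) ∨ χ.IsDeferred T e v S := by
  by_cases he : χ.InTreeSubgraph T S e
  · exact Or.inl (exists_isLeafRemoval hR hl _ hS he)
  · obtain ⟨a, rfl⟩ := Quot.exists_rep v
    have h1 := hR.hasLabel_iff hS a
    by_cases h : S.lab a = χ.leafLabel T e
    · exact Or.inr (Or.inl (exists_isLeafRemoval_of_hasLabel hR hl hS he ((h1 _).2 h)))
    · refine Or.inr (Or.inr ⟨he, (h1 _).2 ?_⟩)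
      cases h2 : S.lab a <;> cases h3 : χ.leafLabel T e <;> simp_all [Label.other]

/-- With prescribed labels of the vertices away from the tree, exactly one state is unmatched. -/
theorem existsUnique_unmatched (hR : χ.IsRootedSubtree dot T R) :
    ∀ f : χ.TreeVertex T → Label, ∃! S : χ.EnhancedSubgraph, χ.toggled T S.H ⊆ R ∧
      S.lab dot = .one ∧
      (∀ a, ¬ EdgeConn (χ.face₁ (χ.treeState T)) (χ.face₂ (χ.treeState T)) (R : Set C)
        (χ.face (χ.treeState T) a) (χ.face (χ.treeState T) dot) →
        S.lab a = f (χ.face (χ.treeState T) a)) ∧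
      ∀ S', ¬ χ.Matched dot T R S S' := by
  classical
  refine IsRootedSubtree.induction ?_ ?_ hR
  · intro hT f
    have hconn : ∀ a, EdgeConn (χ.face₁ (χ.treeState T)) (χ.face₂ (χ.treeState T))
        ((∅ : Finset C) : Set C) (χ.face (χ.treeState T) a) (χ.face (χ.treeState T) dot) ↔
        χ.face (χ.treeState T) a = χ.face (χ.treeState T) dot := fun a =>
      ⟨fun h => h.symm.eq_of_isolated (by simp), fun h => h ▸ EdgeConn.refl _ _⟩
    obtain ⟨S, hSH, hS⟩ := exists_of_lab χ (χ.treeState T)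
      (fun a => if χ.face (χ.treeState T) a = χ.face (χ.treeState T) dot then .one
        else f (χ.face (χ.treeState T) a)) fun a b h => by simp only [h]
    refine ⟨S, ⟨?_, ?_, fun a ha => ?_, not_matched_empty S⟩, ?_⟩
    · rw [hSH, toggled_treeState]
      exact Set.empty_subset _
    · rw [hS, if_pos rfl]
    · rw [hS, if_neg (mt (hconn a).2 ha)]
    · rintro S' ⟨h1, h2, h3, -⟩
      have hSH' : S'.H = χ.treeState T := eq_of_toggled_eq (by
        rw [toggled_treeState]
        exact Set.subset_empty_iff.1 (by simpa using h1))
      refine ext_lab (hSH'.trans hSH.symm) fun a => ?_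
      rw [hS]
      split_ifs with h
      · rw [← h2]
        exact lab_congr (by rw [hSH']; exact h)
      · exact h3 a (mt (hconn a).1 h)
  · intro R e v hR hl ih f
    have hroot : ∀ x, EdgeConn (χ.face₁ (χ.treeState T)) (χ.face₂ (χ.treeState T))
        ((R.erase e : Finset C) : Set C) x (χ.face (χ.treeState T) dot) ↔
        EdgeConn (χ.face₁ (χ.treeState T)) (χ.face₂ (χ.treeState T)) (R : Set C) x
          (χ.face (χ.treeState T) dot) ∧ x ≠ v := by
      intro x
      rw [Finset.coe_erase]
      exact hl.1.isPendant.conn_root_iff x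
    have hsub : ((R.erase e : Finset C) : Set C) ⊆ R :=
      Finset.coe_subset.2 (Finset.erase_subset e R)
    have hvroot := hR.isRooted.conn_of_incident hl.1.1 hl.1.2.2.1
    obtain ⟨S, ⟨h1, h2, h3, h4⟩, hu⟩ := ih (Function.update f v (χ.leafLabel T e).other)
    have hd : χ.IsDeferred T e v S := by
      refine ⟨fun h => ?_, fun a ha => ?_⟩
      · exact Finset.notMem_erase e R (h1 ((inTreeSubgraph_iff S e).1 h))
      · refine (h3 a fun h => ((hroot _).1 h).2 ha).trans ?_
        rw [ha, Function.update_self]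
    refine ⟨S, ⟨h1.trans hsub, h2, fun a ha => ?_, fun S' h => ?_⟩, ?_⟩
    · rw [h3 a fun h => ha ((hroot _).1 h).1, Function.update_of_ne]
      exact fun h => ha (h ▸ hvroot)
    · rcases (matched_iff hR hl S S').1 h with h | h | ⟨-, -, h⟩
      · exact hd.not_isLeafRemoval_left h
      · exact hd.not_isLeafRemoval_right h
      · exact h4 S' h
    · rintro S' ⟨h1', h2', h3', h4'⟩
      have hd' : χ.IsDeferred T e v S' := by
        rcases exists_isLeafRemoval_or_isDeferred hR hl.1 h1' with ⟨S'', h⟩ | ⟨S'', h⟩ | h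
        · exact (h4' S'' ((matched_iff hR hl _ _).2 (Or.inl h))).elim
        · exact (h4' S'' ((matched_iff hR hl _ _).2 (Or.inr (Or.inl h)))).elim
        · exact h
      have hs' := hd'.toggled_subset h1'
      refine hu S' ⟨hs', h2', fun a ha => ?_, fun S'' h => ?_⟩
      · by_cases hav : χ.face (χ.treeState T) a = v
        · rw [hav, Function.update_self]
          exact hd'.2 a hav
        · rw [Function.update_of_ne hav]
          exact h3' a fun h => ha ((hroot _).2 ⟨h, hav⟩)
      · obtain ⟨h5, -, h6⟩ := Matched.preserves (hR.erase hl.1) S' S'' h hs'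
        refine h4' S'' ((matched_iff hR hl _ _).2 (Or.inr (Or.inr ⟨hd', ⟨fun h7 => ?_, ?_⟩, h⟩)))
        · exact Finset.notMem_erase e R (h5 ((inTreeSubgraph_iff S'' e).1 h7))
        · intro a ha
          refine (h6 a fun h7 => ((hroot _).1 h7).2 ha).trans (hd'.2 a ha)

end Tree

end ConnectedLinkDiagram.Checkerboard

/-! ### Acyclicity -/

/-- A relation along which `f` weakly increases has no cycle if it has none on which `f` is
constant. -/
theorem not_transGen_of_monotone {V A : Type*} [PartialOrder A] {r : V → V → Prop} (f : V → A)
    (h : ∀ a b, r a b → f a ≤ f b)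
    (h' : ∀ a, ¬ Relation.TransGen (fun a b => r a b ∧ f a = f b) a a) (a : V) :
    ¬ Relation.TransGen r a a := by
  have h1 : ∀ {a b}, Relation.TransGen r a b → f a ≤ f b := by
    intro a b hab
    induction hab with
    | single hab => exact h _ _ hab
    | tail _ hbc ih => exact ih.trans (h _ _ hbc)
  have h2 : ∀ {a b}, Relation.TransGen r a b → f b ≤ f a →
      Relation.TransGen (fun a b => r a b ∧ f a = f b) a b := by
    intro a b hab
    induction hab with
    | single hab => exact fun hba => .single ⟨hab, (h _ _ hab).antisymm hba⟩
    | tail hab hbc ih =>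
      intro hca
      have h3 := h _ _ hbc
      exact (ih (h3.trans hca)).tail ⟨hbc, h3.antisymm (hca.trans (h1 hab))⟩
  exact fun ha => h' a (h2 ha le_rfl)

namespace ConnectedLinkDiagram.Checkerboard

open EnhancedSubgraph

variable {Arc C : Type*} {D : ConnectedLinkDiagram Arc C} {χ : D.Checkerboard}

section Level

variable [Fintype C] [LinearOrder C] {dot : Arc} {T R : Finset C} {e : C} {v : χ.TreeVertex T}

open Classical in
/-- The states in which the leaf is isolated with the label `x`, those that contain the leaf edge,
and those in which the leaf is isolated with the label `1`, are numbered `0`, `1`, `2`. This number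
weakly increases along the differential and the reversed edges of the matching. -/
noncomputable def leafLevel (T : Finset C) (e : C) (v : χ.TreeVertex T) (S : χ.EnhancedSubgraph) :
    ℕ :=
  if χ.InTreeSubgraph T S e then 1 else if χ.HasLabel T S v .x then 0 else 2

theorem leafLevel_eq_one {S : χ.EnhancedSubgraph} (h : χ.InTreeSubgraph T S e) :
    leafLevel T e v S = 1 := if_pos h

theorem leafLevel_eq_zero {S : χ.EnhancedSubgraph} (h : ¬ χ.InTreeSubgraph T S e)
    (h' : χ.HasLabel T S v .x) : leafLevel T e v S = 0 := by
  rw [leafLevel, if_neg h, if_pos h']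

theorem leafLevel_eq_two {S : χ.EnhancedSubgraph} (h : ¬ χ.InTreeSubgraph T S e)
    (h' : ¬ χ.HasLabel T S v .x) : leafLevel T e v S = 2 := by
  rw [leafLevel, if_neg h, if_neg h']

theorem not_hasLabel_x {S : χ.EnhancedSubgraph} (h : χ.HasLabel T S v .one) :
    ¬ χ.HasLabel T S v .x := fun h' => by cases h.unique h'

/-- An edge of the Hasse diagram, with the matching on the subtree `R` reversed, between states
whose subgraphs of `G(T)` are contained in `R`. -/
def TreeEdge (χ : D.Checkerboard) (dot : Arc) (T R : Finset C) (S S' : χ.EnhancedSubgraph) : Prop :=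
  χ.toggled T S.H ⊆ R ∧ χ.toggled T S'.H ⊆ R ∧
    (((∃ f, S.IsTerm S' f) ∧ ¬ χ.TreeMatching dot T R S S') ∨ χ.TreeMatching dot T R S' S)

theorem mem_toggled_of_toggle {H H' : Finset C} {c f : C} (h : IsToggle H H' f) (hc : c ≠ f) :
    c ∈ χ.toggled T H' ↔ c ∈ χ.toggled T H := by
  change ¬ _ ↔ ¬ _
  rw [h.1 c hc]

end Level

section TreeEdge

variable [Finite Arc] [Fintype C] [LinearOrder C] {dot : Arc} {T R : Finset C} {e : C}
  {v : χ.TreeVertex T}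

theorem isDeferred_iff_leafLevel (hR : χ.IsRootedSubtree dot T R) {S : χ.EnhancedSubgraph}
    (hS : χ.toggled T S.H ⊆ R) :
    χ.IsDeferred T e v S ↔ leafLevel T e v S = if χ.leafLabel T e = .one then 0 else 2 := by
  obtain ⟨a, rfl⟩ := Quot.exists_rep v
  have h1 : ∀ l, χ.HasLabel T S (Quot.mk _ a) l ↔ S.lab a = l := fun l => hR.hasLabel_iff hS a l
  unfold IsDeferred leafLevel
  simp only [h1]
  by_cases h2 : χ.InTreeSubgraph T S e <;> cases h3 : S.lab a <;>
    cases h4 : χ.leafLabel T e <;> simp [h2, Label.other]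

/-- The only edges that could lower the level are those at the leaf edge `e`. For a negative twist
they lead from `1` to `0` or `2`, and those to `0` are the matched ones, which are reversed; for a
positive twist they lead from `0` or `2` to `1`, and those from `2` are reversed. -/
theorem leafLevel_mono (hR : χ.IsRootedSubtree dot T R) (hl : χ.IsLeastLeaf dot T R e v)
    {S S' : χ.EnhancedSubgraph} (h : χ.TreeEdge dot T R S S') :
    leafLevel T e v S ≤ leafLevel T e v S' := by
  obtain ⟨hS, hS', ⟨⟨f, hf⟩, hM⟩ | hM⟩ := h
  · have htog := hf.toggle
    by_cases hfe : e = f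
    · subst hfe
      cases hs : χ.treeSmoothing T e
      · have h1 : ¬ χ.InTreeSubgraph T S e :=
          not_not.2 ((mem_aEdges_iff_res.1 hf.1).trans hs.symm)
        have h2 : χ.HasLabel T S v .x := by
          obtain ⟨a, rfl⟩ := Quot.exists_rep v
          refine (hR.hasLabel_iff hS a _).2 ?_
          cases h3 : S.lab a
          · refine (hM ((treeMatching_iff hR hl S S').2 (Or.inr (Or.inl ⟨hs, ?_⟩)))).elim
            exact (isLeafRemoval_iff_isTerm_of_A hR hl.1 hs hS').2
              ⟨hf, (hR.hasLabel_iff hS a _).2 h3⟩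
          · rfl
        rw [leafLevel_eq_zero h1 h2]
        exact Nat.zero_le _
      · have h1 : χ.InTreeSubgraph T S e := by
          unfold InTreeSubgraph
          rw [mem_aEdges_iff_res.1 hf.1, hs]
          decide
        have h2 : ¬ χ.HasLabel T S' v .x := fun h =>
          hM ((treeMatching_iff hR hl S S').2 (Or.inl ⟨hs,
            (isLeafRemoval_iff_isTerm_of_B hR hl.1 hs hS).2 ⟨hf, h⟩⟩))
        rw [leafLevel_eq_one h1]
        unfold leafLevel
        rw [if_neg h2]
        split_ifs <;> omega
    · have h1 : χ.InTreeSubgraph T S' e ↔ χ.InTreeSubgraph T S e := by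
        rw [inTreeSubgraph_iff, inTreeSubgraph_iff, mem_toggled_of_toggle htog hfe]
      unfold leafLevel
      by_cases h2 : χ.InTreeSubgraph T S e
      · rw [if_pos h2, if_pos (h1.2 h2)]
      · rw [if_neg h2, if_neg (mt h1.1 h2)]
        by_cases h3 : χ.HasLabel T S v .x
        · rw [if_pos h3]
          exact Nat.zero_le _
        · -- The isolated leaf is not touched by the change of `f`.
          have h4 : ¬ χ.HasLabel T S' v .x := by
            obtain ⟨a, rfl⟩ := Quot.exists_rep v
            have hfR : f ∈ R := by
              by_cases hft : f ∈ χ.toggled T S.H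
              · exact hS hft
              · refine hS' ?_
                rw [htog.symm.toggled_eq hft]
                exact Or.inl rfl
            have h5 : ∀ b, (b = D.arc f 0 ∨ b = D.arc f 2) → χ.face S.H a ≠ χ.face S.H b := by
              intro b hb h6
              have h7 := hl.1.isolated hR hS (mt (inTreeSubgraph_iff S e).2 h2) rfl h6
              refine hfe (hl.1.2.2.2 f hfR ?_).symm
              rcases hb with rfl | rfl
              · exact Or.inl h7.symm
              · exact Or.inr h7.symm
            intro h6
            have h8 := (isTerm_iff.1 hf).2.2.1 a (h5 _ (Or.inl rfl)) (h5 _ (Or.inr rfl))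
            have h9 : S'.lab a = .x := h6 a rfl
            exact h3 ((hR.hasLabel_iff hS a _).2 (h8.symm.trans h9))
          rw [if_neg h3, if_neg h4]
  · rcases (treeMatching_iff hR hl S' S).1 hM with ⟨-, h⟩ | ⟨-, h⟩ | ⟨h1, h2, -⟩
    · rw [leafLevel_eq_zero h.2.1 h.2.2.2.1]
      exact Nat.zero_le _
    · rw [leafLevel_eq_one h.1, leafLevel_eq_two h.2.1 (not_hasLabel_x h.2.2.2.1)]
      exact Nat.le_succ 1
    · rw [(isDeferred_iff_leafLevel hR hS).1 h2, (isDeferred_iff_leafLevel hR hS').1 h1]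

/-- There are no cycles within a twisted unknot. -/
theorem not_transGen_treeEdge (hR : χ.IsRootedSubtree dot T R) :
    ∀ S, ¬ Relation.TransGen (χ.TreeEdge dot T R) S S := by
  refine IsRootedSubtree.induction ?_ ?_ hR
  · intro _ S h
    obtain ⟨S', ⟨h1, h2, ⟨⟨f, hf⟩, -⟩ | h3⟩, -⟩ := Relation.TransGen.head'_iff.1 h
    · have h3 : f ∉ χ.toggled T S.H := fun h => by simpa using h1 h
      have h4 : f ∈ χ.toggled T S'.H := by
        rw [hf.toggle.symm.toggled_eq h3]
        exact Or.inl rfl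
      simpa using h2 h4
    · exact not_treeMatching_empty _ _ h3
  · intro R e v hR hl ih
    refine not_transGen_of_monotone (leafLevel T e v) (fun S S' h => leafLevel_mono hR hl h) ?_
    intro S hSS
    by_cases hd : χ.IsDeferred T e v S
    · have key : ∀ S', Relation.TransGen (fun S S' => χ.TreeEdge dot T R S S' ∧
          leafLevel T e v S = leafLevel T e v S') S S' →
          χ.IsDeferred T e v S' ∧ Relation.TransGen (χ.TreeEdge dot T (R.erase e)) S S' := by
        have hstep : ∀ {S S'}, χ.IsDeferred T e v S → χ.TreeEdge dot T R S S' →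
            leafLevel T e v S = leafLevel T e v S' →
            χ.IsDeferred T e v S' ∧ χ.TreeEdge dot T (R.erase e) S S' := by
          rintro S S' hd ⟨hS, hS', h⟩ heq
          have hd' : χ.IsDeferred T e v S' := by
            rw [isDeferred_iff_leafLevel hR hS', ← heq, ← isDeferred_iff_leafLevel hR hS]
            exact hd
          refine ⟨hd', hd.toggled_subset hS, hd'.toggled_subset hS', ?_⟩
          rcases h with ⟨hf, hM⟩ | hM
          · exact Or.inl ⟨hf, fun h => hM ((treeMatching_iff hR hl S S').2
              (Or.inr (Or.inr ⟨hd, hd', h⟩)))⟩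
          · rcases (treeMatching_iff hR hl S' S).1 hM with ⟨-, h⟩ | ⟨-, h⟩ | ⟨-, -, h⟩
            · exact (hd'.1 h.1).elim
            · exact (hd.1 h.1).elim
            · exact Or.inr h
        intro S' h
        induction h with
        | single h => exact ⟨(hstep hd h.1 h.2).1, .single (hstep hd h.1 h.2).2⟩
        | tail _ h ih' =>
          have h1 := hstep ih'.1 h.1 h.2
          exact ⟨h1.1, ih'.2.tail h1.2⟩
      exact ih S (key S hSS).2
    · have key : ∀ S', Relation.TransGen (fun S S' => χ.TreeEdge dot T R S S' ∧
          leafLevel T e v S = leafLevel T e v S') S S' →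
          ¬ χ.IsDeferred T e v S' ∧ S.iDeg < S'.iDeg := by
        have hstep : ∀ {S S'}, ¬ χ.IsDeferred T e v S → χ.TreeEdge dot T R S S' →
            leafLevel T e v S = leafLevel T e v S' →
            ¬ χ.IsDeferred T e v S' ∧ S.iDeg < S'.iDeg := by
          rintro S S' hd ⟨hS, hS', h⟩ heq
          refine ⟨?_, ?_⟩
          · rw [isDeferred_iff_leafLevel hR hS', ← heq, ← isDeferred_iff_leafLevel hR hS]
            exact hd
          · rcases h with ⟨⟨f, hf⟩, -⟩ | hM
            · rw [iDeg_of_toggle hf.toggle hf.1]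
              exact lt_add_one _
            · rcases (treeMatching_iff hR hl S' S).1 hM with ⟨-, h⟩ | ⟨-, h⟩ | ⟨-, h, -⟩
              · rw [leafLevel_eq_one h.1, leafLevel_eq_zero h.2.1 h.2.2.2.1] at heq
                cases heq
              · rw [leafLevel_eq_one h.1, leafLevel_eq_two h.2.1 (not_hasLabel_x h.2.2.2.1)] at heq
                cases heq
              · exact (hd h).elim
        intro S' h
        induction h with
        | single h => exact hstep hd h.1 h.2
        | tail _ h ih' =>
          have h1 := hstep ih'.1 h.1 h.2
          exact ⟨h1.1, ih'.2.trans h1.2⟩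
      exact lt_irrefl _ (key S hSS).2

end TreeEdge

end ConnectedLinkDiagram.Checkerboard

namespace ConnectedLinkDiagram.Checkerboard

open EnhancedSubgraph BasedComplex

variable {Arc C : Type*} {D : ConnectedLinkDiagram Arc C} {χ : D.Checkerboard}

/-! ### The matching on the reduced Khovanov complex -/

theorem IsTerm.edge_unique {S S' : χ.EnhancedSubgraph} {e f : C}
    (he : S.IsTerm S' e) (hf : S.IsTerm S' f) : e = f := by
  by_contra hef
  have h1 := he.toggle.2
  have h2 := hf.toggle.1 e hef
  tauto

section Inc

variable [Fintype C] [LinearOrder C] {S S' : χ.EnhancedSubgraph}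

theorem inc_of_isTerm {e : C} (h : S.IsTerm S' e) : S.inc S' = (-1) ^ S.signExponent e := by
  unfold EnhancedSubgraph.inc
  rw [Finset.sum_eq_single e, if_pos h]
  · exact fun f _ hfe => if_neg fun hf => hfe (IsTerm.edge_unique hf h)
  · exact fun h => (h (Finset.mem_univ e)).elim

theorem exists_isTerm_of_inc_ne_zero (h : S.inc S' ≠ 0) : ∃ e, S.IsTerm S' e := by
  obtain ⟨e, -, he⟩ := Finset.exists_ne_zero_of_sum_ne_zero h
  by_contra h1
  exact he (if_neg fun h2 => h1 ⟨e, h2⟩)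

theorem isUnit_inc_of_isTerm {e : C} (h : S.IsTerm S' e) : IsUnit (S.inc S') := by
  rw [inc_of_isTerm h]
  exact isUnit_one.neg.pow _

end Inc

section Order

variable [Fintype C] [LinearOrder C] {T : Finset C}

/-- Every state belongs to at most one twisted unknot. -/
theorem spanningTree_unique {T' H : Finset C} (hT : χ.IsSpanningTree T) (hT' : χ.IsSpanningTree T')
    (h : χ.toggled T H ⊆ {c | χ.IsLive T c}) (h' : χ.toggled T' H ⊆ {c | χ.IsLive T' c}) :
    T = T' :=
  Finset.coe_injective ((baseOf_eq_tree hT h).symm.trans (baseOf_eq_tree hT' h'))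

theorem coe_liveEdges (χ : D.Checkerboard) (T : Finset C) :
    ((χ.liveEdges T : Finset C) : Set C) = {c | χ.IsLive T c} := by
  ext c; simp [liveEdges]

open Classical in
/-- The inactive crossings with a `B`-smoothing. In the colexicographic order, this set increases
along the edges of the Hasse diagram that lead from one twisted unknot to another one. -/
noncomputable def deadB (S : χ.EnhancedSubgraph) : Finset C :=
  Finset.univ.filter fun e => ¬ (ExtActive χ.cycleClosure (S.H : Set C) e ∨
    IntActive χ.cycleClosure (S.H : Set C) e) ∧ e ∉ S.aEdges

theorem mem_deadB_iff (S : χ.EnhancedSubgraph) (e : C) :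
    e ∈ deadB S ↔ ¬ (ExtActive χ.cycleClosure (S.H : Set C) e ∨
      IntActive χ.cycleClosure (S.H : Set C) e) ∧ e ∉ S.aEdges := by
  simp [deadB]

theorem deadB_congr (hT : χ.IsSpanningTree T) {S S' : χ.EnhancedSubgraph}
    (h : χ.toggled T S.H ⊆ {c | χ.IsLive T c}) (h' : χ.toggled T S'.H ⊆ {c | χ.IsLive T c}) :
    deadB S = deadB S' := by
  ext e
  rw [mem_deadB_iff, mem_deadB_iff, ← isLive_iff_of_toggled hT h, ← isLive_iff_of_toggled hT h']
  refine and_congr_right fun he => ?_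
  rw [mem_aEdges_iff, mem_aEdges_iff, ← mem_iff_of_dead h he, ← mem_iff_of_dead h' he]

/-- If the differential changes the smoothing of an inactive crossing, it leads to another twisted
unknot, and `deadB` increases: `c` is added, and only crossings below `c` can be lost. -/
theorem deadB_lt (hT : χ.IsSpanningTree T) {S S' : χ.EnhancedSubgraph}
    (h : χ.toggled T S.H ⊆ {c | χ.IsLive T c}) {c : C} (hc : S.IsTerm S' c) (hd : ¬ χ.IsLive T c) :
    toColex (deadB S) < toColex (deadB S') := by
  -- The activity of an edge depends only on the edges above it in the state.
  have hact : ∀ e, c ≤ e → ((ExtActive χ.cycleClosure (S'.H : Set C) e ∨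
      IntActive χ.cycleClosure (S'.H : Set C) e) ↔ (ExtActive χ.cycleClosure (S.H : Set C) e ∨
      IntActive χ.cycleClosure (S.H : Set C) e)) := by
    intro e hce
    have h1 : {x ∈ (S'.H : Set C) | e < x} = {x ∈ (S.H : Set C) | e < x} := by
      ext x
      refine and_congr_left fun hx => ?_
      exact hc.toggle.1 x (hce.trans_lt hx).ne'
    unfold ExtActive IntActive
    rw [h1]
  have hA := notMem_aEdges_of_toggle hc.toggle hc.1
  rw [isLive_iff_of_toggled hT h] at hd
  rw [Finset.Colex.toColex_lt_toColex_iff_exists_forall_lt]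
  refine ⟨c, ?_, ?_, fun b hb hb' => ?_⟩
  · rw [mem_deadB_iff, hact c le_rfl]
    exact ⟨hd, (hA c).2 (Or.inl rfl)⟩
  · rw [mem_deadB_iff]
    exact fun h => h.2 hc.1
  · by_contra hbc
    rw [mem_deadB_iff] at hb hb'
    rw [hact b (not_lt.1 hbc)] at hb'
    exact hb' ⟨hb.1, (hA b).2 (Or.inr hb.2)⟩

theorem exists_inTwistedUnknot (S : χ.EnhancedSubgraph) :
    ∃ T : χ.SpanningTree, χ.toggled T.1 S.H ⊆ {c | χ.IsLive T.1 c} :=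
  let ⟨T, hT, h⟩ := exists_spanningTree χ S.H
  ⟨⟨T, hT⟩, h⟩

end Order

section Main

variable [Finite Arc] [Fintype C] [LinearOrder C] {dot : Arc}

theorem khovanovMatching_iff (T : χ.SpanningTree) {S S' : χ.ReducedSubgraph dot}
    (hS : χ.toggled T.1 S.1.H ⊆ {c | χ.IsLive T.1 c}) :
    χ.khovanovMatching dot S S' ↔ χ.TreeMatching dot T.1 (χ.liveEdges T.1) S.1 S'.1 := by
  constructor
  · rintro ⟨T', h, -, h'⟩
    rw [inTwistedUnknot_iff] at h
    rwa [spanningTree_unique T.2 T'.2 hS h]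
  · intro h
    rw [← coe_liveEdges] at hS
    have h1 := (Matched.preserves (isRootedSubtree_liveEdges T.2 dot) _ _ (Or.inl h) hS).1
    rw [coe_liveEdges] at hS h1
    exact ⟨T, (inTwistedUnknot_iff _).2 hS, (inTwistedUnknot_iff _).2 h1, h⟩

theorem khovanovMatching_iff_right (T : χ.SpanningTree) {S S' : χ.ReducedSubgraph dot}
    (hS : χ.toggled T.1 S'.1.H ⊆ {c | χ.IsLive T.1 c}) :
    χ.khovanovMatching dot S S' ↔ χ.TreeMatching dot T.1 (χ.liveEdges T.1) S.1 S'.1 := by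
  constructor
  · rintro ⟨T', -, h, h'⟩
    rw [inTwistedUnknot_iff] at h
    rwa [spanningTree_unique T.2 T'.2 hS h]
  · intro h
    rw [← coe_liveEdges] at hS
    have h1 := (Matched.preserves (isRootedSubtree_liveEdges T.2 dot) _ _ (Or.inr h) hS).1
    rw [coe_liveEdges] at hS h1
    exact ⟨T, (inTwistedUnknot_iff _).2 h1, (inTwistedUnknot_iff _).2 hS, h⟩

theorem isTerm_of_khovanovMatching {S S' : χ.ReducedSubgraph dot}
    (h : χ.khovanovMatching dot S S') : ∃ e, S.1.IsTerm S'.1 e := by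
  obtain ⟨T, h1, -, h2⟩ := h
  rw [inTwistedUnknot_iff, ← coe_liveEdges] at h1
  exact TreeMatching.isTerm (isRootedSubtree_liveEdges T.2 dot) _ _ h2 h1

theorem khovanovMatching_unique {S S₁ S₂ : χ.ReducedSubgraph dot}
    (h₁ : χ.khovanovMatching dot S S₁ ∨ χ.khovanovMatching dot S₁ S)
    (h₂ : χ.khovanovMatching dot S S₂ ∨ χ.khovanovMatching dot S₂ S) : S₁ = S₂ := by
  obtain ⟨T, hS⟩ := exists_inTwistedUnknot S.1
  rw [khovanovMatching_iff T hS, khovanovMatching_iff_right T hS] at h₁ h₂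
  rw [← coe_liveEdges] at hS
  exact Subtype.ext (Matched.unique (isRootedSubtree_liveEdges T.2 dot) _ _ _ hS h₁ h₂)

theorem not_transGen_morseEdge (S : χ.ReducedSubgraph dot) :
    ¬ Relation.TransGen ((χ.reducedKhovanov dot).MorseEdge (χ.khovanovMatching dot)) S S := by
  -- An edge of the modified Hasse diagram either stays in one twisted unknot or increases `deadB`.
  have key : ∀ {S S' : χ.ReducedSubgraph dot} (T : χ.SpanningTree),
      χ.toggled T.1 S.1.H ⊆ {c | χ.IsLive T.1 c} →
      (χ.reducedKhovanov dot).MorseEdge (χ.khovanovMatching dot) S S' →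
      (χ.TreeEdge dot T.1 (χ.liveEdges T.1) S.1 S'.1 ∧ deadB S.1 = deadB S'.1) ∨
        toColex (deadB S.1) < toColex (deadB S'.1) := by
    rintro S S' T hS (⟨⟨-, hinc⟩, hM⟩ | hM)
    · obtain ⟨c, hc⟩ := exists_isTerm_of_inc_ne_zero hinc
      by_cases hlive : χ.IsLive T.1 c
      · have hS' : χ.toggled T.1 S'.1.H ⊆ {c | χ.IsLive T.1 c} := by
          intro b hb
          by_cases hbc : b = c
          · exact hbc ▸ hlive
          · exact hS ((mem_toggled_of_toggle hc.toggle hbc).1 hb)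
        refine Or.inl ⟨⟨?_, ?_, Or.inl ⟨⟨c, hc⟩, ?_⟩⟩, deadB_congr T.2 hS hS'⟩
        · rwa [coe_liveEdges]
        · rwa [coe_liveEdges]
        · rwa [khovanovMatching_iff T hS] at hM
      · exact Or.inr (deadB_lt T.2 hS hc hlive)
    · obtain ⟨T', h', h, hM⟩ := hM
      rw [inTwistedUnknot_iff] at h h'
      obtain rfl : T = T' := Subtype.ext (spanningTree_unique T.2 T'.2 hS h)
      refine Or.inl ⟨⟨?_, ?_, Or.inr hM⟩, deadB_congr T.2 hS h'⟩
      · rwa [coe_liveEdges]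
      · rwa [coe_liveEdges]
  refine not_transGen_of_monotone (fun S => toColex (deadB S.1)) (fun S S' h => ?_)
    (fun S h => ?_) S
  · obtain ⟨T, hS⟩ := exists_inTwistedUnknot S.1
    rcases key T hS h with h | h
    · exact le_of_eq (congrArg toColex h.2)
    · exact h.le
  · obtain ⟨T, hS⟩ := exists_inTwistedUnknot S.1
    have h1 : ∀ S', Relation.TransGen (fun S S' =>
        (χ.reducedKhovanov dot).MorseEdge (χ.khovanovMatching dot) S S' ∧
          toColex (deadB S.1) = toColex (deadB S'.1)) S S' →
        Relation.TransGen (χ.TreeEdge dot T.1 (χ.liveEdges T.1)) S.1 S'.1 ∧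
          χ.toggled T.1 S'.1.H ⊆ {c | χ.IsLive T.1 c} := by
      have hstep : ∀ {S S' : χ.ReducedSubgraph dot}, χ.toggled T.1 S.1.H ⊆ {c | χ.IsLive T.1 c} →
          (χ.reducedKhovanov dot).MorseEdge (χ.khovanovMatching dot) S S' →
          toColex (deadB S.1) = toColex (deadB S'.1) →
          χ.TreeEdge dot T.1 (χ.liveEdges T.1) S.1 S'.1 ∧
            χ.toggled T.1 S'.1.H ⊆ {c | χ.IsLive T.1 c} := by
        intro S S' hS h h'
        rcases key T hS h with h | h
        · have := h.1.2.1
          rw [coe_liveEdges] at this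
          exact ⟨h.1, this⟩
        · exact (h.ne h').elim
      intro S' h
      induction h with
      | single h => exact ⟨.single (hstep hS h.1 h.2).1, (hstep hS h.1 h.2).2⟩
      | tail _ h ih =>
        have h2 := hstep ih.2 h.1 h.2
        exact ⟨ih.1.tail h2.1, h2.2⟩
    exact not_transGen_treeEdge (isRootedSubtree_liveEdges T.2 dot) _ (h1 S h).1

theorem isAcyclicMatching_khovanovMatching (χ : D.Checkerboard) (dot : Arc) :
    (χ.reducedKhovanov dot).IsAcyclicMatching (χ.khovanovMatching dot) where
  hasseEdge S S' h := by
    obtain ⟨e, he⟩ := isTerm_of_khovanovMatching h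
    exact ⟨iDeg_of_toggle he.toggle he.1, (isUnit_inc_of_isTerm he).ne_zero⟩
  matching S₁ S₂ S₃ S₄ h h' := by
    have hdeg : ∀ {S S' : χ.ReducedSubgraph dot}, χ.khovanovMatching dot S S' →
        S'.1.iDeg = S.1.iDeg + 1 := fun h =>
      let ⟨_, he⟩ := isTerm_of_khovanovMatching h
      iDeg_of_toggle he.toggle he.1
    have h1 := hdeg h
    have h2 := hdeg h'
    rintro (rfl | rfl | rfl | rfl)
    · exact ⟨rfl, khovanovMatching_unique (Or.inl h) (Or.inl h')⟩
    · obtain rfl := khovanovMatching_unique (Or.inl h) (Or.inr h')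
      omega
    · obtain rfl := khovanovMatching_unique (Or.inr h) (Or.inl h')
      omega
    · exact ⟨khovanovMatching_unique (Or.inr h) (Or.inr h'), rfl⟩
  isUnit S S' h := by
    obtain ⟨e, he⟩ := isTerm_of_khovanovMatching h
    exact isUnit_inc_of_isTerm he
  acyclic := not_transGen_morseEdge

theorem isCriticalFor_iff (T : χ.SpanningTree) (S : χ.ReducedSubgraph dot) :
    χ.IsCriticalFor dot T S ↔ χ.toggled T.1 S.1.H ⊆ (χ.liveEdges T.1 : Finset C) ∧
      ∀ S', ¬ χ.Matched dot T.1 (χ.liveEdges T.1) S.1 S' := by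
  unfold IsCriticalFor
  rw [inTwistedUnknot_iff, coe_liveEdges]
  refine and_congr_right fun hS => ?_
  unfold IsCritical
  simp only [khovanovMatching_iff T hS, khovanovMatching_iff_right T hS, ← not_or]
  refine ⟨fun h S' hM => ?_, fun h S' => h S'.1⟩
  rw [← coe_liveEdges] at hS
  have h1 := (Matched.preserves (isRootedSubtree_liveEdges T.2 dot) _ _ hM hS).2.1
  exact h ⟨S', h1.trans S.2⟩ hM

theorem existsUnique_isCriticalFor (dot : Arc) (T : χ.SpanningTree) :
    ∃! S : χ.ReducedSubgraph dot, χ.IsCriticalFor dot T S := by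
  have hconn : ∀ a, EdgeConn (χ.face₁ (χ.treeState T.1)) (χ.face₂ (χ.treeState T.1))
      (χ.liveEdges T.1 : Set C) (χ.face (χ.treeState T.1) a) (χ.face (χ.treeState T.1) dot) := by
    rw [coe_liveEdges]
    exact fun a => edgeConn_liveEdges T.2 _ _
  obtain ⟨S, ⟨h1, h2, -, h4⟩, hu⟩ :=
    existsUnique_unmatched (isRootedSubtree_liveEdges T.2 dot) fun _ => .one
  refine ⟨⟨S, h2⟩, (isCriticalFor_iff T _).2 ⟨h1, h4⟩, fun S' h => Subtype.ext ?_⟩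
  obtain ⟨h5, h6⟩ := (isCriticalFor_iff T _).1 h
  exact hu S'.1 ⟨h5, S'.2, fun a ha => (ha (hconn a)).elim, h6⟩

theorem isCriticalFor_criticalSubgraph (dot : Arc) (T : χ.SpanningTree) :
    χ.IsCriticalFor dot T (χ.criticalSubgraph dot T) :=
  Classical.epsilon_spec (existsUnique_isCriticalFor dot T).exists

theorem criticalSubgraph_injective (χ : D.Checkerboard) (dot : Arc) :
    Function.Injective (χ.criticalSubgraph dot) := by
  intro T T' h
  have h1 := (isCriticalFor_criticalSubgraph dot T).1
  have h2 := (isCriticalFor_criticalSubgraph dot T').1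
  rw [← h] at h2
  rw [inTwistedUnknot_iff] at h1 h2
  exact Subtype.ext (spanningTree_unique T.2 T'.2 h1 h2)

theorem isCritical_iff_mem_range (S : χ.ReducedSubgraph dot) :
    IsCritical (χ.khovanovMatching dot) S ↔ S ∈ Set.range (χ.criticalSubgraph dot) := by
  constructor
  · intro h
    obtain ⟨T, hS⟩ := exists_inTwistedUnknot S.1
    exact ⟨T, (existsUnique_isCriticalFor dot T).unique (isCriticalFor_criticalSubgraph dot T)
      ⟨(inTwistedUnknot_iff _).2 hS, h⟩⟩
  · rintro ⟨T, rfl⟩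
    exact (isCriticalFor_criticalSubgraph dot T).2

end Main

end ConnectedLinkDiagram.Checkerboard

theorem theorem1p1 {Arc C : Type*} [Finite Arc] [Fintype C] [LinearOrder C]
    (D : ConnectedLinkDiagram Arc C) (χ : D.Checkerboard) (dot : Arc) :
    (χ.reducedKhovanov dot).IsAcyclicMatching (χ.khovanovMatching dot) ∧
    (∀ T : χ.SpanningTree, ∃! S : χ.ReducedSubgraph dot, χ.IsCriticalFor dot T S) ∧
    (χ.reducedKhovanov dot).IsComplex ∧
    (χ.reducedSpanningTreeComplex dot).IsComplex ∧
    ∀ i j : ℤ, Nonempty ((χ.reducedSpanningTreeComplex dot).Cohomology i j ≃ₗ[ℤ]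
      (χ.reducedKhovanov dot).Cohomology i j) := by
  have hM := χ.isAcyclicMatching_khovanovMatching dot
  have hK := χ.isComplex_reducedKhovanov dot
  refine ⟨hM, ConnectedLinkDiagram.Checkerboard.existsUnique_isCriticalFor dot, hK, ?_⟩
  exact BasedComplex.morse_complex (χ.reducedSpanningTreeComplex dot) hM
    (χ.isHomogeneous_reducedKhovanov dot) hK (χ.criticalSubgraph_injective dot)
    ConnectedLinkDiagram.Checkerboard.isCritical_iff_mem_range (fun _ => rfl) (fun _ => rfl)
    fun _ _ => rfl
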